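/- Theorem 1.4. For $t\ge 0$ let $(-\Delta)^{t/2}$ be the Fourier multiplier with symbol $|\xi|^t$ (in the convention in which $-\Delta$ has symbol $|\xi|^2$), defined on $L^2(\mathbb{R}^n)$ in the sense of tempered distributions. For $s\in(0,1)$ and $K:\mathbb{R}^n\times\mathbb{R}^n\to[0,\infty)$ put \[ \mathcal{L}^s_K(u,\varphi)=\int_{\mathbb{R}^n}\int_{\mathbb{R}^n}\frac{K(x,y)\,(u(x)-u(y))\,(\varphi(x)-\varphi(y))}{|x-y|^{n+2s}}\,dx\,dy , \] and say that $u\in H^s(\mathbb{R}^n)$ solves $\mathcal{L}^s_K u=(-\Delta)^{s/2}f$ in $\mathbb{R}^n$, where $f\in L^2(\mathbb{R}^n)$, if $\mathcal{L}^s_K(u,\varphi)=\int_{\mathbb{R}^n} f\,(-\Delta)^{s/2}\varphi\,dx$ for all $\varphi\in C_c^\infty(\mathbb{R}^n)$. Let $n\ge 1$ and $\theta>0$. There exists $\varepsilon>0$, depending only on $\theta$ and $n$, such that for all $s,s_1,s_2\in(\theta,1-\theta)$ with $s_1+s_2=2s$ and $s_1\ge s$, and all $p\in[2,\frac1\theta)$,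 there is a constant $C>0$, depending only on $n,s,s_1,s_2,p,\theta$, such that the following holds. Let $K:\mathbb{R}^n\times\mathbb{R}^n\to[0,\infty)$ be measurable with $0<\sup K<\infty$ and $1-\frac{\inf K}{\sup K}<\varepsilon$, and let $u\in H^s(\mathbb{R}^n)$ and $f\in L^2(\mathbb{R}^n)$ (complex-valued) be such that $u$ solves $\mathcal{L}^s_K u=(-\Delta)^{s/2}f$ in $\mathbb{R}^n$. If $(-\Delta)^{\frac{s-s_2}{2}}f\in L^p(\mathbb{R}^n)$, then $(-\Delta)^{\frac{s_1}{2}}u\in L^p(\mathbb{R}^n)$ and \[ \|(-\Delta)^{\frac{s_1}{2}}u\|_{L^p(\mathbb{R}^n)}\le \frac{C}{\sup K}\,\|(-\Delta)^{\frac{s-s_2}{2}}f\|_{L^p(\mathbb{R}^n)} . \] In particular, for any $s,s_1,s_2\in(0,1)$ with $s_1+s_2=2s$, $s_1\ge s$ and any $p\in[2,\infty)$ such an $\varepsilon>0$ exists. -/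

import Mathlib

open MeasureTheory FourierTransform
open scoped SchwartzMap

noncomputable section

/-- The fractional Laplacian `(-Δ)^{t/2}` of a Schwartz function `φ` on `ℝⁿ`, for `t ≥ 0`: the
inverse Fourier transform of `(2π|ξ|)^t 𝓕φ(ξ)`. With the convention
`𝓕φ(ξ) = ∫ e^{-2πi⟨x,ξ⟩} φ(x) dx`, the symbol of `-Δ` is `(2π|ξ|)²`. -/
def fracLaplacian {n : ℕ} (t : ℝ) (φ : 𝓢(EuclideanSpace ℝ (Fin n), ℂ)) :
    EuclideanSpace ℝ (Fin n) → ℂ :=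
  𝓕⁻ (fun ξ : EuclideanSpace ℝ (Fin n) ↦
    (((2 * Real.pi * ‖ξ‖) ^ t : ℝ) : ℂ) * 𝓕 (φ : EuclideanSpace ℝ (Fin n) → ℂ) ξ)

/-- `(-Δ)^{t/2} w = g` in the sense of tempered distributions, for `w ∈ L²(ℝⁿ)` and
`g ∈ L^q(ℝⁿ)`. For `t ≥ 0` and `φ` Schwartz the function `(-Δ)^{t/2} φ` lies in `L²(ℝⁿ)`, so both
integrals converge absolutely; `g` is determined by `w` and `t`. -/
def HasFracLaplacian {n : ℕ} {q : ENNReal} (t : ℝ)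
    (w : Lp ℂ 2 (volume : Measure (EuclideanSpace ℝ (Fin n))))
    (g : Lp ℂ q (volume : Measure (EuclideanSpace ℝ (Fin n)))) : Prop :=
  ∀ φ : 𝓢(EuclideanSpace ℝ (Fin n), ℂ),
    ∫ x, w x * fracLaplacian t φ x = ∫ x, g x * φ x

/-- The form
`𝓛ˢ_K(u, φ) = ∬ K(x,y) (u(x) - u(y)) (φ(x) - φ(y)) / |x - y|^{n+2s} dx dy`. -/
def nonlocalForm {n : ℕ} (s : ℝ)
    (K : EuclideanSpace ℝ (Fin n) × EuclideanSpace ℝ (Fin n) → ℝ)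
    (u φ : EuclideanSpace ℝ (Fin n) → ℂ) : ℂ :=
  ∫ z : EuclideanSpace ℝ (Fin n) × EuclideanSpace ℝ (Fin n),
    (K z : ℂ) * (u z.1 - u z.2) * (φ z.1 - φ z.2) / ((‖z.1 - z.2‖ ^ ((n : ℝ) + 2 * s) : ℝ) : ℂ)

/-- `u` solves `𝓛ˢ_K u = (-Δ)^{s/2} f` weakly in `ℝⁿ`:
`𝓛ˢ_K(u, φ) = ∫ f (-Δ)^{s/2} φ` for all test functions `φ ∈ C_c^∞(ℝⁿ)`. -/
def IsWeakSolution {n : ℕ} (s : ℝ)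
    (K : EuclideanSpace ℝ (Fin n) × EuclideanSpace ℝ (Fin n) → ℝ)
    (u f : Lp ℂ 2 (volume : Measure (EuclideanSpace ℝ (Fin n)))) : Prop :=
  ∀ φ : 𝓢(EuclideanSpace ℝ (Fin n), ℂ), HasCompactSupport φ →
    nonlocalForm s K u φ = ∫ x, f x * fracLaplacian s φ x

end

/-!
Let `w = (-Δ)^{s/2} u`. The increments of `u` are the increments of the Riesz potential of `w`
(`potIncr_ae_eq_sub`), so the form is a bilinear form in the fractional derivatives of `u` and of
the test function. Write the coefficient as `Λ (1 - ε κ)` with `Λ = sup K` and `|κ| ≤ 1`. By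
Plancherel the constant coefficient contributes a multiple `γ` of the `L²` pairing
(`exists_integral_lift_mul`), with `γ` bounded above and below as long as the order stays in
`(θ, 1 - θ)`; and the functions `(-Δ)^{s/2} φ` with `φ` a test function are total in `L²`
(`eq_zero_of_integral_rpow_mul_fourier`). So `u` is a weak solution only if
`γ w - ε T w = f / Λ` in `L²` (`smul_sub_incrOp_eq`), where `T = T_{s,s}` is the operator of the form
with coefficient `κ` (`incrOp`).

The operators `T_{σ₁,σ₂}` of the forms with weight `|h|^{-d-σ₁-σ₂}`, increments of the potential of
order `σ₁` of the first argument and of order `σ₂` of the second, satisfy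
`(-Δ)^{τ/2} T_{s,s} = T_{s₁,s₂} (-Δ)^{τ/2}` for `τ = s₁ - s = s - s₂` (`IsFracPow.incrOp`), for the
simple reason that the increments of the potentials of order `σ` of `F` and of order `σ + τ` of
`(-Δ)^{τ/2} F` are the same. Hence `(-Δ)^{s₁/2} u = (-Δ)^{τ/2} w` solves an equation of the same type
with data `(-Δ)^{τ/2} f / Λ`, and the estimate follows for small `ε` by a Neumann series as soon as
the `T_{σ₁,σ₂}` are bounded on `L^p`, uniformly in `κ`, in the orders and in `2 ≤ p < 1/θ`
(`exists_eLpNorm'_incrOp_le`). As `(-Δ)^{τ/2} f` lies in `L^p` but need not lie in `L²`, the data are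
mollified (`exists_isFracPow_near`), the equations are solved in `L²`, and the `L^p` bounds pass to
the limit (`exists_hasFracPow_of_eq_add_apply`).

The `L^p` bound is Calderón–Zygmund theory. The kernels of the `T_{σ₁,σ₂}` have no regularity, `κ`
being merely bounded and measurable, but absolute values suffice, as for fixed `h` the increments of
the Riesz kernel have good `L¹` bounds: total mass `|h|^σ`, tail `|h| R^{σ-1}` and modulus
of continuity `|z|^σ` (`exists_rieszIncr_bound`). Integrated over `h` they give
Hörmander's condition in the form `∫ |T b| ≤ A ∫ |b|` off the tripled ball, for mean-zero `b`
supported in a ball (`exists_hormanderBound_incrOp`). With the `L²` bound this yields the weak type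
`(1, 1)` (`mul_volume_lt_enorm_le`), and then, since the transpose of `T_{σ₁,σ₂}` is `T_{σ₂,σ₁}`, the
range `2 ≤ p < 1/θ` by interpolation and duality (`exists_eLpNorm'_apply_le`).
-/

noncomputable section

namespace NonlocalCZ

set_option linter.unusedSectionVars false

open Filter Topology
open scoped ENNReal NNReal ContDiff

variable {E : Type*} [NormedAddCommGroup E] [InnerProductSpace ℝ E] [FiniteDimensional ℝ E]
  [MeasurableSpace E] [BorelSpace E]


/-! ### Fourier transform on `L²` and convolutions -/

lemma integral_mul_fourierInv_schwartz (f : Lp ℂ 2 (volume : Measure E)) (φ : 𝓢(E, ℂ)) :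
    ∫ x, f x * (𝓕⁻ φ) x = ∫ x, (𝓕⁻ f : Lp ℂ 2 (volume : Measure E)) x * φ x := by
  have h := DFunLike.congr_fun (Lp.fourierInv_toTemperedDistribution_eq f) φ
  rw [TemperedDistribution.fourierInv_apply, Lp.toTemperedDistribution_apply,
    Lp.toTemperedDistribution_apply] at h
  simpa [mul_comm] using h

lemma integral_mul_fourierInv (f g : Lp ℂ 2 (volume : Measure E)) :
    ∫ x, f x * (𝓕⁻ g : Lp ℂ 2 (volume : Measure E)) x =
      ∫ x, (𝓕⁻ f : Lp ℂ 2 (volume : Measure E)) x * g x := by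
  have key : ∀ a b : Lp ℂ 2 (volume : Measure E), ∫ x, a x * b x =
      ((ContinuousLinearMap.mul ℂ ℂ).lpPairing volume 2 2 a) b := by
    intro a b
    rw [ContinuousLinearMap.lpPairing_eq_integral]
    rfl
  refine DenseRange.induction_on (p := fun g : Lp ℂ 2 (volume : Measure E) ↦
      ∫ x, f x * (𝓕⁻ g : Lp ℂ 2 (volume : Measure E)) x =
      ∫ x, (𝓕⁻ f : Lp ℂ 2 (volume : Measure E)) x * g x)
    (SchwartzMap.denseRange_toLpCLM (p := 2) ENNReal.ofNat_ne_top) g ?_ ?_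
  · simp_rw [key]
    apply isClosed_eq
    · exact (((ContinuousLinearMap.mul ℂ ℂ).lpPairing volume 2 2 f)).continuous.comp
        (Lp.fourierTransformₗᵢ E ℂ).symm.continuous
    · exact (((ContinuousLinearMap.mul ℂ ℂ).lpPairing volume 2 2 _)).continuous
  · intro φ
    have h1 : (𝓕⁻ (SchwartzMap.toLpCLM ℝ (E := E) ℂ 2 volume φ) : Lp ℂ 2 (volume : Measure E))
        = (𝓕⁻ φ).toLp 2 := by
      rw [SchwartzMap.toLpCLM_apply, SchwartzMap.toLp_fourierInv_eq]
    rw [h1]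
    have h2 := integral_mul_fourierInv_schwartz f φ
    calc _ = ∫ x, f x * (𝓕⁻ φ) x := by
          apply integral_congr_ae
          filter_upwards [(𝓕⁻ φ).coeFn_toLp 2 volume] with x hx
          rw [hx]
      _ = _ := h2
      _ = _ := by
          apply integral_congr_ae
          filter_upwards [φ.coeFn_toLp 2 volume] with x hx
          rw [SchwartzMap.toLpCLM_apply, hx]

/-- Two locally integrable functions with equal integrals against all Schwartz functions agree
almost everywhere. -/
lemma ae_eq_of_integral_mul_schwartz {f g : E → ℂ} (hf : LocallyIntegrable f)
    (hg : LocallyIntegrable g)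
    (h : ∀ φ : 𝓢(E, ℂ), HasCompactSupport φ → ∫ x, f x * φ x = ∫ x, g x * φ x) :
    f =ᵐ[volume] g := by
  refine ae_eq_of_integral_contDiff_smul_eq hf hg fun ψ hψ hψc ↦ ?_
  have hc : HasCompactSupport (fun x ↦ (ψ x : ℂ)) := hψc.comp_left (g := ((↑) : ℝ → ℂ)) (by simp)
  have hs : ContDiff ℝ ∞ (fun x ↦ (ψ x : ℂ)) := Complex.ofRealCLM.contDiff.comp hψ
  have := h (hc.toSchwartzMap hs) (by exact hc)
  simpa [mul_comm] using this

lemma locallyIntegrable_Lp {p : ℝ≥0∞} [Fact (1 ≤ p)] (f : Lp ℂ p (volume : Measure E)) :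
    LocallyIntegrable f volume := (Lp.memLp f).locallyIntegrable Fact.out

/-- On `L¹ ∩ L²` the inverse Fourier transform of `L²` is the inverse Fourier integral. -/
lemma fourierInv_toLp_ae {F : E → ℂ} (h1 : Integrable F) (h2 : MemLp F 2) :
    (𝓕⁻ (h2.toLp F) : Lp ℂ 2 (volume : Measure E)) =ᵐ[volume] 𝓕⁻ F := by
  have hcont : Continuous (𝓕⁻ F) := by
    rw [Real.fourierInv_eq_fourier_comp_neg]
    exact VectorFourier.fourierIntegral_continuous Real.continuous_fourierChar
      (L := innerₗ E) continuous_inner h1.comp_neg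
  refine ae_eq_of_integral_mul_schwartz (locallyIntegrable_Lp _)
    hcont.locallyIntegrable fun φ _ ↦ ?_
  rw [← integral_mul_fourierInv_schwartz]
  have e1 : ∫ x, (h2.toLp F) x * (𝓕⁻ φ) x = ∫ x, F x * (𝓕⁻ φ) x := by
    apply integral_congr_ae
    filter_upwards [h2.coeFn_toLp] with x hx
    rw [hx]
  rw [e1, SchwartzMap.fourierInv_coe]
  have := VectorFourier.integral_fourierIntegral_smul_eq_flip (L := -innerₗ E) (μ := volume)
    (ν := volume) (f := F) (g := φ) Real.continuous_fourierChar
    (by simp only [LinearMap.neg_apply]; exact continuous_inner.neg) h1 φ.integrable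
  simp only [smul_eq_mul] at this
  symm
  convert this using 1
  · congr! 2 with x
  · congr! 2 with x
    simp [Real.fourierInv_eq, VectorFourier.fourierIntegral, real_inner_comm]

/-- Jensen's inequality for the measure with density `k`. -/
lemma lintegral_mul_rpow_le {α : Type*} [MeasurableSpace α] {μ : Measure α} {k f : α → ℝ≥0∞}
    (hk : AEMeasurable k μ) (hf : AEMeasurable f μ) {p : ℝ} (hp : 1 ≤ p) :
    (∫⁻ x, k x * f x ∂μ) ^ p ≤ (∫⁻ x, k x ∂μ) ^ (p - 1) * ∫⁻ x, k x * f x ^ p ∂μ := by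
  rcases hp.eq_or_lt with rfl | hp
  · simp
  have hpq : (p / (p - 1)).HolderConjugate p := by
    have := (Real.HolderConjugate.conjExponent hp).symm
    simpa [Real.conjExponent] using this
  have hp0 : 0 < p := by linarith
  have h := ENNReal.lintegral_mul_le_Lp_mul_Lq μ hpq (f := fun x ↦ k x ^ ((p - 1) / p))
    (g := fun x ↦ k x ^ (1 / p) * f x) (hk.pow_const _) ((hk.pow_const _).mul hf)
  have e1 : ∀ x, ((fun x ↦ k x ^ ((p - 1) / p)) * (fun x ↦ k x ^ (1 / p) * f x)) x
      = k x * f x := by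
    intro x
    simp only [Pi.mul_apply]
    rw [← mul_assoc, ← ENNReal.rpow_add_of_nonneg _ _ (by apply div_nonneg <;> linarith)
      (by positivity)]
    rw [← add_div]
    simp [hp0.ne']
  have e2 : ∀ x, (k x ^ ((p - 1) / p)) ^ (p / (p - 1)) = k x := by
    intro x
    rw [← ENNReal.rpow_mul]
    have : (p - 1) / p * (p / (p - 1)) = 1 := by
      have : p - 1 ≠ 0 := by linarith
      field_simp
    rw [this, ENNReal.rpow_one]
  have e3 : ∀ x, (k x ^ (1 / p) * f x) ^ p = k x * f x ^ p := by
    intro x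
    rw [ENNReal.mul_rpow_of_nonneg _ _ hp0.le, ← ENNReal.rpow_mul]
    simp [hp0.ne']
  simp only [e1, e2, e3] at h
  calc _ ≤ _ := ENNReal.rpow_le_rpow h hp0.le
    _ = _ := by
      rw [ENNReal.mul_rpow_of_nonneg _ _ hp0.le, ← ENNReal.rpow_mul, ← ENNReal.rpow_mul]
      have : 1 / (p / (p - 1)) * p = p - 1 := by
        have : p - 1 ≠ 0 := by linarith
        field_simp
      rw [this]
      simp [hp0.ne']

/-- Young's inequality `‖K * f‖_p ≤ ‖K‖_1 ‖f‖_p`. -/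
lemma lintegral_conv_rpow_le {K f : E → ℝ≥0∞} (hK : Measurable K) (hf : Measurable f)
    {p : ℝ} (hp : 1 ≤ p) :
    ∫⁻ x, (∫⁻ y, K (x - y) * f y) ^ p ≤ (∫⁻ x, K x) ^ p * ∫⁻ x, f x ^ p := by
  have hp0 : 0 < p := by linarith
  calc _ ≤ ∫⁻ x, (∫⁻ y, K (x - y)) ^ (p - 1) * ∫⁻ y, K (x - y) * f y ^ p := by
        refine lintegral_mono fun x ↦ lintegral_mul_rpow_le ?_ hf.aemeasurable hp
        exact (hK.comp (measurable_const.sub measurable_id)).aemeasurable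
    _ = (∫⁻ x, K x) ^ (p - 1) * ∫⁻ x, ∫⁻ y, K (x - y) * f y ^ p := by
        simp_rw [lintegral_sub_left_eq_self K]
        rw [lintegral_const_mul]
        apply Measurable.lintegral_prod_right' (f := fun z : E × E ↦ K (z.1 - z.2) * f z.2 ^ p)
        fun_prop
    _ = (∫⁻ x, K x) ^ (p - 1) * ∫⁻ y, ∫⁻ x, K (x - y) * f y ^ p := by
        rw [lintegral_lintegral_swap]
        apply Measurable.aemeasurable
        simp only [Function.uncurry_def]
        fun_prop
    _ = (∫⁻ x, K x) ^ (p - 1) * ((∫⁻ x, K x) * ∫⁻ y, f y ^ p) := by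
        congr 1
        rw [← lintegral_const_mul _ (by fun_prop)]
        refine lintegral_congr fun y ↦ ?_
        rw [lintegral_mul_const _ (by fun_prop), lintegral_sub_right_eq_self K]
    _ = _ := by
        rw [← mul_assoc]
        congr 1
        conv_lhs => rw [← ENNReal.rpow_one (∫⁻ x, K x), ← ENNReal.rpow_mul, one_mul]
        rw [← ENNReal.rpow_add_of_nonneg _ _ (by linarith) zero_le_one]
        simp

lemma ae_lintegral_conv_lt_top {K f : E → ℝ≥0∞} (hK : Measurable K) (hf : Measurable f)
    {p : ℝ} (hp : 1 ≤ p) (hK1 : ∫⁻ x, K x ≠ ⊤) (hfp : ∫⁻ x, f x ^ p ≠ ⊤) :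
    ∀ᵐ x, ∫⁻ y, K (x - y) * f y < ⊤ := by
  have hp0 : 0 < p := by linarith
  have h : ∫⁻ x, (∫⁻ y, K (x - y) * f y) ^ p ≠ ⊤ :=
    ((lintegral_conv_rpow_le hK hf hp).trans_lt (ENNReal.mul_lt_top
      (ENNReal.rpow_lt_top_of_nonneg hp0.le hK1) hfp.lt_top)).ne
  filter_upwards [ae_lt_top' (Measurable.aemeasurable (by
    apply Measurable.pow_const
    apply Measurable.lintegral_prod_right' (f := fun z : E × E ↦ K (z.1 - z.2) * f z.2)
    fun_prop)) h] with x hx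
  by_contra hc
  simp only [not_lt, top_le_iff] at hc
  rw [hc, ENNReal.top_rpow_of_pos hp0] at hx
  exact lt_irrefl _ hx

/-- Convolution of an integrable kernel with a function, `(k * w)(x) = ∫ k(x - y) w(y) dy`.
Its value is `0` at the points where the integrand is not integrable, a null set for `k ∈ L¹` and
`w ∈ L^p`. -/
def conv (k w : E → ℂ) (x : E) : ℂ := ∫ y, k (x - y) * w y

lemma measurable_conv {k w : E → ℂ} (hk : Measurable k) (hw : Measurable w) :
    Measurable (conv k w) := by
  have : StronglyMeasurable (fun z : E × E ↦ k (z.1 - z.2) * w z.2) := by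
    apply Measurable.stronglyMeasurable
    fun_prop
  exact this.integral_prod_right.measurable

lemma enorm_conv_le (k w : E → ℂ) (x : E) : ‖conv k w x‖ₑ ≤ ∫⁻ y, ‖k (x - y)‖ₑ * ‖w y‖ₑ := by
  refine (enorm_integral_le_lintegral_enorm _).trans (le_of_eq ?_)
  simp [enorm_mul]

lemma lintegral_enorm_rpow_ne_top {α : Type*} [MeasurableSpace α] {μ : Measure α} {w : α → ℂ}
    {p : ℝ} (hp : 1 ≤ p) (hw : MemLp w (ENNReal.ofReal p) μ) : ∫⁻ x, ‖w x‖ₑ ^ p ∂μ ≠ ⊤ := by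
  have := lintegral_rpow_enorm_lt_top_of_eLpNorm_lt_top (p := ENNReal.ofReal p)
    (by simp; linarith) (by simp) hw.2
  rw [ENNReal.toReal_ofReal (by linarith)] at this
  exact this.ne

lemma ae_integrable_conv {k w : E → ℂ} (hk : Measurable k) (hw : Measurable w) {p : ℝ}
    (hp : 1 ≤ p) (hk1 : Integrable k) (hwp : MemLp w (ENNReal.ofReal p)) :
    ∀ᵐ x, Integrable (fun y ↦ k (x - y) * w y) := by
  filter_upwards [ae_lintegral_conv_lt_top hk.enorm hw.enorm hp hk1.2.ne
    (lintegral_enorm_rpow_ne_top hp hwp)] with x hx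
  refine ⟨by fun_prop, ?_⟩
  simpa [HasFiniteIntegral, enorm_mul] using hx

lemma lintegral_enorm_conv_rpow_le {k w : E → ℂ} (hk : Measurable k) (hw : Measurable w) {p : ℝ}
    (hp : 1 ≤ p) :
    ∫⁻ x, ‖conv k w x‖ₑ ^ p ≤ (∫⁻ x, ‖k x‖ₑ) ^ p * ∫⁻ x, ‖w x‖ₑ ^ p := by
  refine le_trans (lintegral_mono fun x ↦ ?_) (lintegral_conv_rpow_le hk.enorm hw.enorm hp)
  exact ENNReal.rpow_le_rpow (enorm_conv_le k w x) (by linarith)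

lemma memLp_conv {k w : E → ℂ} (hk : Measurable k) (hw : Measurable w) {p : ℝ}
    (hp : 1 ≤ p) (hk1 : Integrable k) (hwp : MemLp w (ENNReal.ofReal p)) :
    MemLp (conv k w) (ENNReal.ofReal p) := by
  refine ⟨(measurable_conv hk hw).aestronglyMeasurable, ?_⟩
  rw [eLpNorm_lt_top_iff_lintegral_rpow_enorm_lt_top (by simp; linarith) (by simp),
    ENNReal.toReal_ofReal (by linarith)]
  exact (lintegral_enorm_conv_rpow_le hk hw hp).trans_lt (ENNReal.mul_lt_top
    (ENNReal.rpow_lt_top_of_nonneg (by linarith) hk1.2.ne)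
    (lintegral_enorm_rpow_ne_top hp hwp).lt_top)

lemma memLp_two_conv {k w : E → ℂ} (hk : Measurable k) (hw : Measurable w)
    (hk1 : Integrable k) (hwp : MemLp w 2) : MemLp (conv k w) 2 := by
  have : (2 : ℝ≥0∞) = ENNReal.ofReal 2 := by simp
  rw [this] at hwp ⊢
  exact memLp_conv hk hw one_le_two hk1 hwp

lemma continuous_fourierInv {F : E → ℂ} (h1 : Integrable F) : Continuous (𝓕⁻ F) := by
  rw [Real.fourierInv_eq_fourier_comp_neg]
  exact VectorFourier.fourierIntegral_continuous Real.continuous_fourierChar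
    (L := innerₗ E) continuous_inner h1.comp_neg

lemma norm_fourierInv_le (F : E → ℂ) (x : E) : ‖𝓕⁻ F x‖ ≤ ∫ y, ‖F y‖ := by
  rw [Real.fourierInv_eq]
  exact (norm_integral_le_integral_norm _).trans (le_of_eq (by simp))

/-- Fubini for `∫ (k * w) ψ`: the adjoint of convolution with `k` is convolution with `k(-·)`. -/
lemma integral_conv_mul {k w ψ : E → ℂ} (hk : Measurable k) (hw : Measurable w)
    (hψ : Measurable ψ) {p q : ℝ} (hpq : p.HolderConjugate q) (hk1 : Integrable k)
    (hwp : MemLp w (ENNReal.ofReal p)) (hψq : MemLp ψ (ENNReal.ofReal q)) :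
    ∫ x, conv k w x * ψ x = ∫ y, w y * ∫ x, k (x - y) * ψ x := by
  have hint : Integrable (fun z : E × E ↦ k (z.1 - z.2) * w z.2 * ψ z.1) (volume.prod volume) := by
    refine ⟨by fun_prop, ?_⟩
    rw [HasFiniteIntegral, lintegral_prod _ (by fun_prop)]
    have e : ∀ x, ∫⁻ y, ‖k (x - y) * w y * ψ x‖ₑ
        = (∫⁻ y, ‖k (x - y)‖ₑ * ‖w y‖ₑ) * ‖ψ x‖ₑ := by
      intro x
      simp_rw [enorm_mul]
      rw [lintegral_mul_const _ (by fun_prop)]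
    simp_rw [e]
    refine (ENNReal.lintegral_mul_le_Lp_mul_Lq volume hpq ?_ (by fun_prop)).trans_lt ?_
    · apply Measurable.aemeasurable
      apply Measurable.lintegral_prod_right'
        (f := fun z : E × E ↦ ‖k (z.1 - z.2)‖ₑ * ‖w z.2‖ₑ)
      fun_prop
    · apply ENNReal.mul_lt_top
      · refine ENNReal.rpow_lt_top_of_nonneg (by have := hpq.pos; positivity) (ne_of_lt ?_)
        refine (lintegral_conv_rpow_le hk.enorm hw.enorm hpq.lt.le).trans_lt ?_
        exact ENNReal.mul_lt_top (ENNReal.rpow_lt_top_of_nonneg hpq.pos.le hk1.2.ne)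
          (lintegral_enorm_rpow_ne_top hpq.lt.le hwp).lt_top
      · exact ENNReal.rpow_lt_top_of_nonneg (by have := hpq.symm.pos; positivity)
          (lintegral_enorm_rpow_ne_top hpq.symm.lt.le hψq)
  calc _ = ∫ x, ∫ y, k (x - y) * w y * ψ x := by
        simp_rw [conv, ← integral_mul_const]
    _ = ∫ y, ∫ x, k (x - y) * w y * ψ x := integral_integral_swap hint
    _ = _ := by
        congr 1 with y
        rw [← integral_const_mul]
        congr 1 with x
        ring

/-- The inverse Fourier transform turns a product with a transform into a convolution, here written
with the reflected kernel. -/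
lemma fourierInv_fourierInv_mul {k φ : E → ℂ} (hk1 : Integrable k) (hφ : Integrable φ) (y : E) :
    𝓕⁻ (fun ξ ↦ 𝓕⁻ k ξ * φ ξ) y = ∫ x, k (x - y) * 𝓕⁻ φ x := by
  rw [← integral_add_right_eq_self (fun x ↦ k (x - y) * 𝓕⁻ φ x) y]
  simp only [add_sub_cancel_right]
  have hint : Integrable (fun z : E × E ↦
      ((Real.fourierChar (inner ℝ z.1 (z.2 + y)) : Circle) : ℂ) * (φ z.1 * k z.2)) (volume.prod volume) := by
    refine (hφ.mul_prod hk1).bdd_mul (c := 1) ?_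
      (Eventually.of_forall fun z ↦ (Circle.norm_coe _).le)
    exact Continuous.aestronglyMeasurable (by fun_prop)
  calc _ = ∫ ξ, ∫ x, ((Real.fourierChar (inner ℝ ξ (x + y)) : Circle) : ℂ) * (φ ξ * k x) := by
        rw [Real.fourierInv_eq]
        congr 1 with ξ
        rw [Real.fourierInv_eq, ← integral_mul_const, Circle.smul_def, smul_eq_mul,
          ← integral_const_mul]
        congr 1 with x
        simp only [Circle.smul_def, smul_eq_mul, inner_add_right, AddChar.map_add_eq_mul,
          Circle.coe_mul]
        rw [real_inner_comm x ξ]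
        ring
    _ = ∫ x, ∫ ξ, ((Real.fourierChar (inner ℝ ξ (x + y)) : Circle) : ℂ) * (φ ξ * k x) :=
        integral_integral_swap hint
    _ = _ := by
        congr 1 with x
        rw [Real.fourierInv_eq, ← integral_const_mul]
        congr 1 with ξ
        simp only [Circle.smul_def, smul_eq_mul]
        ring

/-- Convolution with an integrable kernel acts on `L²` as a Fourier multiplier. -/
lemma fourierInv_conv {k w : E → ℂ} (hk : Measurable k) (hw : Measurable w)
    (hk1 : Integrable k) (hw2 : MemLp w 2) :
    (𝓕⁻ ((memLp_two_conv hk hw hk1 hw2).toLp (conv k w)) : Lp ℂ 2 (volume : Measure E)) =ᵐ[volume]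
      fun ξ ↦ 𝓕⁻ k ξ * (𝓕⁻ (hw2.toLp w) : Lp ℂ 2 (volume : Measure E)) ξ := by
  have e2 : (2 : ℝ≥0∞) = ENNReal.ofReal 2 := by simp
  refine ae_eq_of_integral_mul_schwartz (locallyIntegrable_Lp _) ?_ fun φ _ ↦ ?_
  · refine MemLp.locallyIntegrable (p := 2) ?_ (by norm_num)
    refine MemLp.of_le_mul (c := ∫ y, ‖k y‖)
      (Lp.memLp (𝓕⁻ (hw2.toLp w) : Lp ℂ 2 (volume : Measure E)))
      ((continuous_fourierInv hk1).aestronglyMeasurable.mul (Lp.aestronglyMeasurable _)) ?_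
    filter_upwards with ξ
    rw [norm_mul]
    gcongr
    exact norm_fourierInv_le k ξ
  have hG1 : Integrable (fun ξ ↦ 𝓕⁻ k ξ * φ ξ) :=
    φ.integrable.bdd_mul (c := ∫ y, ‖k y‖) (continuous_fourierInv hk1).aestronglyMeasurable
      (Eventually.of_forall (norm_fourierInv_le k))
  have hG2 : MemLp (fun ξ ↦ 𝓕⁻ k ξ * φ ξ) 2 := by
    refine MemLp.of_le_mul (c := ∫ y, ‖k y‖) (φ.memLp 2)
      ((continuous_fourierInv hk1).aestronglyMeasurable.mul φ.continuous.aestronglyMeasurable) ?_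
    filter_upwards with ξ
    rw [norm_mul]
    gcongr
    exact norm_fourierInv_le k ξ
  calc _ = ∫ x, conv k w x * (𝓕⁻ φ) x := by
        rw [← integral_mul_fourierInv_schwartz]
        apply integral_congr_ae
        filter_upwards [(memLp_two_conv hk hw hk1 hw2).coeFn_toLp] with x hx
        rw [hx]
    _ = ∫ y, w y * ∫ x, k (x - y) * (𝓕⁻ φ) x := by
        rw [e2] at hw2
        refine integral_conv_mul hk hw (𝓕⁻ φ).continuous.measurable
          Real.HolderConjugate.two_two hk1 hw2 ?_
        rw [← e2]
        exact (𝓕⁻ φ).memLp 2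
    _ = ∫ y, w y * 𝓕⁻ (fun ξ ↦ 𝓕⁻ k ξ * φ ξ) y := by
        congr 1 with y
        rw [fourierInv_fourierInv_mul hk1 φ.integrable, SchwartzMap.fourierInv_coe]
    _ = ∫ y, hw2.toLp w y * (𝓕⁻ (hG2.toLp _) : Lp ℂ 2 (volume : Measure E)) y := by
        apply integral_congr_ae
        filter_upwards [hw2.coeFn_toLp, fourierInv_toLp_ae hG1 hG2] with y h1 h2
        rw [h1, h2]
    _ = _ := by
        rw [integral_mul_fourierInv]
        apply integral_congr_ae
        filter_upwards [hG2.coeFn_toLp] with y h1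
        rw [h1]
        ring

/-! ### Increments of Gaussians -/

lemma lintegral_comp_smul_of_pos (f : E → ℝ≥0∞) {r : ℝ} (hr : 0 < r) :
    ∫⁻ x, f (r • x) = ENNReal.ofReal ((r ^ Module.finrank ℝ E)⁻¹) * ∫⁻ x, f x := by
  have h := lintegral_map_equiv (μ := (volume : Measure E)) f
    (Homeomorph.smulOfNeZero r hr.ne' : E ≃ₜ E).toMeasurableEquiv
  have h2 : Measure.map (Homeomorph.smulOfNeZero r hr.ne' : E ≃ₜ E).toMeasurableEquiv volume
      = ENNReal.ofReal ((r ^ Module.finrank ℝ E)⁻¹) • (volume : Measure E) := by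
    have := Measure.map_addHaar_smul (volume : Measure E) hr.ne'
    rw [abs_of_pos (by positivity)] at this
    exact this
  rw [h2, lintegral_smul_measure] at h
  exact h.symm

/-- The Gaussian `e^{-π|x|²}`. -/
def gauss (x : E) : ℝ := Real.exp (-Real.pi * ‖x‖ ^ 2)

lemma gauss_pos (x : E) : 0 < gauss x := Real.exp_pos _

@[fun_prop]
lemma continuous_gauss : Continuous (gauss (E := E)) := by unfold gauss; fun_prop

lemma gauss_le (k : ℕ) (x : E) :
    gauss x ≤ (k.factorial * Real.exp 2) * ((1 + ‖x‖) ^ k)⁻¹ := by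
  have h1 := Real.pow_div_factorial_le_exp (1 + ‖x‖) (by positivity) k
  have hp : (0 : ℝ) < (1 + ‖x‖) ^ k := by positivity
  rw [← div_eq_mul_inv, le_div_iff₀ hp]
  rw [div_le_iff₀ (by positivity)] at h1
  calc gauss x * (1 + ‖x‖) ^ k ≤ gauss x * (Real.exp (1 + ‖x‖) * k.factorial) := by
        gcongr
        exact (gauss_pos x).le
    _ = k.factorial * Real.exp (-Real.pi * ‖x‖ ^ 2 + (1 + ‖x‖)) := by
        rw [gauss, Real.exp_add (-Real.pi * ‖x‖ ^ 2)]; ring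
    _ ≤ k.factorial * Real.exp 2 := by
        gcongr
        nlinarith [Real.pi_gt_three, sq_nonneg (‖x‖ - 1 / 2), sq_nonneg ‖x‖]

/-- A Gaussian increment is linear in `h`, with decay of any polynomial order in `x`. -/
lemma abs_gauss_sub_le (x h : E) (hh : ‖h‖ ≤ 1) (k : ℕ) :
    |gauss (x + h) - gauss x| ≤
      (2 * Real.pi * (k + 1).factorial * Real.exp 2 * 2 ^ (k + 1)) * ‖h‖ * ((1 + ‖x‖) ^ k)⁻¹ := by
  have hx : ‖x‖ ≤ ‖x + h‖ + ‖h‖ := by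
    have := norm_sub_le (x + h) h
    simpa using this
  have hx' : ‖x + h‖ ≤ ‖x‖ + ‖h‖ := norm_add_le _ _
  obtain ⟨c, hc⟩ : ∃ c, (k + 1).factorial * Real.exp 2 = c := ⟨_, rfl⟩
  have hg1 := gauss_le (k + 1) x
  have hg2 := gauss_le (k + 1) (x + h)
  rw [hc] at hg1 hg2
  have hc0 : 0 < c := by rw [← hc]; positivity
  -- both Gaussians are dominated by the same power
  have b1 : gauss x ≤ c * 2 ^ (k + 1) * ((1 + ‖x‖) ^ (k + 1))⁻¹ := by
    refine hg1.trans ?_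
    have : (1 : ℝ) ≤ 2 ^ (k + 1) := one_le_pow₀ (by norm_num)
    gcongr
    exact le_mul_of_one_le_right hc0.le this
  have b2 : gauss (x + h) ≤ c * 2 ^ (k + 1) * ((1 + ‖x‖) ^ (k + 1))⁻¹ := by
    refine hg2.trans ?_
    rw [mul_assoc]
    gcongr
    rw [← div_eq_mul_inv, le_div_iff₀ (by positivity), inv_mul_le_iff₀ (by positivity), ← mul_pow]
    gcongr
    linarith [norm_nonneg (x + h)]
  have e1 : ∀ a b : ℝ, 0 ≤ a → a ≤ b → |Real.exp (-a) - Real.exp (-b)| ≤ (b - a) * Real.exp (-a) := by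
    intro a b _ hab
    have : Real.exp (-b) ≤ Real.exp (-a) := Real.exp_le_exp.2 (by linarith)
    rw [abs_of_nonneg (by linarith)]
    have h3 := Real.add_one_le_exp (a - b)
    have h4 : Real.exp (-b) = Real.exp (-a) * Real.exp (a - b) := by rw [← Real.exp_add]; ring_nf
    rw [h4]
    nlinarith [Real.exp_pos (-a)]
  have hd : |Real.pi * ‖x + h‖ ^ 2 - Real.pi * ‖x‖ ^ 2| ≤ 2 * Real.pi * ‖h‖ * (1 + ‖x‖) := by
    have : |‖x + h‖ - ‖x‖| ≤ ‖h‖ := by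
      rw [abs_le]; constructor <;> linarith
    have e : Real.pi * ‖x + h‖ ^ 2 - Real.pi * ‖x‖ ^ 2
      = Real.pi * ((‖x + h‖ - ‖x‖) * (‖x + h‖ + ‖x‖)) := by ring
    rw [e, abs_mul, abs_mul, abs_of_pos Real.pi_pos, abs_of_nonneg (a := ‖x + h‖ + ‖x‖)
      (by positivity)]
    have : |‖x + h‖ - ‖x‖| * (‖x + h‖ + ‖x‖) ≤ ‖h‖ * (2 * (1 + ‖x‖)) := by
      gcongr
      linarith
    nlinarith [Real.pi_pos]
  have main : |gauss (x + h) - gauss x| ≤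
      2 * Real.pi * ‖h‖ * (1 + ‖x‖) * (c * 2 ^ (k + 1) * ((1 + ‖x‖) ^ (k + 1))⁻¹) := by
    have hp := Real.pi_pos
    unfold gauss at b1 b2 ⊢
    simp only [neg_mul] at b1 b2 ⊢
    rcases le_total (Real.pi * ‖x + h‖ ^ 2) (Real.pi * ‖x‖ ^ 2) with hle | hle
    · refine (e1 _ _ (by positivity) hle).trans ?_
      rw [abs_sub_comm] at hd
      have := (le_abs_self _).trans hd
      gcongr
    · rw [abs_sub_comm]
      refine (e1 _ _ (by positivity) hle).trans ?_
      have := (le_abs_self _).trans hd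
      gcongr
  refine main.trans (le_of_eq ?_)
  rw [pow_succ (1 + ‖x‖) k, mul_assoc _ _ (Real.exp 2), hc]
  field_simp

lemma lintegral_norm_mul_gauss_lt_top :
    (∫⁻ x : E, ENNReal.ofReal ((1 + ‖x‖) * gauss x)) < ⊤ := by
  set d := Module.finrank ℝ E
  refine lt_of_le_of_lt (b := ∫⁻ x : E, ENNReal.ofReal (((d + 2).factorial * Real.exp 2)) *
    ENNReal.ofReal ((1 + ‖x‖) ^ (-((d : ℝ) + 1)))) (lintegral_mono fun x ↦ ?_) ?_
  · rw [← ENNReal.ofReal_mul (by positivity)]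
    apply ENNReal.ofReal_le_ofReal
    have h := gauss_le (d + 2) x
    calc (1 + ‖x‖) * gauss x ≤ (1 + ‖x‖) * (((d + 2).factorial * Real.exp 2) *
          ((1 + ‖x‖) ^ (d + 2))⁻¹) := by gcongr
      _ = _ := by
        rw [Real.rpow_neg (by positivity)]
        norm_cast
        rw [pow_succ (1 + ‖x‖) (d + 1)]
        field_simp
  · rw [lintegral_const_mul _ (by fun_prop)]
    exact ENNReal.mul_lt_top ENNReal.ofReal_lt_top (finite_integral_one_add_norm (by simp [d]))

/-- The zeroth and first moments of the increments of the Gaussian. -/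
lemma exists_gauss_incr_bound : ∃ C : ℝ, 0 < C ∧ ∀ h : E,
    (∫⁻ x, ‖gauss (x + h) - gauss x‖ₑ) ≤ ENNReal.ofReal (C * min 1 ‖h‖) ∧
    (∫⁻ x, ‖x‖ₑ * ‖gauss (x + h) - gauss x‖ₑ) ≤ ENNReal.ofReal (C * ‖h‖) := by
  set d := Module.finrank ℝ E
  set A := (∫⁻ x : E, ENNReal.ofReal ((1 + ‖x‖) * gauss x)).toReal with hA
  have hA' : (∫⁻ x : E, ENNReal.ofReal ((1 + ‖x‖) * gauss x)) = ENNReal.ofReal A :=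
    (ENNReal.ofReal_toReal lintegral_norm_mul_gauss_lt_top.ne).symm
  have hA0 : 0 ≤ A := ENNReal.toReal_nonneg
  have hfin := finite_integral_one_add_norm (E := E) (μ := volume) (r := d + 1) (by simp [d])
  set B := (∫⁻ x : E, ENNReal.ofReal ((1 + ‖x‖) ^ (-((d : ℝ) + 1)))).toReal with hB
  have hB' : (∫⁻ x : E, ENNReal.ofReal ((1 + ‖x‖) ^ (-((d : ℝ) + 1)))) = ENNReal.ofReal B :=
    (ENNReal.ofReal_toReal hfin.ne).symm
  have hB0 : 0 ≤ B := ENNReal.toReal_nonneg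
  set M := (2 * Real.pi * ((d + 2) + 1).factorial * Real.exp 2 * 2 ^ ((d + 2) + 1)) with hM
  have hM0 : 0 < M := by have := Real.pi_pos; positivity
  refine ⟨3 * A + M * B + 1, by positivity, fun h ↦ ?_⟩
  -- integrate the larger weight `1 + ‖x‖` in both regimes
  have hg : ∫⁻ x : E, ENNReal.ofReal (gauss x) ≤ ENNReal.ofReal A := by
    rw [← hA']
    refine lintegral_mono fun x ↦ ENNReal.ofReal_le_ofReal ?_
    nlinarith [gauss_pos x, norm_nonneg x]
  have hxg : ∫⁻ x : E, ENNReal.ofReal (‖x‖ * gauss x) ≤ ENNReal.ofReal A := by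
    rw [← hA']
    refine lintegral_mono fun x ↦ ENNReal.ofReal_le_ofReal ?_
    nlinarith [gauss_pos x, norm_nonneg x]
  rcases le_total ‖h‖ 1 with hh | hh
  · have key : ∫⁻ x : E, ENNReal.ofReal (1 + ‖x‖) * ‖gauss (x + h) - gauss x‖ₑ ≤
        ENNReal.ofReal (M * B * ‖h‖) := by
      calc _ ≤ ∫⁻ x : E, ENNReal.ofReal (M * ‖h‖) *
            ENNReal.ofReal ((1 + ‖x‖) ^ (-((d : ℝ) + 1))) := by
            refine lintegral_mono fun x ↦ ?_
            rw [← ofReal_norm, ← ENNReal.ofReal_mul (by positivity),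
              ← ENNReal.ofReal_mul (by positivity)]
            apply ENNReal.ofReal_le_ofReal
            have := abs_gauss_sub_le x h hh (d + 2)
            rw [← hM] at this
            rw [Real.norm_eq_abs]
            calc _ ≤ (1 + ‖x‖) * _ := mul_le_mul_of_nonneg_left this (by positivity)
              _ = _ := by
                rw [Real.rpow_neg (by positivity)]
                norm_cast
                rw [pow_succ (1 + ‖x‖) (d + 1)]
                field_simp
        _ = _ := by
          rw [lintegral_const_mul _ (by fun_prop), hB', ← ENNReal.ofReal_mul (by positivity)]
          ring_nf
    rw [min_eq_right hh]
    constructor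
    · refine le_trans (lintegral_mono fun x ↦ ?_) (key.trans (ENNReal.ofReal_le_ofReal ?_))
      · refine le_mul_of_one_le_left (by positivity) ?_
        simp
      · gcongr
        linarith
    · refine le_trans (lintegral_mono fun x ↦ ?_) (key.trans (ENNReal.ofReal_le_ofReal ?_))
      · gcongr
        rw [← ofReal_norm]
        exact ENNReal.ofReal_le_ofReal (by linarith)
      · gcongr
        linarith
  · rw [min_eq_left hh]
    have tri : ∀ x, ‖gauss (x + h) - gauss x‖ₑ ≤
        ENNReal.ofReal (gauss (x + h)) + ENNReal.ofReal (gauss x) := by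
      intro x
      rw [← ENNReal.ofReal_add (gauss_pos _).le (gauss_pos _).le, ← ofReal_norm]
      apply ENNReal.ofReal_le_ofReal
      rw [Real.norm_eq_abs, abs_le]
      constructor <;> linarith [gauss_pos x, gauss_pos (x + h)]
    constructor
    · calc _ ≤ ∫⁻ x, (ENNReal.ofReal (gauss (x + h)) + ENNReal.ofReal (gauss x)) :=
            lintegral_mono tri
        _ = (∫⁻ x : E, ENNReal.ofReal (gauss x)) + ∫⁻ x : E, ENNReal.ofReal (gauss x) := by
            rw [lintegral_add_left (by fun_prop),
              lintegral_add_right_eq_self (fun x : E ↦ ENNReal.ofReal (gauss x))]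
        _ ≤ ENNReal.ofReal A + ENNReal.ofReal A := by gcongr
        _ ≤ _ := by
            rw [← ENNReal.ofReal_add hA0 hA0]
            apply ENNReal.ofReal_le_ofReal
            nlinarith [mul_nonneg hM0.le hB0]
    · calc _ ≤ ∫⁻ x, (ENNReal.ofReal (‖x + h‖ * gauss (x + h)) +
              ENNReal.ofReal ‖h‖ * ENNReal.ofReal (gauss (x + h)) +
              ENNReal.ofReal (‖x‖ * gauss x)) := by
            refine lintegral_mono fun x ↦ ?_
            refine (mul_le_mul_right (tri x) _).trans ?_
            have h1 := gauss_pos x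
            have h2 := gauss_pos (x + h)
            rw [← ofReal_norm, ← ENNReal.ofReal_add h2.le h1.le,
              ← ENNReal.ofReal_mul (by positivity), ← ENNReal.ofReal_mul (by positivity),
              ← ENNReal.ofReal_add (by positivity) (by positivity),
              ← ENNReal.ofReal_add (by positivity) (by positivity)]
            apply ENNReal.ofReal_le_ofReal
            have hx : ‖x‖ ≤ ‖x + h‖ + ‖h‖ := by
              have := norm_sub_le (x + h) h
              simpa using this
            nlinarith
        _ = (∫⁻ x : E, ENNReal.ofReal (‖x‖ * gauss x)) +
              ENNReal.ofReal ‖h‖ * (∫⁻ x : E, ENNReal.ofReal (gauss x)) +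
              ∫⁻ x : E, ENNReal.ofReal (‖x‖ * gauss x) := by
            rw [lintegral_add_left (by fun_prop), lintegral_add_left (by fun_prop),
              lintegral_const_mul _ (by fun_prop),
              lintegral_add_right_eq_self (fun x : E ↦ ENNReal.ofReal (gauss x)),
              lintegral_add_right_eq_self (fun x : E ↦ ENNReal.ofReal (‖x‖ * gauss x))]
        _ ≤ ENNReal.ofReal A + ENNReal.ofReal ‖h‖ * ENNReal.ofReal A + ENNReal.ofReal A := by
            gcongr
        _ ≤ _ := by
            rw [← ENNReal.ofReal_mul (by positivity),
              ← ENNReal.ofReal_add (by positivity) (by positivity),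
              ← ENNReal.ofReal_add (by positivity) (by positivity)]
            apply ENNReal.ofReal_le_ofReal
            have h1 := mul_nonneg (mul_nonneg hM0.le hB0) (norm_nonneg h)
            nlinarith

/-- The rescaled Gaussian `r^{-d} e^{-π|x|²/r²}`. -/
def gaussScale (r : ℝ) (x : E) : ℝ := (r ^ Module.finrank ℝ E)⁻¹ * gauss (r⁻¹ • x)

@[fun_prop]
lemma measurable_gaussScale : Measurable (fun z : ℝ × E ↦ gaussScale z.1 z.2) := by
  unfold gaussScale gauss
  fun_prop

lemma lintegral_gaussScale_incr {r : ℝ} (hr : 0 < r) (h : E) (F : E → ℝ≥0∞) :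
    ∫⁻ x, F x * ‖gaussScale r (x + h) - gaussScale r x‖ₑ =
      ∫⁻ x, F (r • x) * ‖gauss (x + r⁻¹ • h) - gauss x‖ₑ := by
  have := lintegral_comp_smul_of_pos
    (fun x ↦ F x * ‖gaussScale r (x + h) - gaussScale r x‖ₑ) hr
  have hd : 0 < r ^ Module.finrank ℝ E := by positivity
  have e : ∀ x : E, ‖gaussScale r (r • x + h) - gaussScale r (r • x)‖ₑ =
      ENNReal.ofReal ((r ^ Module.finrank ℝ E)⁻¹) * ‖gauss (x + r⁻¹ • h) - gauss x‖ₑ := by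
    intro x
    rw [gaussScale, gaussScale, ← mul_sub, enorm_mul, smul_add, smul_smul, inv_mul_cancel₀ hr.ne',
      one_smul]
    congr 1
    rw [← ofReal_norm, Real.norm_of_nonneg (by positivity)]
  simp_rw [e] at this
  have h2 : ∀ x : E, F (r • x) * (ENNReal.ofReal ((r ^ Module.finrank ℝ E)⁻¹) *
      ‖gauss (x + r⁻¹ • h) - gauss x‖ₑ) = ENNReal.ofReal ((r ^ Module.finrank ℝ E)⁻¹) *
      (F (r • x) * ‖gauss (x + r⁻¹ • h) - gauss x‖ₑ) := fun x ↦ by ring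
  simp_rw [h2] at this
  rw [lintegral_const_mul' _ _ ENNReal.ofReal_ne_top] at this
  exact ((ENNReal.mul_right_inj (by simpa using hd) ENNReal.ofReal_ne_top).1 this).symm

/-- `L¹` norm of an increment of the Gaussian of scale `r`, on the whole space and off a ball. The
tail bound `‖h‖ / R` comes from the first moment and is uniform in `r`. -/
lemma exists_gaussScale_incr_bound : ∃ C : ℝ, 0 < C ∧ ∀ (h : E) (r : ℝ), 0 < r →
    (∫⁻ x, ‖gaussScale r (x + h) - gaussScale r x‖ₑ) ≤ ENNReal.ofReal (C * min 1 (‖h‖ / r)) ∧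
    ∀ R : ℝ, 0 < R →
      (∫⁻ x in {x | R ≤ ‖x‖}, ‖gaussScale r (x + h) - gaussScale r x‖ₑ) ≤
        ENNReal.ofReal (C * min (‖h‖ / R) (‖h‖ / r)) := by
  obtain ⟨C, hC, hb⟩ := exists_gauss_incr_bound (E := E)
  have key : ∀ (h : E) (r : ℝ), 0 < r →
    (∫⁻ x, ‖gaussScale r (x + h) - gaussScale r x‖ₑ) ≤
      ENNReal.ofReal (C * min 1 (‖h‖ / r)) := by
    intro h r hr
    have e1 := lintegral_gaussScale_incr hr h (fun _ ↦ 1)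
    simp only [one_mul] at e1
    rw [e1]
    refine (hb _).1.trans (le_of_eq ?_)
    rw [norm_smul, norm_inv, Real.norm_of_nonneg hr.le, inv_mul_eq_div]
  refine ⟨C, hC, fun h r hr ↦ ⟨key h r hr, fun R hR ↦ ?_⟩⟩
  rw [mul_min_of_nonneg _ _ hC.le, ENNReal.ofReal_mono.map_min]
  refine le_min ?_ ?_
  · calc _ ≤ ∫⁻ x in {x | R ≤ ‖x‖}, ENNReal.ofReal R⁻¹ *
          (‖x‖ₑ * ‖gaussScale r (x + h) - gaussScale r x‖ₑ) := by
          refine setLIntegral_mono' (measurableSet_le measurable_const measurable_norm)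
            fun x hx ↦ ?_
          rw [← mul_assoc]
          refine le_mul_of_one_le_left (by positivity) ?_
          rw [← ofReal_norm, ← ENNReal.ofReal_mul (by positivity)]
          simp only [ENNReal.one_le_ofReal]
          rw [inv_mul_eq_div, one_le_div hR]
          exact hx
      _ ≤ ∫⁻ x, ENNReal.ofReal R⁻¹ *
          (‖x‖ₑ * ‖gaussScale r (x + h) - gaussScale r x‖ₑ) := setLIntegral_le_lintegral _ _
      _ = ENNReal.ofReal R⁻¹ * ∫⁻ x : E, ‖r • x‖ₑ * ‖gauss (x + r⁻¹ • h) - gauss x‖ₑ := by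
          rw [lintegral_const_mul' _ _ ENNReal.ofReal_ne_top, lintegral_gaussScale_incr hr]
      _ = ENNReal.ofReal R⁻¹ * (ENNReal.ofReal r *
            ∫⁻ x : E, ‖x‖ₑ * ‖gauss (x + r⁻¹ • h) - gauss x‖ₑ) := by
          rw [← lintegral_const_mul' _ _ ENNReal.ofReal_ne_top]
          simp_rw [enorm_smul, mul_assoc]
          rw [← ofReal_norm, Real.norm_of_nonneg hr.le, lintegral_const_mul' _ _ (by finiteness),
            lintegral_const_mul' _ _ (by finiteness)]
      _ ≤ ENNReal.ofReal R⁻¹ * (ENNReal.ofReal r * ENNReal.ofReal (C * ‖r⁻¹ • h‖)) := by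
          gcongr
          exact (hb _).2
      _ = _ := by
          rw [← ENNReal.ofReal_mul hr.le, ← ENNReal.ofReal_mul (by positivity), norm_smul, norm_inv,
            Real.norm_of_nonneg hr.le]
          congr 1
          field_simp
  · refine (setLIntegral_le_lintegral _ _).trans ((key h r hr).trans ?_)
    apply ENNReal.ofReal_le_ofReal
    gcongr
    exact min_le_right _ _

/-- `∫₀^∞ r^{σ-1} min(1/R, 1/r) dr = R^{σ-1} (1/σ + 1/(1-σ))`, as an upper bound. -/
lemma lintegral_rpow_mul_min_le {σ : ℝ} (h0 : 0 < σ) (h1 : σ < 1) {R : ℝ} (hR : 0 < R) :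
    ∫⁻ r in Set.Ioi (0 : ℝ), ENNReal.ofReal (r ^ (σ - 1) * min (1 / R) (1 / r)) ≤
      ENNReal.ofReal ((1 / σ + 1 / (1 - σ)) * R ^ (σ - 1)) := by
  have e : Set.Ioi (0 : ℝ) = Set.Ioc 0 R ∪ Set.Ioi R := (Set.Ioc_union_Ioi_eq_Ioi hR.le).symm
  rw [e]
  refine (lintegral_union_le _ _ _).trans ?_
  have p1 : ∫⁻ r in Set.Ioc 0 R, ENNReal.ofReal (r ^ (σ - 1) * min (1 / R) (1 / r)) ≤
      ENNReal.ofReal (1 / σ * R ^ (σ - 1)) := by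
    calc _ ≤ ∫⁻ r in Set.Ioc 0 R, ENNReal.ofReal (r ^ (σ - 1) * (1 / R)) := by
          refine setLIntegral_mono' measurableSet_Ioc fun r hr ↦ ENNReal.ofReal_le_ofReal ?_
          have := hr.1
          gcongr
          exact min_le_left _ _
      _ = ENNReal.ofReal (∫ r in Set.Ioc 0 R, r ^ (σ - 1) * (1 / R)) := by
          rw [ofReal_integral_eq_lintegral_ofReal]
          · apply Integrable.mul_const
            have := intervalIntegral.intervalIntegrable_rpow' (a := 0) (b := R)
              (r := σ - 1) (by linarith)
            exact (intervalIntegrable_iff_integrableOn_Ioc_of_le hR.le).1 this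
          · refine (ae_restrict_iff' measurableSet_Ioc).2 (Eventually.of_forall fun r hr ↦ ?_)
            have := hr.1
            simp only [Pi.zero_apply]
            positivity
      _ = _ := by
          rw [integral_mul_const, ← intervalIntegral.integral_of_le hR.le,
            integral_rpow (by left; linarith)]
          congr 1
          simp only [sub_add_cancel]
          rw [Real.zero_rpow h0.ne', Real.rpow_sub_one hR.ne']
          field_simp
          ring
  have p2 : ∫⁻ r in Set.Ioi R, ENNReal.ofReal (r ^ (σ - 1) * min (1 / R) (1 / r)) ≤
      ENNReal.ofReal (1 / (1 - σ) * R ^ (σ - 1)) := by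
    calc _ ≤ ∫⁻ r in Set.Ioi R, ENNReal.ofReal (r ^ (σ - 2)) := by
          refine setLIntegral_mono' measurableSet_Ioi fun r hr ↦ ENNReal.ofReal_le_ofReal ?_
          have hr0 : 0 < r := hR.trans hr
          calc r ^ (σ - 1) * min (1 / R) (1 / r) ≤ r ^ (σ - 1) * (1 / r) := by
                gcongr
                exact min_le_right _ _
            _ = _ := by
                rw [show σ - 2 = (σ - 1) - 1 by ring, Real.rpow_sub_one hr0.ne' (σ - 1)]
                ring
      _ = ENNReal.ofReal (∫ r in Set.Ioi R, r ^ (σ - 2)) := by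
          rw [ofReal_integral_eq_lintegral_ofReal]
          · exact integrableOn_Ioi_rpow_of_lt (by linarith) hR
          · refine (ae_restrict_iff' measurableSet_Ioi).2 (Eventually.of_forall fun r hr ↦ ?_)
            have : 0 < r := hR.trans hr
            simp only [Pi.zero_apply]
            positivity
      _ = _ := by
          rw [integral_Ioi_rpow_of_lt (by linarith) hR]
          congr 1
          rw [show σ - 2 + 1 = σ - 1 by ring]
          have : 1 - σ ≠ 0 := by linarith
          have : σ - 1 ≠ 0 := by linarith
          field_simp
          ring
  refine (add_le_add p1 p2).trans (le_of_eq ?_)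
  have : 0 < 1 - σ := by linarith
  rw [← ENNReal.ofReal_add (by positivity) (by positivity)]
  ring_nf

/-! ### Riesz kernels -/

/-- The normalizing constant that gives the Riesz kernel the Fourier symbol `(2π|ξ|)^{-σ}`. -/
def rieszConst (σ : ℝ) : ℝ :=
  (∫ r in Set.Ioi (0 : ℝ), r ^ (σ - 1) * Real.exp (-Real.pi * r ^ (2 : ℝ)))⁻¹ *
    (2 * Real.pi) ^ (-σ)

lemma integrableOn_rpow_mul_gauss {σ : ℝ} (h0 : 0 < σ) {b : ℝ} (hb : 0 < b) :
    IntegrableOn (fun r : ℝ ↦ r ^ (σ - 1) * Real.exp (-b * r ^ (2 : ℝ))) (Set.Ioi 0) :=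
  integrableOn_rpow_mul_exp_neg_mul_rpow (by linarith) (by norm_num) hb

lemma integral_rpow_mul_gauss_pos {σ : ℝ} (h0 : 0 < σ) {b : ℝ} (hb : 0 < b) :
    0 < ∫ r in Set.Ioi (0 : ℝ), r ^ (σ - 1) * Real.exp (-b * r ^ (2 : ℝ)) := by
  rw [integral_rpow_mul_exp_neg_mul_rpow (by norm_num) (by linarith) hb]
  have : 0 < Real.Gamma ((σ - 1 + 1) / 2) := Real.Gamma_pos_of_pos (by linarith)
  positivity

lemma rieszConst_pos {σ : ℝ} (h0 : 0 < σ) : 0 < rieszConst σ := by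
  have := integral_rpow_mul_gauss_pos h0 Real.pi_pos
  have := Real.pi_pos
  unfold rieszConst
  positivity

/-- Since `∫₀^∞ r^{σ-1} e^{-πr²} dr ≥ e^{-π}`, the constant is bounded uniformly in `σ`. -/
lemma rieszConst_le {σ : ℝ} (h0 : 0 < σ) (h1 : σ < 1) : rieszConst σ ≤ Real.exp Real.pi := by
  have hlow : Real.exp (-Real.pi) ≤
      ∫ r in Set.Ioi (0 : ℝ), r ^ (σ - 1) * Real.exp (-Real.pi * r ^ (2 : ℝ)) := by
    calc Real.exp (-Real.pi) = ∫ r in Set.Ioc (0 : ℝ) 1, Real.exp (-Real.pi) := by simp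
      _ ≤ ∫ r in Set.Ioc (0 : ℝ) 1, r ^ (σ - 1) * Real.exp (-Real.pi * r ^ (2 : ℝ)) := by
        refine setIntegral_mono_on (by simp) ((integrableOn_rpow_mul_gauss h0 Real.pi_pos).mono_set
          Set.Ioc_subset_Ioi_self) measurableSet_Ioc fun r hr ↦ ?_
        have h2 : 1 ≤ r ^ (σ - 1) :=
          Real.one_le_rpow_of_pos_of_le_one_of_nonpos hr.1 hr.2 (by linarith)
        have h3 : r ^ (2 : ℝ) ≤ 1 := Real.rpow_le_one hr.1.le hr.2 (by norm_num)
        have h4 : Real.exp (-Real.pi) ≤ Real.exp (-Real.pi * r ^ (2 : ℝ)) :=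
          Real.exp_le_exp.2 (by nlinarith [Real.pi_pos])
        nlinarith [Real.exp_pos (-Real.pi)]
      _ ≤ _ := by
        refine setIntegral_mono_set (integrableOn_rpow_mul_gauss h0 Real.pi_pos) ?_
          (Set.Ioc_subset_Ioi_self.eventuallyLE)
        refine (ae_restrict_iff' measurableSet_Ioi).2 (Eventually.of_forall fun r hr ↦ ?_)
        have : (0 : ℝ) < r := hr
        simp only [Pi.zero_apply]
        positivity
  have h2 : (2 * Real.pi) ^ (-σ) ≤ 1 :=
    Real.rpow_le_one_of_one_le_of_nonpos (by linarith [Real.pi_gt_three]) (by linarith)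
  have h3 : (∫ r in Set.Ioi (0 : ℝ), r ^ (σ - 1) * Real.exp (-Real.pi * r ^ (2 : ℝ)))⁻¹ ≤
      Real.exp Real.pi := by
    rw [show Real.exp Real.pi = (Real.exp (-Real.pi))⁻¹ by rw [Real.exp_neg, inv_inv]]
    exact inv_anti₀ (Real.exp_pos _) hlow
  unfold rieszConst
  calc _ ≤ Real.exp Real.pi * 1 := by
        gcongr
    _ = _ := mul_one _

lemma rieszConst_mul_integral {σ : ℝ} (h0 : 0 < σ) {ρ : ℝ} (hρ : 0 < ρ) :
    rieszConst σ * ∫ r in Set.Ioi (0 : ℝ), r ^ (σ - 1) * Real.exp (-(Real.pi * ρ ^ 2) * r ^ (2 : ℝ))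
      = (2 * Real.pi * ρ) ^ (-σ) := by
  have hp := Real.pi_pos
  rw [rieszConst, integral_rpow_mul_exp_neg_mul_rpow (by norm_num) (by linarith) hp,
    integral_rpow_mul_exp_neg_mul_rpow (by norm_num) (by linarith) (by positivity),
    Real.mul_rpow (x := Real.pi) hp.le (by positivity), Real.mul_rpow (x := 2 * Real.pi)
    (by positivity) hρ.le]
  have hG : 0 < Real.Gamma ((σ - 1 + 1) / 2) := Real.Gamma_pos_of_pos (by linarith)
  have e : (ρ ^ 2) ^ (-(σ - 1 + 1) / 2) = ρ ^ (-σ) := by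
    rw [← Real.rpow_natCast ρ 2, ← Real.rpow_mul hρ.le]
    congr 1
    push_cast
    ring
  rw [e]
  have : 0 < Real.pi ^ (-(σ - 1 + 1) / 2) := by positivity
  field_simp

/-- The increment `R_σ(x + h) - R_σ(x)` of the Riesz kernel `R_σ` of `(-Δ)^{-σ/2}`, written as a
superposition of increments of Gaussians; unlike `R_σ` itself it is integrable over the space. -/
def rieszIncr (σ : ℝ) (h x : E) : ℝ :=
  rieszConst σ * ∫ r in Set.Ioi (0 : ℝ), r ^ (σ - 1) * (gaussScale r (x + h) - gaussScale r x)

@[fun_prop]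
lemma measurable_rieszIncr (σ : ℝ) : Measurable (fun z : E × E ↦ rieszIncr σ z.1 z.2) := by
  unfold rieszIncr
  apply Measurable.const_mul
  have : StronglyMeasurable (fun w : (E × E) × ℝ ↦ w.2 ^ (σ - 1) *
      (gaussScale w.2 (w.1.2 + w.1.1) - gaussScale w.2 w.1.2)) := by
    apply Measurable.stronglyMeasurable
    have h1 : Measurable (fun w : (E × E) × ℝ ↦ gaussScale w.2 (w.1.2 + w.1.1)) :=
      measurable_gaussScale.comp (g := fun z : ℝ × E ↦ gaussScale z.1 z.2)
        (f := fun w : (E × E) × ℝ ↦ (w.2, w.1.2 + w.1.1)) (by fun_prop)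
    have h2 : Measurable (fun w : (E × E) × ℝ ↦ gaussScale w.2 w.1.2) :=
      measurable_gaussScale.comp (g := fun z : ℝ × E ↦ gaussScale z.1 z.2)
        (f := fun w : (E × E) × ℝ ↦ (w.2, w.1.2)) (by fun_prop)
    fun_prop
  exact this.integral_prod_right.measurable

@[fun_prop]
lemma measurable_rieszIncr_right (σ : ℝ) (h : E) : Measurable (rieszIncr σ h) :=
  (measurable_rieszIncr σ).comp (g := fun z : E × E ↦ rieszIncr σ z.1 z.2) (f := fun x ↦ (h, x))
    (by fun_prop)

lemma measurable_gaussIncr (σ : ℝ) (h : E) : Measurable (fun z : ℝ × E ↦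
    z.1 ^ (σ - 1) * (gaussScale z.1 (z.2 + h) - gaussScale z.1 z.2)) := by
  have h1 : Measurable (fun z : ℝ × E ↦ gaussScale z.1 (z.2 + h)) :=
      measurable_gaussScale.comp (g := fun z : ℝ × E ↦ gaussScale z.1 z.2)
        (f := fun z : ℝ × E ↦ (z.1, z.2 + h)) (by fun_prop)
  fun_prop

/-- Tonelli for the superposition defining `rieszIncr`, over a part of the space. -/
lemma lintegral_gaussIncr_swap (σ : ℝ) (h : E) (S : Set E) :
    ∫⁻ x in S, ∫⁻ r in Set.Ioi (0 : ℝ),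
      ‖r ^ (σ - 1) * (gaussScale r (x + h) - gaussScale r x)‖ₑ =
    ∫⁻ r in Set.Ioi (0 : ℝ), ENNReal.ofReal (r ^ (σ - 1)) *
      ∫⁻ x in S, ‖gaussScale r (x + h) - gaussScale r x‖ₑ := by
  rw [lintegral_lintegral_swap]
  · refine setLIntegral_congr_fun measurableSet_Ioi fun r hr ↦ ?_
    have hr : (0 : ℝ) < r := hr
    rw [← lintegral_const_mul' _ _ (by finiteness)]
    refine lintegral_congr fun x ↦ ?_
    rw [enorm_mul, ← ofReal_norm (r ^ (σ - 1)), Real.norm_of_nonneg (by positivity)]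
  · apply Measurable.aemeasurable
    have := (measurable_gaussIncr σ h).comp measurable_swap
    exact this.enorm

lemma enorm_rieszIncr_le {σ : ℝ} (h0 : 0 < σ) (h x : E) :
    ‖rieszIncr σ h x‖ₑ ≤ ENNReal.ofReal (rieszConst σ) * ∫⁻ r in Set.Ioi (0 : ℝ),
      ‖r ^ (σ - 1) * (gaussScale r (x + h) - gaussScale r x)‖ₑ := by
  rw [rieszIncr, enorm_mul, ← ofReal_norm (rieszConst σ), Real.norm_of_nonneg (rieszConst_pos h0).le]
  gcongr
  exact enorm_integral_le_lintegral_enorm _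

lemma exists_lintegral_gaussIncr_bound : ∃ C : ℝ, 0 < C ∧ ∀ σ : ℝ, 0 < σ → σ < 1 → ∀ h : E,
    (∫⁻ x, ∫⁻ r in Set.Ioi (0 : ℝ), ‖r ^ (σ - 1) * (gaussScale r (x + h) - gaussScale r x)‖ₑ) ≤
      ENNReal.ofReal (C * (1 / σ + 1 / (1 - σ)) * ‖h‖ ^ σ) ∧
    ∀ R : ℝ, 0 < R → (∫⁻ x in {x | R ≤ ‖x‖}, ∫⁻ r in Set.Ioi (0 : ℝ),
      ‖r ^ (σ - 1) * (gaussScale r (x + h) - gaussScale r x)‖ₑ) ≤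
      ENNReal.ofReal (C * (1 / σ + 1 / (1 - σ)) * (‖h‖ * R ^ (σ - 1))) := by
  obtain ⟨C, hC, hb⟩ := exists_gaussScale_incr_bound (E := E)
  refine ⟨C, hC, fun σ h0 h1 h ↦ ⟨?_, fun R hR ↦ ?_⟩⟩
  · rcases eq_or_ne h 0 with rfl | hh
    · simp
    have hn : 0 < ‖h‖ := norm_pos_iff.2 hh
    have := lintegral_gaussIncr_swap σ h Set.univ
    simp only [Measure.restrict_univ] at this
    rw [this]
    calc _ ≤ ∫⁻ r in Set.Ioi (0 : ℝ), ENNReal.ofReal (C * ‖h‖) *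
          ENNReal.ofReal (r ^ (σ - 1) * min (1 / ‖h‖) (1 / r)) := by
          refine setLIntegral_mono' measurableSet_Ioi fun r hr ↦ ?_
          have hr : (0 : ℝ) < r := hr
          refine (mul_le_mul_right (hb h r hr).1 _).trans (le_of_eq ?_)
          rw [← ENNReal.ofReal_mul (by positivity), ← ENNReal.ofReal_mul (by positivity)]
          congr 1
          have : min 1 (‖h‖ / r) = ‖h‖ * min (1 / ‖h‖) (1 / r) := by
            rw [mul_min_of_nonneg _ _ hn.le, mul_one_div_cancel hn.ne', mul_one_div]
          rw [this]
          ring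
      _ ≤ _ := by
          rw [lintegral_const_mul' _ _ (by finiteness)]
          refine (mul_le_mul_right (lintegral_rpow_mul_min_le h0 h1 hn) _).trans (le_of_eq ?_)
          rw [← ENNReal.ofReal_mul (by positivity), Real.rpow_sub_one hn.ne']
          congr 1
          field_simp
  · rw [lintegral_gaussIncr_swap]
    calc _ ≤ ∫⁻ r in Set.Ioi (0 : ℝ), ENNReal.ofReal (C * ‖h‖) *
          ENNReal.ofReal (r ^ (σ - 1) * min (1 / R) (1 / r)) := by
          refine setLIntegral_mono' measurableSet_Ioi fun r hr ↦ ?_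
          have hr : (0 : ℝ) < r := hr
          refine (mul_le_mul_right ((hb h r hr).2 R hR) _).trans (le_of_eq ?_)
          rw [← ENNReal.ofReal_mul (by positivity), ← ENNReal.ofReal_mul (by positivity)]
          congr 1
          have : min (‖h‖ / R) (‖h‖ / r) = ‖h‖ * min (1 / R) (1 / r) := by
            rw [mul_min_of_nonneg _ _ (norm_nonneg _), mul_one_div, mul_one_div]
          rw [this]
          ring
      _ ≤ _ := by
          rw [lintegral_const_mul' _ _ (by finiteness)]
          refine (mul_le_mul_right (lintegral_rpow_mul_min_le h0 h1 hR) _).trans (le_of_eq ?_)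
          rw [← ENNReal.ofReal_mul (by positivity)]
          congr 1
          ring

lemma integrable_gaussIncr {σ : ℝ} (h0 : 0 < σ) (h1 : σ < 1) (h : E) :
    Integrable (fun z : E × ℝ ↦ z.2 ^ (σ - 1) * (gaussScale z.2 (z.1 + h) - gaussScale z.2 z.1))
      ((volume : Measure E).prod (volume.restrict (Set.Ioi (0 : ℝ)))) := by
  obtain ⟨C, hC, hb⟩ := exists_lintegral_gaussIncr_bound (E := E)
  have hm : Measurable (fun z : E × ℝ ↦ z.2 ^ (σ - 1) *
      (gaussScale z.2 (z.1 + h) - gaussScale z.2 z.1)) :=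
    (measurable_gaussIncr σ h).comp measurable_swap
  refine ⟨hm.aestronglyMeasurable, ?_⟩
  rw [HasFiniteIntegral, lintegral_prod _ hm.enorm.aemeasurable]
  exact ((hb σ h0 h1 h).1).trans_lt ENNReal.ofReal_lt_top

/-- Second differences of the Riesz kernel are symmetric in the two increments. -/
lemma rieszIncr_add_sub_ae {σ : ℝ} (h0 : 0 < σ) (h1 : σ < 1) (h z : E) :
    ∀ᵐ x, rieszIncr σ h (x + z) - rieszIncr σ h x = rieszIncr σ z (x + h) - rieszIncr σ z x := by
  have key : ∀ h : E, ∀ᵐ x : E, Integrable (fun r : ℝ ↦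
      r ^ (σ - 1) * (gaussScale r (x + h) - gaussScale r x)) (volume.restrict (Set.Ioi 0)) :=
    fun h ↦ (integrable_gaussIncr h0 h1 h).prod_right_ae
  have k1 : ∀ᵐ x : E, Integrable (fun r : ℝ ↦
      r ^ (σ - 1) * (gaussScale r (x + z + h) - gaussScale r (x + z)))
      (volume.restrict (Set.Ioi 0)) :=
    (measurePreserving_add_right volume z).quasiMeasurePreserving.ae (key h)
  have k2 : ∀ᵐ x : E, Integrable (fun r : ℝ ↦
      r ^ (σ - 1) * (gaussScale r (x + h + z) - gaussScale r (x + h)))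
      (volume.restrict (Set.Ioi 0)) :=
    (measurePreserving_add_right volume h).quasiMeasurePreserving.ae (key z)
  filter_upwards [key h, key z, k1, k2] with x a1 a2 a3 a4
  unfold rieszIncr
  rw [← mul_sub, ← mul_sub, ← integral_sub a3 a1, ← integral_sub a4 a2]
  congr 2 with r
  rw [add_right_comm x z h]
  ring

/-- The bounds on the Riesz kernel increments that drive the Calderón-Zygmund theory: total mass,
tail, and `L¹` modulus of continuity. -/
lemma exists_rieszIncr_bound {θ : ℝ} (hθ : 0 < θ) : ∃ C : ℝ, 0 < C ∧
    ∀ σ ∈ Set.Ioo θ (1 - θ), ∀ h : E,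
    (∫⁻ x, ‖rieszIncr σ h x‖ₑ) ≤ ENNReal.ofReal (C * ‖h‖ ^ σ) ∧
    (∀ R : ℝ, 0 < R → (∫⁻ x in {x | R ≤ ‖x‖}, ‖rieszIncr σ h x‖ₑ) ≤
      ENNReal.ofReal (C * (‖h‖ * R ^ (σ - 1)))) ∧
    ∀ z : E, (∫⁻ x, ‖rieszIncr σ h (x + z) - rieszIncr σ h x‖ₑ) ≤
      ENNReal.ofReal (C * ‖z‖ ^ σ) := by
  obtain ⟨C, hC, hb⟩ := exists_lintegral_gaussIncr_bound (E := E)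
  set A := Real.exp Real.pi * (C * (1 / θ + 1 / θ))
  have hA : 0 < A := by positivity
  have hc : ∀ σ ∈ Set.Ioo θ (1 - θ), rieszConst σ * (C * (1 / σ + 1 / (1 - σ))) ≤ A := by
    intro σ hσ
    have h1 : 0 < σ := hθ.trans hσ.1
    have h2 : θ < 1 - σ := by linarith [hσ.2]
    have h3 : 0 < 1 - σ := hθ.trans h2
    have := rieszConst_le h1 (by linarith)
    have := rieszConst_pos h1
    have h4 : 1 / σ ≤ 1 / θ := one_div_le_one_div_of_le hθ hσ.1.le
    have h5 : 1 / (1 - σ) ≤ 1 / θ := one_div_le_one_div_of_le hθ h2.le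
    exact mul_le_mul (by assumption) (mul_le_mul_of_nonneg_left (add_le_add h4 h5) hC.le)
      (by positivity) (by positivity)
  have tot : ∀ σ ∈ Set.Ioo θ (1 - θ), ∀ h : E, (∫⁻ x, ‖rieszIncr σ h x‖ₑ) ≤
      ENNReal.ofReal (A * ‖h‖ ^ σ) := by
    intro σ hσ h
    have h1 : 0 < σ := hθ.trans hσ.1
    refine (lintegral_mono fun x ↦ enorm_rieszIncr_le h1 h x).trans ?_
    rw [lintegral_const_mul' _ _ (by finiteness)]
    refine (mul_le_mul_right (hb σ h1 (by linarith [hσ.2]) h).1 _).trans ?_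
    rw [← ENNReal.ofReal_mul (rieszConst_pos h1).le, ← mul_assoc]
    apply ENNReal.ofReal_le_ofReal
    gcongr
    exact hc σ hσ
  refine ⟨2 * A, by positivity, fun σ hσ h ↦ ⟨(tot σ hσ h).trans ?_, fun R hR ↦ ?_, fun z ↦ ?_⟩⟩
  · apply ENNReal.ofReal_le_ofReal
    gcongr
    linarith
  · have h1 : 0 < σ := hθ.trans hσ.1
    refine (lintegral_mono fun x ↦ enorm_rieszIncr_le h1 h x).trans ?_
    rw [lintegral_const_mul' _ _ (by finiteness)]
    refine (mul_le_mul_right ((hb σ h1 (by linarith [hσ.2]) h).2 R hR) _).trans ?_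
    rw [← ENNReal.ofReal_mul (rieszConst_pos h1).le, ← mul_assoc]
    apply ENNReal.ofReal_le_ofReal
    refine mul_le_mul_of_nonneg_right ((hc σ hσ).trans ?_) (by positivity)
    linarith
  · have h1 : 0 < σ := hθ.trans hσ.1
    -- The second difference is symmetric in `h` and `z`, so the total mass for the increment `z`
    -- bounds it, uniformly in `h`.
    calc _ = ∫⁻ x, ‖rieszIncr σ z (x + h) - rieszIncr σ z x‖ₑ := by
          apply lintegral_congr_ae
          filter_upwards [rieszIncr_add_sub_ae h1 (by linarith [hσ.2]) h z] with x hx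
          rw [hx]
      _ ≤ ∫⁻ x, (‖rieszIncr σ z (x + h)‖ₑ + ‖rieszIncr σ z x‖ₑ) :=
          lintegral_mono fun x ↦ enorm_sub_le
      _ = (∫⁻ x, ‖rieszIncr σ z x‖ₑ) + ∫⁻ x, ‖rieszIncr σ z x‖ₑ := by
          rw [lintegral_add_right _ (by fun_prop),
            lintegral_add_right_eq_self (fun x ↦ ‖rieszIncr σ z x‖ₑ)]
      _ ≤ ENNReal.ofReal (A * ‖z‖ ^ σ) + ENNReal.ofReal (A * ‖z‖ ^ σ) :=
          add_le_add (tot σ hσ z) (tot σ hσ z)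
      _ = _ := by
          rw [← ENNReal.ofReal_add (by positivity) (by positivity)]
          ring_nf

lemma integrable_rieszIncr {σ : ℝ} (h0 : 0 < σ) (h1 : σ < 1) (h : E) :
    Integrable (fun x ↦ (rieszIncr σ h x : ℂ)) := by
  have := ((integrable_gaussIncr h0 h1 h).integral_prod_left).const_mul (rieszConst σ)
  exact this.ofReal

lemma integrable_gauss : Integrable (gauss (E := E)) := by
  refine ⟨continuous_gauss.aestronglyMeasurable, ?_⟩
  refine lt_of_le_of_lt (lintegral_mono fun x ↦ ?_) (lintegral_norm_mul_gauss_lt_top (E := E))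
  rw [← ofReal_norm, Real.norm_of_nonneg (gauss_pos x).le]
  apply ENNReal.ofReal_le_ofReal
  nlinarith [gauss_pos x, norm_nonneg x]

lemma integrable_gaussScale {r : ℝ} (hr : 0 < r) : Integrable (gaussScale (E := E) r) :=
  (integrable_gauss.comp_smul (inv_ne_zero hr.ne')).const_mul _

lemma fourierInv_gaussScale {r : ℝ} (hr : 0 < r) (ξ : E) :
    ∫ x, (Real.fourierChar (inner ℝ x ξ) : Circle) • (gaussScale r x : ℂ) =
      (Real.exp (-(Real.pi * ‖ξ‖ ^ 2) * r ^ (2 : ℝ)) : ℂ) := by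
  have h := fourier_gaussian_innerProductSpace (V := E) (b := (Real.pi / r ^ 2 : ℝ))
    (by rw [Complex.ofReal_re]; have := Real.pi_pos; positivity) (-ξ)
  rw [Real.fourier_eq] at h
  have hr2 : (0 : ℝ) < r ^ Module.finrank ℝ E := by positivity
  have e1 : ∀ x : E, (Real.fourierChar (inner ℝ x ξ) : Circle) • (gaussScale r x : ℂ) =
      ((r ^ Module.finrank ℝ E)⁻¹ : ℝ) • ((Real.fourierChar (-inner ℝ x (-ξ)) : Circle) •
        Complex.exp (-((Real.pi / r ^ 2 : ℝ) : ℂ) * (‖x‖ : ℂ) ^ 2)) := by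
    intro x
    rw [inner_neg_right, neg_neg, smul_comm]
    congr 1
    rw [gaussScale, gauss, norm_smul, norm_inv, Real.norm_of_nonneg hr.le, Complex.real_smul]
    push_cast
    congr 2
    field_simp
  simp_rw [e1]
  rw [integral_smul, h]
  have e2 : (Real.pi / ((Real.pi / r ^ 2 : ℝ) : ℂ)) = ((r ^ 2 : ℝ) : ℂ) := by
    push_cast
    have : (Real.pi : ℂ) ≠ 0 := by exact_mod_cast Real.pi_ne_zero
    field_simp
  have e3 : (((r ^ 2 : ℝ) : ℂ)) ^ ((Module.finrank ℝ E : ℂ) / 2) =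
      ((r ^ Module.finrank ℝ E : ℝ) : ℂ) := by
    have : ((Module.finrank ℝ E : ℂ) / 2) = (((Module.finrank ℝ E : ℝ) / 2 : ℝ) : ℂ) := by
      push_cast; ring
    rw [this, ← Complex.ofReal_cpow (by positivity)]
    congr 1
    rw [← Real.rpow_natCast r 2, ← Real.rpow_mul hr.le, ← Real.rpow_natCast]
    congr 1
    push_cast
    ring
  rw [e2, e3, Complex.real_smul, ← mul_assoc, ← Complex.ofReal_mul, inv_mul_cancel₀ hr2.ne',
    Complex.ofReal_one, one_mul, norm_neg, Complex.ofReal_exp]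
  congr 1
  push_cast
  have : (Real.pi : ℂ) ≠ 0 := by exact_mod_cast Real.pi_ne_zero
  have : (r : ℂ) ≠ 0 := by exact_mod_cast hr.ne'
  norm_num
  field_simp

/-- The Fourier symbol of the Riesz kernel increment. -/
lemma fourierInv_rieszIncr {σ : ℝ} (h0 : 0 < σ) (h1 : σ < 1) (h ξ : E) :
    𝓕⁻ (fun x ↦ (rieszIncr σ h x : ℂ)) ξ =
      (((Real.fourierChar (-inner ℝ h ξ) : Circle) : ℂ) - 1) *
        (((2 * Real.pi * ‖ξ‖) ^ (-σ) : ℝ) : ℂ) := by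
  have hint : Integrable (fun z : E × ℝ ↦ ((Real.fourierChar (inner ℝ z.1 ξ) : Circle) : ℂ) *
      ((z.2 ^ (σ - 1) * (gaussScale z.2 (z.1 + h) - gaussScale z.2 z.1) : ℝ) : ℂ))
      ((volume : Measure E).prod (volume.restrict (Set.Ioi (0 : ℝ)))) := by
    refine (integrable_gaussIncr h0 h1 h).ofReal.bdd_mul (c := 1) ?_
      (Eventually.of_forall fun z ↦ (Circle.norm_coe _).le)
    exact Continuous.aestronglyMeasurable (by fun_prop)
  have step : 𝓕⁻ (fun x ↦ (rieszIncr σ h x : ℂ)) ξ = rieszConst σ *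
      ∫ r in Set.Ioi (0 : ℝ), ((r ^ (σ - 1) : ℝ) : ℂ) *
        ((((Real.fourierChar (-inner ℝ h ξ) : Circle) : ℂ) - 1) *
          (Real.exp (-(Real.pi * ‖ξ‖ ^ 2) * r ^ (2 : ℝ)) : ℂ)) := by
    calc _ = ∫ x, rieszConst σ * ∫ r in Set.Ioi (0 : ℝ),
          ((Real.fourierChar (inner ℝ x ξ) : Circle) : ℂ) *
          ((r ^ (σ - 1) * (gaussScale r (x + h) - gaussScale r x) : ℝ) : ℂ) := by
          rw [Real.fourierInv_eq]
          congr 1 with x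
          rw [rieszIncr, Complex.ofReal_mul, ← integral_complex_ofReal, integral_const_mul,
            Circle.smul_def, smul_eq_mul]
          ring
      _ = rieszConst σ * ∫ r in Set.Ioi (0 : ℝ), ∫ x : E,
          ((Real.fourierChar (inner ℝ x ξ) : Circle) : ℂ) *
          ((r ^ (σ - 1) * (gaussScale r (x + h) - gaussScale r x) : ℝ) : ℂ) := by
          rw [integral_const_mul, integral_integral_swap hint]
      _ = _ := by
          congr 1
          refine setIntegral_congr_fun measurableSet_Ioi fun r hr ↦ ?_
          have hr : (0 : ℝ) < r := hr
          have i1 : Integrable (fun x : E ↦ (Real.fourierChar (inner ℝ x ξ) : Circle) •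
              (gaussScale r x : ℂ)) := by
            have := (integrable_gaussScale (E := E) hr).ofReal (𝕜 := ℂ)
            simp_rw [Circle.smul_def, smul_eq_mul]
            refine this.bdd_mul (c := 1) (Continuous.aestronglyMeasurable (by fun_prop))
              (Eventually.of_forall fun z ↦ (Circle.norm_coe _).le)
          have i2 := (i1.comp_add_right h).const_mul
            ((Real.fourierChar (-inner ℝ h ξ) : Circle) : ℂ)
          have e : ∀ x : E, ((Real.fourierChar (inner ℝ x ξ) : Circle) : ℂ) *
              ((r ^ (σ - 1) * (gaussScale r (x + h) - gaussScale r x) : ℝ) : ℂ) =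
              ((r ^ (σ - 1) : ℝ) : ℂ) * (((Real.fourierChar (-inner ℝ h ξ) : Circle) : ℂ) *
                ((Real.fourierChar (inner ℝ (x + h) ξ) : Circle) • (gaussScale r (x + h) : ℂ)) -
              (Real.fourierChar (inner ℝ x ξ) : Circle) • (gaussScale r x : ℂ)) := by
            intro x
            simp only [Circle.smul_def, smul_eq_mul]
            rw [← mul_assoc ((Real.fourierChar (-inner ℝ h ξ) : Circle) : ℂ), ← Circle.coe_mul,
              ← AddChar.map_add_eq_mul, inner_add_left, neg_add_cancel_comm_assoc]
            push_cast
            ring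
          simp_rw [e]
          rw [integral_const_mul, integral_sub i2 i1, integral_const_mul,
            integral_add_right_eq_self (fun x : E ↦
              (Real.fourierChar (inner ℝ x ξ) : Circle) • (gaussScale r x : ℂ)),
            fourierInv_gaussScale hr]
          ring
  rw [step]
  rcases eq_or_ne ξ 0 with rfl | hξ
  · simp
  · rw [← rieszConst_mul_integral h0 (norm_pos_iff.2 hξ)]
    push_cast
    rw [← integral_complex_ofReal, mul_left_comm,
      ← integral_const_mul (((Real.fourierChar (-inner ℝ h ξ) : Circle) : ℂ) - 1)]
    refine congrArg _ (integral_congr_ae (Eventually.of_forall fun r ↦ ?_))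
    simp only
    push_cast
    ring

/-! ### The symbol of the Gagliardo seminorm -/

/-- Radial power integrals near the origin and near infinity. -/
lemma exists_radial_bound [Nontrivial E] {δ : ℝ} (hδ : 0 < δ) : ∃ K : ℝ, 0 < K ∧
    ∀ R : ℝ, 0 < R →
    (∫⁻ h : E in {h | ‖h‖ ≤ R}, ENNReal.ofReal (‖h‖ ^ (δ - Module.finrank ℝ E))) ≤
      ENNReal.ofReal (K * R ^ δ) ∧
    (∫⁻ h : E in {h | R ≤ ‖h‖}, ENNReal.ofReal (‖h‖ ^ (-δ - Module.finrank ℝ E))) ≤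
      ENNReal.ofReal (K * R ^ (-δ)) := by
  set d := Module.finrank ℝ E with hd
  have hd1 : 1 ≤ d := Module.finrank_pos
  -- the two integrals over the unit scale
  have near : Integrable (fun h : E ↦ (Set.Iic (1 : ℝ)).indicator
      (fun y ↦ y ^ (δ - d)) ‖h‖) := by
    rw [integrable_fun_norm_addHaar volume (f := (Set.Iic (1 : ℝ)).indicator
      (fun y ↦ y ^ (δ - d)))]
    have h1 : IntegrableOn (fun y : ℝ ↦ y ^ (δ - 1)) (Set.Ioc 0 1) := by
      have := intervalIntegral.intervalIntegrable_rpow' (a := 0) (b := 1)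
              (r := δ - 1) (by linarith)
      exact (intervalIntegrable_iff_integrableOn_Ioc_of_le zero_le_one).1 this
    have h2 := h1.integrable_indicator measurableSet_Ioc
    refine h2.integrableOn.congr_fun ?_ measurableSet_Ioi
    intro y hy
    have hy : 0 < y := hy
    simp only [smul_eq_mul]
    by_cases hy1 : y ≤ 1
    · rw [Set.indicator_of_mem (by exact ⟨hy, hy1⟩), Set.indicator_of_mem (by exact hy1),
        ← Real.rpow_natCast, ← Real.rpow_add hy]
      congr 1
      rw [← hd]
      push_cast [Nat.cast_sub hd1]
      ring
    · rw [Set.indicator_of_notMem (by simp [hy1]), Set.indicator_of_notMem (by simpa using hy1),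
        mul_zero]
  have far : Integrable (fun h : E ↦ (Set.Ici (1 : ℝ)).indicator
      (fun y ↦ y ^ (-δ - d)) ‖h‖) := by
    rw [integrable_fun_norm_addHaar volume (f := (Set.Ici (1 : ℝ)).indicator
      (fun y ↦ y ^ (-δ - d)))]
    have h1 : IntegrableOn (fun y : ℝ ↦ y ^ (-δ - 1)) (Set.Ici 1) :=
      (integrableOn_Ici_iff_integrableOn_Ioi).2
        (integrableOn_Ioi_rpow_of_lt (by linarith) zero_lt_one)
    have h2 := h1.integrable_indicator measurableSet_Ici
    refine h2.integrableOn.congr_fun ?_ measurableSet_Ioi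
    intro y hy
    have hy : 0 < y := hy
    simp only [smul_eq_mul]
    by_cases hy1 : 1 ≤ y
    · rw [Set.indicator_of_mem (by exact hy1), Set.indicator_of_mem (by exact hy1),
        ← Real.rpow_natCast, ← Real.rpow_add hy]
      congr 1
      rw [← hd]
      push_cast [Nat.cast_sub hd1]
      ring
    · rw [Set.indicator_of_notMem (by simpa using hy1), Set.indicator_of_notMem (by simpa using hy1),
        mul_zero]
  have lnear : ∫⁻ h : E in {h | ‖h‖ ≤ 1}, ENNReal.ofReal (‖h‖ ^ (δ - d)) < ⊤ := by
    rw [← lintegral_indicator (measurableSet_le measurable_norm measurable_const)]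
    refine lt_of_le_of_lt (lintegral_mono fun h ↦ ?_) near.2
    by_cases hh : ‖h‖ ≤ 1
    · beta_reduce
      rw [Set.indicator_of_mem (by exact hh), Set.indicator_of_mem (by exact hh), ← ofReal_norm,
        Real.norm_of_nonneg (by positivity)]
    · rw [Set.indicator_of_notMem (by exact hh)]; positivity
  have lfar : ∫⁻ h : E in {h | 1 ≤ ‖h‖}, ENNReal.ofReal (‖h‖ ^ (-δ - d)) < ⊤ := by
    rw [← lintegral_indicator (measurableSet_le measurable_const measurable_norm)]
    refine lt_of_le_of_lt (lintegral_mono fun h ↦ ?_) far.2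
    by_cases hh : 1 ≤ ‖h‖
    · beta_reduce
      rw [Set.indicator_of_mem (by exact hh), Set.indicator_of_mem (by exact hh), ← ofReal_norm,
        Real.norm_of_nonneg (by positivity)]
    · rw [Set.indicator_of_notMem (by exact hh)]; positivity
  -- scaling reduces every radius to the unit scale
  have scale : ∀ (a : ℝ) (P : ℝ → Prop) (_ : MeasurableSet {y | P y}) (R : ℝ), 0 < R →
      ∫⁻ h : E in {h | P (R⁻¹ * ‖h‖)}, ENNReal.ofReal (‖h‖ ^ (a - d)) =
        ENNReal.ofReal (R ^ a) * ∫⁻ h : E in {h | P ‖h‖}, ENNReal.ofReal (‖h‖ ^ (a - d)) := by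
    intro a P hP R hR
    have m1 : MeasurableSet {h : E | P (R⁻¹ * ‖h‖)} :=
      hP.preimage (f := fun h : E ↦ R⁻¹ * ‖h‖) (by fun_prop)
    have m2 : MeasurableSet {h : E | P ‖h‖} := hP.preimage measurable_norm
    rw [← lintegral_indicator m1, ← lintegral_indicator m2]
    have h1 := lintegral_comp_smul_of_pos ({h : E | P (R⁻¹ * ‖h‖)}.indicator
      fun h ↦ ENNReal.ofReal (‖h‖ ^ (a - d))) hR
    have h2 : ∀ x : E, ({h : E | P (R⁻¹ * ‖h‖)}.indicator
        fun h ↦ ENNReal.ofReal (‖h‖ ^ (a - d))) (R • x) =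
        ENNReal.ofReal (R ^ (a - d)) * ({h : E | P ‖h‖}.indicator
        fun h ↦ ENNReal.ofReal (‖h‖ ^ (a - d))) x := by
      intro x
      have hn : R⁻¹ * ‖R • x‖ = ‖x‖ := by
        rw [norm_smul, Real.norm_of_nonneg hR.le, inv_mul_cancel_left₀ hR.ne']
      by_cases hx : P ‖x‖
      · rw [Set.indicator_of_mem (by simpa [hn] using hx), Set.indicator_of_mem (by exact hx),
          norm_smul, Real.norm_of_nonneg hR.le, Real.mul_rpow hR.le (norm_nonneg _),
          ENNReal.ofReal_mul (by positivity)]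
      · rw [Set.indicator_of_notMem (by simpa [hn] using hx),
          Set.indicator_of_notMem (by exact hx), mul_zero]
    simp_rw [h2] at h1
    rw [lintegral_const_mul' _ _ (by finiteness)] at h1
    have hRd : (0 : ℝ) < R ^ d := by positivity
    have h3 : ENNReal.ofReal (R ^ a) = ENNReal.ofReal (R ^ d) * ENNReal.ofReal (R ^ (a - d)) := by
      rw [← ENNReal.ofReal_mul hRd.le, ← Real.rpow_natCast, ← Real.rpow_add hR]
      ring_nf
    rw [h3, mul_assoc, h1, ← mul_assoc, ← ENNReal.ofReal_mul hRd.le, mul_inv_cancel₀ hRd.ne']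
    simp
  set K1 := (∫⁻ h : E in {h | ‖h‖ ≤ 1}, ENNReal.ofReal (‖h‖ ^ (δ - d))).toReal with hK1
  set K2 := (∫⁻ h : E in {h | 1 ≤ ‖h‖}, ENNReal.ofReal (‖h‖ ^ (-δ - d))).toReal with hK2
  have hK1' : (∫⁻ h : E in {h | ‖h‖ ≤ 1}, ENNReal.ofReal (‖h‖ ^ (δ - d))) = ENNReal.ofReal K1 :=
    (ENNReal.ofReal_toReal lnear.ne).symm
  have hK2' : (∫⁻ h : E in {h | 1 ≤ ‖h‖}, ENNReal.ofReal (‖h‖ ^ (-δ - d))) = ENNReal.ofReal K2 :=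
    (ENNReal.ofReal_toReal lfar.ne).symm
  have k1 : 0 ≤ K1 := ENNReal.toReal_nonneg
  have k2 : 0 ≤ K2 := ENNReal.toReal_nonneg
  refine ⟨K1 + K2 + 1, by positivity, fun R hR ↦ ⟨?_, ?_⟩⟩
  · have := scale δ (· ≤ 1) measurableSet_Iic R hR
    simp only [inv_mul_le_iff₀ hR, mul_one] at this
    rw [this, hK1', ← ENNReal.ofReal_mul (by positivity), mul_comm]
    apply ENNReal.ofReal_le_ofReal
    gcongr
    linarith
  · have := scale (-δ) (1 ≤ ·) measurableSet_Ici R hR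
    simp only [le_inv_mul_iff₀ hR, mul_one] at this
    rw [this, hK2', ← ENNReal.ofReal_mul (by positivity), mul_comm]
    apply ENNReal.ofReal_le_ofReal
    gcongr
    linarith

/-- The Fourier symbol `e^{-2πi⟨h,ξ⟩} - 1` of `u ↦ u(· + h) - u` for the inverse transform. -/
def diffSymbol (h ξ : E) : ℂ := ((Real.fourierChar (-inner ℝ h ξ) : Circle) : ℂ) - 1

@[fun_prop]
lemma continuous_diffSymbol : Continuous (fun z : E × E ↦ diffSymbol z.1 z.2) := by
  unfold diffSymbol
  have h1 : Continuous (fun z : E × E ↦ (Real.fourierChar (-inner ℝ z.1 z.2) : Circle)) := by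
    fun_prop
  exact (continuous_induced_dom.comp h1).sub continuous_const

lemma norm_diffSymbol_le_two (h ξ : E) : ‖diffSymbol h ξ‖ ≤ 2 := by
  refine (norm_sub_le _ _).trans ?_
  rw [Circle.norm_coe, norm_one]
  norm_num

lemma norm_diffSymbol_le (h ξ : E) : ‖diffSymbol h ξ‖ ≤ 2 * Real.pi * (‖h‖ * ‖ξ‖) := by
  rw [diffSymbol, Real.fourierChar_apply]
  have := Real.norm_exp_I_mul_ofReal_sub_one_le (x := 2 * Real.pi * -inner ℝ h ξ)
  rw [mul_comm Complex.I] at this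
  refine this.trans ?_
  rw [norm_mul, norm_neg, Real.norm_of_nonneg (by have := Real.pi_pos; positivity)]
  have := Real.pi_pos
  gcongr
  exact norm_inner_le_norm h ξ

/-- `∫ |e^{-2πi⟨h,ξ⟩} - 1|² |h|^{-d-2σ} dh`, the symbol of the Gagliardo seminorm. -/
def gagliardoSymbol (σ : ℝ) (ξ : E) : ℝ≥0∞ :=
  ∫⁻ h : E, ENNReal.ofReal (‖h‖ ^ (-(2 * σ) - Module.finrank ℝ E)) * ‖diffSymbol h ξ‖ₑ ^ 2

lemma gagliardoSymbol_eq {σ : ℝ} {ξ e : E} (hξ : ξ ≠ 0) (he : ‖e‖ = 1) :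
    gagliardoSymbol σ ξ = ENNReal.ofReal (‖ξ‖ ^ (2 * σ)) * gagliardoSymbol σ e := by
  set d := Module.finrank ℝ E with hd
  have hn : 0 < ‖ξ‖ := norm_pos_iff.2 hξ
  -- a reflection taking the direction of `ξ` to `e`
  have hv : ‖‖ξ‖⁻¹ • ξ‖ = ‖e‖ := by
    rw [norm_smul, norm_inv, norm_norm, inv_mul_cancel₀ hn.ne', he]
  set ρ : E ≃ₗᵢ[ℝ] E := (ℝ ∙ (‖ξ‖⁻¹ • ξ - e))ᗮ.reflection
  have hρ : ρ ξ = ‖ξ‖ • e := by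
    have h1 : ρ (‖ξ‖⁻¹ • ξ) = e := Submodule.reflection_sub hv
    rw [← h1, map_smul, smul_smul, mul_inv_cancel₀ hn.ne', one_smul]
  have h1 := lintegral_comp_smul_of_pos (fun h : E ↦
    ENNReal.ofReal (‖h‖ ^ (-(2 * σ) - d)) * ‖diffSymbol h e‖ₑ ^ 2) hn
  have h2 := (LinearIsometryEquiv.measurePreserving ρ).lintegral_comp_emb
    ρ.toHomeomorph.measurableEmbedding (fun h : E ↦
    ENNReal.ofReal (‖‖ξ‖ • h‖ ^ (-(2 * σ) - d)) * ‖diffSymbol (‖ξ‖ • h) e‖ₑ ^ 2)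
  rw [← h2] at h1
  have h3 : ∀ h : E, ENNReal.ofReal (‖‖ξ‖ • ρ h‖ ^ (-(2 * σ) - d)) *
      ‖diffSymbol (‖ξ‖ • ρ h) e‖ₑ ^ 2 = ENNReal.ofReal (‖ξ‖ ^ (-(2 * σ) - d)) *
      (ENNReal.ofReal (‖h‖ ^ (-(2 * σ) - d)) * ‖diffSymbol h ξ‖ₑ ^ 2) := by
    intro h
    have i1 : inner ℝ (‖ξ‖ • ρ h) e = inner ℝ h ξ := by
      rw [real_inner_smul_left, ← real_inner_smul_right, ← hρ, LinearIsometryEquiv.inner_map_map]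
    rw [diffSymbol, i1, norm_smul, norm_norm, LinearIsometryEquiv.norm_map,
      Real.mul_rpow (norm_nonneg _) (norm_nonneg _), ENNReal.ofReal_mul (by positivity), mul_assoc]
    rfl
  simp_rw [h3] at h1
  rw [lintegral_const_mul' _ _ (by finiteness)] at h1
  have hRd : (0 : ℝ) < ‖ξ‖ ^ (-(2 * σ) - d) := by positivity
  have h4 : ENNReal.ofReal ((‖ξ‖ ^ d)⁻¹) = ENNReal.ofReal (‖ξ‖ ^ (-(2 * σ) - d)) *
      ENNReal.ofReal (‖ξ‖ ^ (2 * σ)) := by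
    rw [← ENNReal.ofReal_mul hRd.le, ← Real.rpow_natCast, ← Real.rpow_add hn, ← Real.rpow_neg hn.le]
    ring_nf
  rw [h4, mul_assoc] at h1
  exact (ENNReal.mul_right_inj (by simpa using hRd) ENNReal.ofReal_ne_top).1 h1

/-- The constant of the Gagliardo seminorm is bounded above and below, uniformly in the order. -/
lemma exists_gagliardoSymbol_bounds [Nontrivial E] {θ : ℝ} (hθ : 0 < θ) {e : E} (he : ‖e‖ = 1) :
    ∃ c C : ℝ, 0 < c ∧ 0 < C ∧ ∀ σ ∈ Set.Ioo θ (1 - θ),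
      ENNReal.ofReal c ≤ gagliardoSymbol σ e ∧ gagliardoSymbol σ e ≤ ENNReal.ofReal C := by
  set d := Module.finrank ℝ E with hd
  obtain ⟨K, hK, hb⟩ := exists_radial_bound (E := E) (δ := 2 * θ) (by linarith)
  have hp := Real.pi_pos
  -- lower bound, by the integral over the unit ball without weight
  have hmeas : Measurable (fun h : E ↦ ‖diffSymbol h e‖ₑ ^ 2) := by
    have : Continuous (fun h : E ↦ diffSymbol h e) :=
      continuous_diffSymbol.comp (by fun_prop : Continuous fun h : E ↦ (h, e))
    exact (this.measurable.enorm).pow_const 2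
  have hpos : 0 < ∫⁻ h : E in {h | ‖h‖ ≤ 1}, ‖diffSymbol h e‖ₑ ^ 2 := by
    rw [setLIntegral_pos_iff hmeas]
    have hcont : Continuous (fun h : E ↦ diffSymbol h e) :=
      continuous_diffSymbol.comp (by fun_prop : Continuous fun h : E ↦ (h, e))
    have hopen : IsOpen ({h : E | diffSymbol h e ≠ 0} ∩ {h : E | ‖h‖ < 1}) :=
      (isOpen_ne_fun hcont continuous_const).inter (isOpen_lt continuous_norm continuous_const)
    refine (hopen.measure_pos volume ⟨(1 / 2 : ℝ) • e, ?_, ?_⟩).trans_le (measure_mono ?_)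
    · simp only [Set.mem_ofPred_eq, diffSymbol, real_inner_smul_left, real_inner_self_eq_norm_sq, he,
        Real.fourierChar_apply]
      rw [show (2 * Real.pi * -(1 / 2 * 1 ^ 2) : ℝ) = -Real.pi by ring]
      push_cast
      rw [neg_mul, Complex.exp_neg, Complex.exp_pi_mul_I]
      norm_num
    · simp only [Set.mem_ofPred_eq, norm_smul, he]
      norm_num
    · rintro h ⟨h1, h2⟩
      refine ⟨?_, (show ‖h‖ < 1 from h2).le⟩
      simpa [Function.mem_support] using h1
  have hfin : ∫⁻ h : E in {h | ‖h‖ ≤ 1}, ‖diffSymbol h e‖ₑ ^ 2 < ⊤ := by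
    have hball : {h : E | ‖h‖ ≤ 1} = Metric.closedBall 0 1 := by
      ext h; simp
    calc _ ≤ ∫⁻ h : E in {h | ‖h‖ ≤ 1}, ENNReal.ofReal 2 ^ 2 := by
          refine lintegral_mono fun h ↦ ?_
          gcongr
          rw [← ofReal_norm]
          exact ENNReal.ofReal_le_ofReal (norm_diffSymbol_le_two _ _)
      _ < ⊤ := by
          rw [hball, setLIntegral_const]
          exact ENNReal.mul_lt_top (by finiteness) measure_closedBall_lt_top
  refine ⟨(∫⁻ h : E in {h | ‖h‖ ≤ 1}, ‖diffSymbol h e‖ₑ ^ 2).toReal,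
    (2 * Real.pi) ^ 2 * K + 4 * K, ENNReal.toReal_pos hpos.ne' hfin.ne, by positivity,
    fun σ hσ ↦ ⟨?_, ?_⟩⟩
  · rw [ENNReal.ofReal_toReal hfin.ne]
    have hnt : ∀ᵐ h : E, h ≠ 0 := by
      simp [ae_iff]
    calc _ ≤ ∫⁻ h : E in {h | ‖h‖ ≤ 1},
          ENNReal.ofReal (‖h‖ ^ (-(2 * σ) - d)) * ‖diffSymbol h e‖ₑ ^ 2 := by
          refine lintegral_mono_ae ?_
          rw [ae_restrict_iff' (measurableSet_le measurable_norm measurable_const)]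
          filter_upwards [hnt] with h h0 h1
          refine le_mul_of_one_le_left (by positivity) ?_
          rw [ENNReal.one_le_ofReal]
          refine Real.one_le_rpow_of_pos_of_le_one_of_nonpos (norm_pos_iff.2 h0) h1 ?_
          have : (0 : ℝ) ≤ d := Nat.cast_nonneg _
          linarith [hσ.1]
      _ ≤ _ := setLIntegral_le_lintegral _ _
  · have hsplit : (Set.univ : Set E) = {h | ‖h‖ ≤ 1} ∪ {h | 1 ≤ ‖h‖} := by
      ext h; simp [le_total]
    have hd0 : (0 : ℝ) ≤ d := Nat.cast_nonneg _
    rw [gagliardoSymbol, ← setLIntegral_univ, hsplit]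
    refine (lintegral_union_le _ _ _).trans ?_
    rw [ENNReal.ofReal_add (by positivity) (by positivity)]
    refine add_le_add ?_ ?_
    · calc _ ≤ ∫⁻ h : E in {h | ‖h‖ ≤ 1}, ENNReal.ofReal ((2 * Real.pi) ^ 2) *
            ENNReal.ofReal (‖h‖ ^ (2 * θ - d)) := by
            refine lintegral_mono_ae ?_
            rw [ae_restrict_iff' (measurableSet_le measurable_norm measurable_const)]
            have hnt : ∀ᵐ h : E, h ≠ 0 := by simp [ae_iff]
            filter_upwards [hnt] with h h0 h1
            have hn : 0 < ‖h‖ := norm_pos_iff.2 h0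
            rw [← ofReal_norm, ← ENNReal.ofReal_pow (norm_nonneg _),
              ← ENNReal.ofReal_mul (by positivity), ← ENNReal.ofReal_mul (by positivity)]
            apply ENNReal.ofReal_le_ofReal
            have h2 := norm_diffSymbol_le h e
            rw [he, mul_one] at h2
            calc ‖h‖ ^ (-(2 * σ) - d) * ‖diffSymbol h e‖ ^ 2
                ≤ ‖h‖ ^ (-(2 * σ) - d) * (2 * Real.pi * ‖h‖) ^ 2 := by gcongr
              _ = (2 * Real.pi) ^ 2 * ‖h‖ ^ (2 - 2 * σ - d) := by
                  rw [mul_pow, ← Real.rpow_natCast ‖h‖ 2, mul_left_comm, ← Real.rpow_add hn]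
                  congr 2
                  push_cast
                  ring
              _ ≤ (2 * Real.pi) ^ 2 * ‖h‖ ^ (2 * θ - d) := by
                  exact mul_le_mul_of_nonneg_left (Real.rpow_le_rpow_of_exponent_ge hn h1
                    (by linarith [hσ.2])) (by positivity)
        _ ≤ _ := by
            rw [lintegral_const_mul' _ _ (by finiteness), ENNReal.ofReal_mul (by positivity)]
            gcongr
            simpa using (hb 1 one_pos).1
    · calc _ ≤ ∫⁻ h : E in {h | 1 ≤ ‖h‖}, ENNReal.ofReal 4 *
            ENNReal.ofReal (‖h‖ ^ (-(2 * θ) - d)) := by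
            refine setLIntegral_mono' (measurableSet_le measurable_const measurable_norm)
              fun h h1 ↦ ?_
            have h1 : 1 ≤ ‖h‖ := h1
            rw [← ofReal_norm, ← ENNReal.ofReal_pow (norm_nonneg _),
              ← ENNReal.ofReal_mul (by positivity), ← ENNReal.ofReal_mul (by positivity)]
            apply ENNReal.ofReal_le_ofReal
            have h2 := norm_diffSymbol_le_two h e
            calc ‖h‖ ^ (-(2 * σ) - d) * ‖diffSymbol h e‖ ^ 2
                ≤ ‖h‖ ^ (-(2 * θ) - d) * 2 ^ 2 := by
                  gcongr
                  exact hσ.1.le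
              _ = _ := by ring
        _ ≤ _ := by
            rw [lintegral_const_mul' _ _ (by finiteness), ENNReal.ofReal_mul (by positivity)]
            gcongr
            simpa using (hb 1 one_pos).2

/-! ### Increments of Riesz potentials -/

/-- The increment `(I_σ w)(x + h) - (I_σ w)(x)` of the Riesz potential `I_σ w = (-Δ)^{-σ/2} w`,
defined by convolution with the integrable kernel `rieszIncr σ h`. -/
def potIncr (σ : ℝ) (w : E → ℂ) (h x : E) : ℂ := conv (fun y ↦ (rieszIncr σ h y : ℂ)) w x

lemma measurable_ofReal_rieszIncr (σ : ℝ) (h : E) : Measurable (fun y ↦ (rieszIncr σ h y : ℂ)) :=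
  Complex.measurable_ofReal.comp (measurable_rieszIncr_right σ h)

lemma measurable_potIncr (σ : ℝ) {w : E → ℂ} (hw : Measurable w) :
    Measurable (fun z : E × E ↦ potIncr σ w z.1 z.2) := by
  unfold potIncr conv
  have : StronglyMeasurable (fun q : (E × E) × E ↦
      (rieszIncr σ q.1.1 (q.1.2 - q.2) : ℂ) * w q.2) := by
    apply Measurable.stronglyMeasurable
    have h1 : Measurable (fun q : (E × E) × E ↦ rieszIncr σ q.1.1 (q.1.2 - q.2)) :=
      (measurable_rieszIncr σ).comp (g := fun z : E × E ↦ rieszIncr σ z.1 z.2)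
        (f := fun q : (E × E) × E ↦ (q.1.1, q.1.2 - q.2)) (by fun_prop)
    fun_prop
  exact this.integral_prod_right.measurable

lemma potIncr_congr {σ : ℝ} {w w' : E → ℂ} (h : w =ᵐ[volume] w') : potIncr σ w = potIncr σ w' := by
  ext a x
  unfold potIncr conv
  apply integral_congr_ae
  filter_upwards [h] with y hy
  rw [hy]

lemma measurable_coeFn_Lp {α : Type*} [MeasurableSpace α] {μ : Measure α} {p : ℝ≥0∞}
    (w : Lp ℂ p μ) : Measurable w := (Lp.stronglyMeasurable w).measurable

lemma memLp_potIncr {σ : ℝ} (h0 : 0 < σ) (h1 : σ < 1) (w : Lp ℂ 2 (volume : Measure E)) (h : E) :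
    MemLp (potIncr σ w h) 2 :=
  memLp_two_conv (measurable_ofReal_rieszIncr σ h) (measurable_coeFn_Lp w)
    (integrable_rieszIncr h0 h1 h) (Lp.memLp w)

lemma fourierInv_potIncr {σ : ℝ} (h0 : 0 < σ) (h1 : σ < 1) (w : Lp ℂ 2 (volume : Measure E))
    (h : E) :
    (𝓕⁻ ((memLp_potIncr h0 h1 w h).toLp _) : Lp ℂ 2 (volume : Measure E)) =ᵐ[volume]
      fun ξ ↦ diffSymbol h ξ * (((2 * Real.pi * ‖ξ‖) ^ (-σ) : ℝ) : ℂ) *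
        (𝓕⁻ w : Lp ℂ 2 (volume : Measure E)) ξ := by
  have := fourierInv_conv (measurable_ofReal_rieszIncr σ h) (measurable_coeFn_Lp w)
    (integrable_rieszIncr h0 h1 h) (Lp.memLp w)
  rw [Lp.toLp_coeFn] at this
  refine this.trans (Eventually.of_forall fun ξ ↦ ?_)
  simp only
  rw [fourierInv_rieszIncr h0 h1]
  rfl

lemma Lp_eq_of_fourierInv_ae {a b : Lp ℂ 2 (volume : Measure E)}
    (h : (𝓕⁻ a : Lp ℂ 2 (volume : Measure E)) =ᵐ[volume] (𝓕⁻ b : Lp ℂ 2 (volume : Measure E))) :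
    a = b :=
  (Lp.fourierTransformₗᵢ E ℂ).symm.injective (Lp.ext h)

/-- Increments of Riesz potentials of different orders agree if the potentials have the same
Fourier transform. -/
lemma potIncr_ae_eq {σ σ' : ℝ} (h0 : 0 < σ) (h1 : σ < 1) (h0' : 0 < σ') (h1' : σ' < 1)
    {a b : Lp ℂ 2 (volume : Measure E)}
    (hab : ∀ᵐ ξ, (((2 * Real.pi * ‖ξ‖) ^ (-σ) : ℝ) : ℂ) * (𝓕⁻ a : Lp ℂ 2 (volume : Measure E)) ξ =
      (((2 * Real.pi * ‖ξ‖) ^ (-σ') : ℝ) : ℂ) * (𝓕⁻ b : Lp ℂ 2 (volume : Measure E)) ξ) (h : E) :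
    potIncr σ a h =ᵐ[volume] potIncr σ' b h := by
  refine (MemLp.toLp_eq_toLp_iff (memLp_potIncr h0 h1 a h) (memLp_potIncr h0' h1' b h)).1 ?_
  apply Lp_eq_of_fourierInv_ae
  filter_upwards [fourierInv_potIncr h0 h1 a h, fourierInv_potIncr h0' h1' b h, hab] with ξ e1 e2 e3
  rw [e1, e2, mul_assoc (diffSymbol h ξ), mul_assoc (diffSymbol h ξ), e3]

lemma memLp_comp_add {u : E → ℂ} (hu : MemLp u 2) (h : E) : MemLp (fun x ↦ u (x + h)) 2 :=
  hu.comp_measurePreserving (measurePreserving_add_right volume h)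

/-- Translation is modulation on the Fourier side. -/
lemma fourierInv_translate (u : Lp ℂ 2 (volume : Measure E)) (h : E) :
    (𝓕⁻ ((memLp_comp_add (Lp.memLp u) h).toLp _) : Lp ℂ 2 (volume : Measure E)) =ᵐ[volume]
      fun ξ ↦ ((Real.fourierChar (-inner ℝ h ξ) : Circle) : ℂ) *
        (𝓕⁻ u : Lp ℂ 2 (volume : Measure E)) ξ := by
  have hc : Continuous (fun ξ : E ↦ ((Real.fourierChar (-inner ℝ h ξ) : Circle) : ℂ)) :=
    continuous_induced_dom.comp (by fun_prop :
      Continuous fun ξ : E ↦ (Real.fourierChar (-inner ℝ h ξ) : Circle))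
  refine ae_eq_of_integral_mul_schwartz (locallyIntegrable_Lp _) ?_ fun φ _ ↦ ?_
  · refine MemLp.locallyIntegrable (p := 2) ?_ (by norm_num)
    refine MemLp.of_le_mul (c := 1)
      (Lp.memLp (𝓕⁻ u : Lp ℂ 2 (volume : Measure E)))
      (hc.aestronglyMeasurable.mul (Lp.aestronglyMeasurable _)) ?_
    filter_upwards with ξ
    rw [norm_mul, Circle.norm_coe]
  have hG1 : Integrable (fun ξ ↦ ((Real.fourierChar (-inner ℝ h ξ) : Circle) : ℂ) * φ ξ) :=
    φ.integrable.bdd_mul (c := 1) hc.aestronglyMeasurable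
      (Eventually.of_forall fun ξ ↦ (Circle.norm_coe _).le)
  have hG2 : MemLp (fun ξ ↦ ((Real.fourierChar (-inner ℝ h ξ) : Circle) : ℂ) * φ ξ) 2 := by
    refine MemLp.of_le_mul (c := 1) (φ.memLp 2)
      (hc.aestronglyMeasurable.mul φ.continuous.aestronglyMeasurable) ?_
    filter_upwards with ξ
    rw [norm_mul, Circle.norm_coe]
  calc _ = ∫ x, u (x + h) * (𝓕⁻ φ) x := by
        rw [← integral_mul_fourierInv_schwartz]
        apply integral_congr_ae
        filter_upwards [(memLp_comp_add (Lp.memLp u) h).coeFn_toLp] with x hx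
        rw [hx]
    _ = ∫ x, u x * (𝓕⁻ φ) (x - h) := by
        have := integral_add_right_eq_self (μ := volume) (fun x ↦ u x * (𝓕⁻ φ) (x - h)) h
        simpa using this
    _ = ∫ x, u x * 𝓕⁻ (fun ξ ↦ ((Real.fourierChar (-inner ℝ h ξ) : Circle) : ℂ) * φ ξ) x := by
        congr 1 with x
        rw [SchwartzMap.fourierInv_coe, Real.fourierInv_eq, Real.fourierInv_eq]
        congr 2 with ξ
        rw [Circle.smul_def, Circle.smul_def, smul_eq_mul, smul_eq_mul, ← mul_assoc,
          ← Circle.coe_mul, ← AddChar.map_add_eq_mul, inner_sub_right, real_inner_comm h ξ]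
        rfl
    _ = ∫ y, u y * (𝓕⁻ (hG2.toLp _) : Lp ℂ 2 (volume : Measure E)) y := by
        apply integral_congr_ae
        filter_upwards [fourierInv_toLp_ae hG1 hG2] with y h2
        rw [h2]
    _ = _ := by
        rw [integral_mul_fourierInv]
        apply integral_congr_ae
        filter_upwards [hG2.coeFn_toLp] with y h1
        rw [h1]
        ring

/-- If `w = (-Δ)^{σ/2} u`, the potential increments of `w` are the increments of `u`. -/
lemma potIncr_ae_eq_sub {σ : ℝ} (h0 : 0 < σ) (h1 : σ < 1) {u w : Lp ℂ 2 (volume : Measure E)}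
    (huw : ∀ᵐ ξ, (𝓕⁻ w : Lp ℂ 2 (volume : Measure E)) ξ =
      (((2 * Real.pi * ‖ξ‖) ^ σ : ℝ) : ℂ) * (𝓕⁻ u : Lp ℂ 2 (volume : Measure E)) ξ)
    [Nontrivial E] (h : E) :
    potIncr σ w h =ᵐ[volume] fun x ↦ u (x + h) - u x := by
  have hm := (memLp_comp_add (Lp.memLp u) h)
  have e : (hm.sub (Lp.memLp u)).toLp _ = hm.toLp _ - u := by
    rw [MemLp.toLp_sub hm (Lp.memLp u), Lp.toLp_coeFn]
  refine (MemLp.toLp_eq_toLp_iff (memLp_potIncr h0 h1 w h) (hm.sub (Lp.memLp u))).1 ?_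
  apply Lp_eq_of_fourierInv_ae
  rw [e]
  have e2 : (𝓕⁻ (hm.toLp _ - u) : Lp ℂ 2 (volume : Measure E)) =
      𝓕⁻ (hm.toLp _) - (𝓕⁻ u : Lp ℂ 2 (volume : Measure E)) :=
    map_sub (Lp.fourierTransformₗᵢ E ℂ).symm _ _
  rw [e2]
  have hnt : ∀ᵐ ξ : E, ξ ≠ 0 := by simp [ae_iff]
  filter_upwards [fourierInv_potIncr h0 h1 w h, fourierInv_translate u h, huw,
    Lp.coeFn_sub (𝓕⁻ (hm.toLp _)) (𝓕⁻ u : Lp ℂ 2 (volume : Measure E)), hnt] with ξ a1 a2 a3 a4 a5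
  rw [a1, a4, Pi.sub_apply, a2, a3]
  have hpos : (0 : ℝ) < 2 * Real.pi * ‖ξ‖ := by
    have := Real.pi_pos
    have := norm_pos_iff.2 a5
    positivity
  have hc : (((2 * Real.pi * ‖ξ‖) ^ (-σ) : ℝ) : ℂ) * (((2 * Real.pi * ‖ξ‖) ^ σ : ℝ) : ℂ) = 1 := by
    rw [← Complex.ofReal_mul, ← Real.rpow_add hpos]
    simp
  rw [mul_assoc (diffSymbol h ξ), ← mul_assoc (((2 * Real.pi * ‖ξ‖) ^ (-σ) : ℝ) : ℂ), hc, one_mul, diffSymbol]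
  ring

/-- The weighted increment `(h, x) ↦ |h|^{-d/2-σ} ((I_σ w)(x + h) - (I_σ w)(x))`, whose `L²` norm
on the product is the Gagliardo seminorm of `I_σ w`. -/
def liftFun (σ : ℝ) (w : E → ℂ) (z : E × E) : ℂ :=
  ((‖z.1‖ ^ (-((Module.finrank ℝ E : ℝ) / 2 + σ)) : ℝ) : ℂ) * potIncr σ w z.1 z.2

lemma measurable_liftFun (σ : ℝ) {w : E → ℂ} (hw : Measurable w) : Measurable (liftFun σ w) := by
  unfold liftFun
  have := measurable_potIncr σ hw
  fun_prop

lemma enorm_weight_sq (σ : ℝ) (h : E) :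
    ‖((‖h‖ ^ (-((Module.finrank ℝ E : ℝ) / 2 + σ)) : ℝ) : ℂ)‖ₑ ^ 2 =
      ENNReal.ofReal (‖h‖ ^ (-(2 * σ) - Module.finrank ℝ E)) := by
  rw [← ofReal_norm, Complex.norm_real, Real.norm_of_nonneg (by positivity),
    ← ENNReal.ofReal_pow (by positivity), ← Real.rpow_natCast, ← Real.rpow_mul (norm_nonneg _)]
  congr 2
  push_cast
  ring

lemma lintegral_enorm_sq_eq (f : Lp ℂ 2 (volume : Measure E)) :
    ∫⁻ x, ‖(𝓕⁻ f : Lp ℂ 2 (volume : Measure E)) x‖ₑ ^ 2 = ∫⁻ x, ‖f x‖ₑ ^ 2 := by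
  have h1 : ∀ g : Lp ℂ 2 (volume : Measure E), ∫⁻ x, ‖g x‖ₑ ^ 2 = ‖g‖ₑ ^ 2 := by
    intro g
    rw [Lp.enorm_def, eLpNorm_eq_lintegral_rpow_enorm_toReal (by norm_num) (by norm_num),
      ← ENNReal.rpow_natCast, ← ENNReal.rpow_mul]
    simp
  rw [h1, h1]
  congr 1
  rw [← ofReal_norm, ← ofReal_norm]
  congr 1
  exact (Lp.fourierTransformₗᵢ E ℂ).symm.norm_map f

lemma lintegral_potIncr_sq {σ : ℝ} (h0 : 0 < σ) (h1 : σ < 1) (w : Lp ℂ 2 (volume : Measure E))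
    (h : E) : ∫⁻ x, ‖potIncr σ w h x‖ₑ ^ 2 = ∫⁻ ξ, ‖diffSymbol h ξ‖ₑ ^ 2 *
      (‖(((2 * Real.pi * ‖ξ‖) ^ (-σ) : ℝ) : ℂ)‖ₑ ^ 2 *
        ‖(𝓕⁻ w : Lp ℂ 2 (volume : Measure E)) ξ‖ₑ ^ 2) := by
  have e1 : ∫⁻ x, ‖potIncr σ w h x‖ₑ ^ 2 = ∫⁻ x, ‖(memLp_potIncr h0 h1 w h).toLp _ x‖ₑ ^ 2 := by
    apply lintegral_congr_ae
    filter_upwards [(memLp_potIncr h0 h1 w h).coeFn_toLp] with x hx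
    rw [hx]
  rw [e1, ← lintegral_enorm_sq_eq]
  apply lintegral_congr_ae
  filter_upwards [fourierInv_potIncr h0 h1 w h] with ξ hξ
  rw [hξ, enorm_mul, enorm_mul, mul_pow, mul_pow, mul_assoc]

lemma measurable_diffSymbol_enorm_sq :
    Measurable (fun z : E × E ↦ ‖diffSymbol z.1 z.2‖ₑ ^ 2) :=
  ((continuous_diffSymbol (E := E)).measurable.enorm).pow_const 2

/-- Integrating the weighted symbol against a density on the frequency side. -/
lemma lintegral_weight_diffSymbol (σ : ℝ) {v : E → ℝ≥0∞} (hv : Measurable v) :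
    ∫⁻ h : E, ENNReal.ofReal (‖h‖ ^ (-(2 * σ) - Module.finrank ℝ E)) *
      ∫⁻ ξ : E, ‖diffSymbol h ξ‖ₑ ^ 2 * v ξ = ∫⁻ ξ : E, gagliardoSymbol σ ξ * v ξ := by
  have hwt : Measurable (fun h : E ↦ ENNReal.ofReal (‖h‖ ^ (-(2 * σ) - Module.finrank ℝ E))) := by
    fun_prop
  have hD := measurable_diffSymbol_enorm_sq (E := E)
  calc _ = ∫⁻ h : E, ∫⁻ ξ : E, ENNReal.ofReal (‖h‖ ^ (-(2 * σ) - Module.finrank ℝ E)) *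
          (‖diffSymbol h ξ‖ₑ ^ 2 * v ξ) := by
        refine lintegral_congr fun h ↦ ?_
        rw [lintegral_const_mul' _ _ (by finiteness)]
    _ = ∫⁻ ξ : E, ∫⁻ h : E, ENNReal.ofReal (‖h‖ ^ (-(2 * σ) - Module.finrank ℝ E)) *
          (‖diffSymbol h ξ‖ₑ ^ 2 * v ξ) := by
        have h1 : Measurable fun z : E × E ↦ v z.2 := hv.comp measurable_snd
        have h2 : Measurable fun z : E × E ↦
          ENNReal.ofReal (‖z.1‖ ^ (-(2 * σ) - Module.finrank ℝ E)) := hwt.comp measurable_fst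
        exact lintegral_lintegral_swap (h2.mul (hD.mul h1)).aemeasurable
    _ = _ := by
        refine lintegral_congr fun ξ ↦ ?_
        rw [gagliardoSymbol, ← lintegral_mul_const]
        · simp_rw [mul_assoc]
        · have h3 : Measurable fun h : E ↦ ‖diffSymbol h ξ‖ₑ ^ 2 :=
            hD.comp (f := fun h : E ↦ (h, ξ)) measurable_prodMk_right
          exact hwt.mul h3

lemma gagliardoSymbol_mul_weight {σ : ℝ} {e ξ : E} (he : ‖e‖ = 1) (hξ : ξ ≠ 0) :
    gagliardoSymbol σ ξ * ‖(((2 * Real.pi * ‖ξ‖) ^ (-σ) : ℝ) : ℂ)‖ₑ ^ 2 =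
      ENNReal.ofReal ((2 * Real.pi) ^ (-(2 * σ))) * gagliardoSymbol σ e := by
  have hn := norm_pos_iff.2 hξ
  have hp := Real.pi_pos
  rw [gagliardoSymbol_eq hξ he, ← ofReal_norm, Complex.norm_real,
    Real.norm_of_nonneg (by positivity), ← ENNReal.ofReal_pow (by positivity), mul_right_comm,
    ← ENNReal.ofReal_mul (by positivity)]
  congr 2
  rw [← Real.rpow_natCast, ← Real.rpow_mul (by positivity),
    Real.mul_rpow (by positivity) hn.le, mul_left_comm, ← Real.rpow_add hn]
  push_cast
  rw [show 2 * σ + -σ * 2 = 0 by ring, Real.rpow_zero, mul_one]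
  ring_nf

/-- Plancherel for the Gagliardo seminorm. -/
lemma lintegral_liftFun_sq [Nontrivial E] {σ : ℝ} (h0 : 0 < σ) (h1 : σ < 1) {e : E} (he : ‖e‖ = 1)
    (w : Lp ℂ 2 (volume : Measure E)) :
    ∫⁻ z, ‖liftFun σ w z‖ₑ ^ 2 =
      ENNReal.ofReal ((2 * Real.pi) ^ (-(2 * σ))) * gagliardoSymbol σ e * ∫⁻ x, ‖w x‖ₑ ^ 2 := by
  have hmw := measurable_coeFn_Lp w
  have hmw' := measurable_coeFn_Lp (𝓕⁻ w : Lp ℂ 2 (volume : Measure E))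
  calc _ = ∫⁻ h : E, ∫⁻ x : E, ‖liftFun σ w (h, x)‖ₑ ^ 2 := by
        rw [Measure.volume_eq_prod, lintegral_prod]
        exact ((measurable_liftFun σ hmw).enorm.pow_const 2).aemeasurable
    _ = ∫⁻ h : E, ENNReal.ofReal (‖h‖ ^ (-(2 * σ) - Module.finrank ℝ E)) *
          ∫⁻ x : E, ‖potIncr σ w h x‖ₑ ^ 2 := by
        refine lintegral_congr fun h ↦ ?_
        rw [← lintegral_const_mul' _ _ (by finiteness)]
        refine lintegral_congr fun x ↦ ?_
        rw [liftFun, enorm_mul, mul_pow, enorm_weight_sq]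
    _ = ∫⁻ ξ : E, gagliardoSymbol σ ξ * (‖(((2 * Real.pi * ‖ξ‖) ^ (-σ) : ℝ) : ℂ)‖ₑ ^ 2 *
          ‖(𝓕⁻ w : Lp ℂ 2 (volume : Measure E)) ξ‖ₑ ^ 2) := by
        simp_rw [lintegral_potIncr_sq h0 h1]
        apply lintegral_weight_diffSymbol
        have : Measurable fun ξ : E ↦ (2 * Real.pi * ‖ξ‖) ^ (-σ) := by fun_prop
        exact ((Complex.measurable_ofReal.comp this).enorm.pow_const 2).mul
          (hmw'.enorm.pow_const 2)
    _ = ∫⁻ ξ : E, ENNReal.ofReal ((2 * Real.pi) ^ (-(2 * σ))) * gagliardoSymbol σ e *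
          ‖(𝓕⁻ w : Lp ℂ 2 (volume : Measure E)) ξ‖ₑ ^ 2 := by
        apply lintegral_congr_ae
        have hnt : ∀ᵐ ξ : E, ξ ≠ 0 := by simp [ae_iff]
        filter_upwards [hnt] with ξ hξ
        rw [← mul_assoc, gagliardoSymbol_mul_weight he hξ]
    _ = _ := by
        rw [lintegral_const_mul _ (hmw'.enorm.pow_const 2), lintegral_enorm_sq_eq]

/-! ### The form and its operator on `L²` -/

lemma enorm_sq_Lp {α : Type*} [MeasurableSpace α] {μ : Measure α} (g : Lp ℂ 2 μ) :
    ‖g‖ₑ ^ 2 = ∫⁻ x, ‖g x‖ₑ ^ 2 ∂μ := by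
  rw [Lp.enorm_def, eLpNorm_eq_lintegral_rpow_enorm_toReal (by norm_num) (by norm_num),
    ← ENNReal.rpow_natCast, ← ENNReal.rpow_mul]
  simp

lemma memLp_two_iff {α : Type*} [MeasurableSpace α] {μ : Measure α} {f : α → ℂ}
    (hf : Measurable f) : MemLp f 2 μ ↔ ∫⁻ x, ‖f x‖ₑ ^ 2 ∂μ < ⊤ := by
  rw [MemLp, and_iff_right hf.aestronglyMeasurable,
    eLpNorm_lt_top_iff_lintegral_rpow_enorm_lt_top (by norm_num) (by norm_num)]
  simp

lemma potIncr_add {σ : ℝ} (h0 : 0 < σ) (h1 : σ < 1) (v w : Lp ℂ 2 (volume : Measure E)) (h : E) :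
    potIncr σ (v + w : Lp ℂ 2 (volume : Measure E)) h =ᵐ[volume]
      fun x ↦ potIncr σ v h x + potIncr σ w h x := by
  have key : ∀ v : Lp ℂ 2 (volume : Measure E), ∀ᵐ x : E,
      Integrable (fun y ↦ (rieszIncr σ h (x - y) : ℂ) * v y) := fun v ↦
    ae_integrable_conv (k := fun y ↦ (rieszIncr σ h y : ℂ)) (w := v) (p := 2)
      (measurable_ofReal_rieszIncr σ h) (measurable_coeFn_Lp v) one_le_two
      (integrable_rieszIncr h0 h1 h) (by simpa using Lp.memLp v)
  rw [potIncr_congr (Lp.coeFn_add v w)]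
  filter_upwards [key v, key w] with x hv hw
  refine Eq.trans ?_ (integral_add hv hw)
  simp only [potIncr, conv, Pi.add_apply, mul_add]

lemma potIncr_smul (σ : ℝ) (c : ℂ) (w : Lp ℂ 2 (volume : Measure E)) (h x : E) :
    potIncr σ (c • w : Lp ℂ 2 (volume : Measure E)) h x = c * potIncr σ w h x := by
  rw [potIncr_congr (Lp.coeFn_smul c w)]
  simp only [potIncr, conv]
  rw [← integral_const_mul]
  congr 1 with y
  simp only [Pi.smul_apply, smul_eq_mul]
  ring

lemma potIncr_star (σ : ℝ) (w : Lp ℂ 2 (volume : Measure E)) (h x : E) :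
    potIncr σ (star w : Lp ℂ 2 (volume : Measure E)) h x = star (potIncr σ w h x) := by
  rw [potIncr_congr (Lp.coeFn_star w)]
  simp only [potIncr, conv]
  rw [Complex.star_def, ← integral_conj]
  simp

lemma exists_liftFun_const [Nontrivial E] {θ : ℝ} (hθ : 0 < θ) : ∃ c C : ℝ, 0 < c ∧ 0 < C ∧
    ∀ σ ∈ Set.Ioo θ (1 - θ), ∃ γ : ℝ, c ≤ γ ∧ γ ≤ C ∧ ∀ w : Lp ℂ 2 (volume : Measure E),
      ∫⁻ z, ‖liftFun σ w z‖ₑ ^ 2 = ENNReal.ofReal γ * ∫⁻ x, ‖w x‖ₑ ^ 2 := by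
  obtain ⟨e, he⟩ : ∃ e : E, ‖e‖ = 1 := exists_norm_eq E zero_le_one
  obtain ⟨c, C, hc, hC, hb⟩ := exists_gagliardoSymbol_bounds hθ he
  have hp := Real.pi_gt_three
  refine ⟨(2 * Real.pi) ^ (-2 : ℝ) * c, C, by positivity, hC, fun σ hσ ↦ ?_⟩
  obtain ⟨h1, h2⟩ := hb σ hσ
  have htop : gagliardoSymbol σ e ≠ ⊤ := (h2.trans_lt ENNReal.ofReal_lt_top).ne
  have hσ0 : 0 < σ := hθ.trans hσ.1
  have hσ1 : σ < 1 := hσ.2.trans (by linarith)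
  refine ⟨(2 * Real.pi) ^ (-(2 * σ)) * (gagliardoSymbol σ e).toReal, ?_, ?_, fun w ↦ ?_⟩
  · apply mul_le_mul _ ((ENNReal.ofReal_le_iff_le_toReal htop).1 h1) hc.le (by positivity)
    exact Real.rpow_le_rpow_of_exponent_le (by linarith) (by linarith)
  · calc _ ≤ 1 * C := by
          apply mul_le_mul _ (ENNReal.toReal_le_of_le_ofReal hC.le h2) (by positivity) zero_le_one
          exact Real.rpow_le_one_of_one_le_of_nonpos (by linarith) (by linarith)
      _ = C := one_mul C
  · rw [lintegral_liftFun_sq hσ0 hσ1 he, ENNReal.ofReal_mul (by positivity),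
      ENNReal.ofReal_toReal htop]

lemma exists_liftFun_const' [Nontrivial E] {σ : ℝ} (hσ : σ ∈ Set.Ioo (0 : ℝ) 1) :
    ∃ γ : ℝ, 0 < γ ∧ ∀ w : Lp ℂ 2 (volume : Measure E),
      ∫⁻ z, ‖liftFun σ w z‖ₑ ^ 2 = ENNReal.ofReal γ * ∫⁻ x, ‖w x‖ₑ ^ 2 := by
  have h1 : 0 < min σ (1 - σ) := lt_min hσ.1 (sub_pos.2 hσ.2)
  obtain ⟨c, C, hc, hC, h⟩ := exists_liftFun_const (E := E) (half_pos h1)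
  obtain ⟨γ, hγ, -, h⟩ := h σ ⟨by linarith [min_le_left σ (1 - σ)],
    by linarith [min_le_right σ (1 - σ)]⟩
  exact ⟨γ, hc.trans_le hγ, h⟩

lemma memLp_liftFun [Nontrivial E] {σ : ℝ} (hσ : σ ∈ Set.Ioo (0 : ℝ) 1)
    (w : Lp ℂ 2 (volume : Measure E)) : MemLp (liftFun σ w) 2 volume := by
  obtain ⟨γ, -, h⟩ := exists_liftFun_const' (E := E) hσ
  rw [memLp_two_iff (measurable_liftFun σ (measurable_coeFn_Lp w)), h, ← enorm_sq_Lp]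
  finiteness

/-- The isometry (up to a constant) `w ↦ liftFun σ w` from `L²(E)` to `L²(E × E)`. -/
def lift [Nontrivial E] (σ : ℝ) (hσ : σ ∈ Set.Ioo (0 : ℝ) 1) :
    Lp ℂ 2 (volume : Measure E) →L[ℂ] Lp ℂ 2 (volume : Measure (E × E)) :=
  LinearMap.mkContinuousOfExistsBound
    { toFun := fun w ↦ (memLp_liftFun hσ w).toLp _
      map_add' := fun v w ↦ by
        rw [← MemLp.toLp_add, MemLp.toLp_eq_toLp_iff]
        have hm := fun w : Lp ℂ 2 (volume : Measure E) ↦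
          measurable_liftFun σ (measurable_coeFn_Lp w)
        rw [Measure.volume_eq_prod]
        refine (Measure.ae_prod_iff_ae_ae
          (measurableSet_eq_fun (hm _) ((hm v).add (hm w)))).2 ?_
        refine Eventually.of_forall fun h ↦ ?_
        filter_upwards [potIncr_add hσ.1 hσ.2 v w h] with x hx
        simp only [liftFun, Pi.add_apply, hx, mul_add]
      map_smul' := fun c w ↦ by
        rw [RingHom.id_apply, ← MemLp.toLp_const_smul, MemLp.toLp_eq_toLp_iff]
        refine Eventually.of_forall fun z ↦ ?_
        simp only [liftFun, Pi.smul_apply, potIncr_smul, smul_eq_mul]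
        ring }
    (by
      obtain ⟨γ, hγ, h⟩ := exists_liftFun_const' (E := E) hσ
      refine ⟨√γ, fun w ↦ ?_⟩
      have h2 : ‖(memLp_liftFun hσ w).toLp _‖ₑ ^ 2 = (ENNReal.ofReal √γ * ‖w‖ₑ) ^ 2 := by
        rw [enorm_sq_Lp, lintegral_congr_ae (g := fun z ↦ ‖liftFun σ w z‖ₑ ^ 2), h, mul_pow,
          ← enorm_sq_Lp, ← ENNReal.ofReal_pow (by positivity), Real.sq_sqrt hγ.le]
        filter_upwards [(memLp_liftFun hσ w).coeFn_toLp] with z hz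
        rw [hz]
      have h3 : ‖(memLp_liftFun hσ w).toLp _‖ₑ = ENNReal.ofReal √γ * ‖w‖ₑ :=
        (ENNReal.pow_right_strictMono two_ne_zero).injective h2
      rw [← ofReal_norm, ← ofReal_norm, ← ENNReal.ofReal_mul (by positivity),
        ENNReal.ofReal_eq_ofReal_iff (by positivity) (by positivity)] at h3
      exact h3.le)

lemma lift_ae_eq [Nontrivial E] {σ : ℝ} (hσ : σ ∈ Set.Ioo (0 : ℝ) 1)
    (w : Lp ℂ 2 (volume : Measure E)) : lift σ hσ w =ᵐ[volume] liftFun σ w :=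
  (memLp_liftFun hσ w).coeFn_toLp

lemma lift_star [Nontrivial E] {σ : ℝ} (hσ : σ ∈ Set.Ioo (0 : ℝ) 1)
    (w : Lp ℂ 2 (volume : Measure E)) : lift σ hσ (star w) = star (lift σ hσ w) := by
  apply Lp.ext
  filter_upwards [lift_ae_eq hσ w, lift_ae_eq hσ (star w), Lp.coeFn_star (lift σ hσ w)]
    with z h1 h2 h3
  rw [h2, h3, Pi.star_apply, h1, liftFun, liftFun, potIncr_star, star_mul']
  simp

/-- The lift multiplies norms by a constant which is bounded above and below as long as `σ` stays
away from `0` and `1`. -/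
lemma exists_norm_lift [Nontrivial E] {θ : ℝ} (hθ : 0 < θ) : ∃ c C : ℝ, 0 < c ∧ 0 < C ∧
    ∀ (σ : ℝ) (hσ : σ ∈ Set.Ioo (0 : ℝ) 1), σ ∈ Set.Ioo θ (1 - θ) → ∃ γ : ℝ, c ≤ γ ∧ γ ≤ C ∧
      ∀ w : Lp ℂ 2 (volume : Measure E), ‖lift σ hσ w‖ ^ 2 = γ * ‖w‖ ^ 2 := by
  obtain ⟨c, C, hc, hC, h⟩ := exists_liftFun_const (E := E) hθ
  refine ⟨c, C, hc, hC, fun σ hσ hσ' ↦ ?_⟩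
  obtain ⟨γ, h1, h2, h⟩ := h σ hσ'
  refine ⟨γ, h1, h2, fun w ↦ ?_⟩
  have hγ : 0 ≤ γ := hc.le.trans h1
  have h3 : ‖lift σ hσ w‖ₑ ^ 2 = ENNReal.ofReal γ * ‖w‖ₑ ^ 2 := by
    rw [enorm_sq_Lp, enorm_sq_Lp, ← h w]
    apply lintegral_congr_ae
    filter_upwards [lift_ae_eq hσ w] with z hz
    rw [hz]
  rwa [← ofReal_norm, ← ofReal_norm, ← ENNReal.ofReal_pow (by positivity),
    ← ENNReal.ofReal_pow (by positivity), ← ENNReal.ofReal_mul (by positivity),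
    ENNReal.ofReal_eq_ofReal_iff (by positivity) (by positivity)] at h3

section Mul

variable {α : Type*} [MeasurableSpace α] {μ : Measure α}

lemma memLp_ofReal_mul {κ : α → ℝ} (hκ : Measurable κ) (hb : ∀ z, |κ z| ≤ 1) (f : Lp ℂ 2 μ) :
    MemLp (fun z ↦ (κ z : ℂ) * f z) 2 μ := by
  refine MemLp.of_le_mul (c := 1) (Lp.memLp f)
    (((Complex.measurable_ofReal.comp hκ).aestronglyMeasurable).mul (Lp.aestronglyMeasurable f)) ?_
  filter_upwards with z
  rw [norm_mul, Complex.norm_real]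
  gcongr
  exact hb z

/-- Multiplication by a real function bounded by `1`, on `L²`. -/
def mulOp (κ : α → ℝ) (hκ : Measurable κ) (hb : ∀ z, |κ z| ≤ 1) : Lp ℂ 2 μ →L[ℂ] Lp ℂ 2 μ :=
  LinearMap.mkContinuous
    { toFun := fun f ↦ (memLp_ofReal_mul hκ hb f).toLp _
      map_add' := fun f g ↦ by
        rw [← MemLp.toLp_add, MemLp.toLp_eq_toLp_iff]
        filter_upwards [Lp.coeFn_add f g] with z hz
        simp only [hz, Pi.add_apply, mul_add]
      map_smul' := fun c f ↦ by
        rw [RingHom.id_apply, ← MemLp.toLp_const_smul, MemLp.toLp_eq_toLp_iff]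
        filter_upwards [Lp.coeFn_smul c f] with z hz
        simp only [hz, Pi.smul_apply, smul_eq_mul]
        ring }
    1 (fun f ↦ by
      rw [one_mul]
      apply Lp.norm_le_norm_of_ae_le
      filter_upwards [(memLp_ofReal_mul hκ hb f).coeFn_toLp] with z hz
      simp only [LinearMap.coe_mk, AddHom.coe_mk, hz, norm_mul, Complex.norm_real]
      exact mul_le_of_le_one_left (norm_nonneg _) (hb z))

lemma mulOp_ae_eq {κ : α → ℝ} (hκ : Measurable κ) (hb : ∀ z, |κ z| ≤ 1) (f : Lp ℂ 2 μ) :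
    mulOp κ hκ hb f =ᵐ[μ] fun z ↦ (κ z : ℂ) * f z :=
  (memLp_ofReal_mul hκ hb f).coeFn_toLp

lemma norm_mulOp_le {κ : α → ℝ} (hκ : Measurable κ) (hb : ∀ z, |κ z| ≤ 1) :
    ‖(mulOp κ hκ hb : Lp ℂ 2 μ →L[ℂ] Lp ℂ 2 μ)‖ ≤ 1 :=
  LinearMap.mkContinuous_norm_le _ zero_le_one _

lemma inner_star_Lp (f g : Lp ℂ 2 μ) : inner ℂ (star g) f = ∫ z, f z * g z ∂μ := by
  rw [L2.inner_def]
  apply integral_congr_ae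
  filter_upwards [Lp.coeFn_star g] with z hz
  rw [hz]
  simp [RCLike.inner_apply]

end Mul

/-- The bilinear form
`∬ κ(h, x) |h|^{-d-σ₁-σ₂} ((I_{σ₁} v)(x+h) - (I_{σ₁} v)(x)) ((I_{σ₂} w)(x+h) - (I_{σ₂} w)(x))`. -/
def incrForm (κ : E × E → ℝ) (σ₁ σ₂ : ℝ) (v w : E → ℂ) : ℂ :=
  ∫ z, (κ z : ℂ) * liftFun σ₁ v z * liftFun σ₂ w z

lemma incrForm_swap (κ : E × E → ℝ) (σ₁ σ₂ : ℝ) (v w : E → ℂ) :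
    incrForm κ σ₁ σ₂ v w = incrForm κ σ₂ σ₁ w v := by
  unfold incrForm
  congr 1 with z
  ring

/-- The operator on `L²` with `∫ (T v) w = incrForm κ σ₁ σ₂ v w`. -/
def incrOp [Nontrivial E] (κ : E × E → ℝ) (hκ : Measurable κ) (hb : ∀ z, |κ z| ≤ 1) {σ₁ σ₂ : ℝ}
    (h₁ : σ₁ ∈ Set.Ioo (0 : ℝ) 1) (h₂ : σ₂ ∈ Set.Ioo (0 : ℝ) 1) :
    Lp ℂ 2 (volume : Measure E) →L[ℂ] Lp ℂ 2 (volume : Measure E) :=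
  (lift σ₂ h₂).adjoint ∘L mulOp κ hκ hb ∘L lift σ₁ h₁

lemma integral_incrOp_mul [Nontrivial E] {κ : E × E → ℝ} (hκ : Measurable κ)
    (hb : ∀ z, |κ z| ≤ 1) {σ₁ σ₂ : ℝ} (h₁ : σ₁ ∈ Set.Ioo (0 : ℝ) 1) (h₂ : σ₂ ∈ Set.Ioo (0 : ℝ) 1)
    (v w : Lp ℂ 2 (volume : Measure E)) :
    ∫ x, incrOp κ hκ hb h₁ h₂ v x * w x = incrForm κ σ₁ σ₂ v w := by
  rw [← inner_star_Lp, incrOp, ContinuousLinearMap.comp_apply,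
    ContinuousLinearMap.adjoint_inner_right, lift_star, inner_star_Lp]
  apply integral_congr_ae
  filter_upwards [lift_ae_eq h₂ w, lift_ae_eq h₁ v, mulOp_ae_eq hκ hb (lift σ₁ h₁ v)]
    with z e1 e2 e3
  rw [ContinuousLinearMap.comp_apply, e3, e1, e2]

/-- The transpose of `incrOp`. -/
lemma integral_incrOp_mul_comm [Nontrivial E] {κ : E × E → ℝ} (hκ : Measurable κ)
    (hb : ∀ z, |κ z| ≤ 1) {σ₁ σ₂ : ℝ} (h₁ : σ₁ ∈ Set.Ioo (0 : ℝ) 1) (h₂ : σ₂ ∈ Set.Ioo (0 : ℝ) 1)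
    (v w : Lp ℂ 2 (volume : Measure E)) :
    ∫ x, incrOp κ hκ hb h₁ h₂ v x * w x = ∫ x, v x * incrOp κ hκ hb h₂ h₁ w x := by
  rw [integral_incrOp_mul, incrForm_swap, ← integral_incrOp_mul hκ hb h₂ h₁]
  simp_rw [mul_comm]

lemma exists_norm_incrOp_le [Nontrivial E] {θ : ℝ} (hθ : 0 < θ) : ∃ A : ℝ, 0 < A ∧
    ∀ (κ : E × E → ℝ) (hκ : Measurable κ) (hb : ∀ z, |κ z| ≤ 1) (σ₁ σ₂ : ℝ)
      (h₁ : σ₁ ∈ Set.Ioo (0 : ℝ) 1) (h₂ : σ₂ ∈ Set.Ioo (0 : ℝ) 1), σ₁ ∈ Set.Ioo θ (1 - θ) →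
      σ₂ ∈ Set.Ioo θ (1 - θ) → ‖incrOp κ hκ hb h₁ h₂‖ ≤ A := by
  obtain ⟨c, C, hc, hC, h⟩ := exists_norm_lift (E := E) hθ
  have key : ∀ (σ : ℝ) (hσ : σ ∈ Set.Ioo (0 : ℝ) 1), σ ∈ Set.Ioo θ (1 - θ) →
      ‖(lift σ hσ : Lp ℂ 2 (volume : Measure E) →L[ℂ] _)‖ ≤ √C := by
    intro σ hσ hσ'
    obtain ⟨γ, h1, h2, h⟩ := h σ hσ hσ'
    refine ContinuousLinearMap.opNorm_le_bound _ (by positivity) fun w ↦ ?_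
    refine le_of_sq_le_sq ?_ (by positivity)
    rw [h, mul_pow, Real.sq_sqrt hC.le]
    gcongr
  refine ⟨C, hC, fun κ hκ hb σ₁ σ₂ h₁ h₂ h₁' h₂' ↦ ?_⟩
  refine (ContinuousLinearMap.opNorm_comp_le _ _).trans ?_
  rw [LinearIsometryEquiv.norm_map]
  calc _ ≤ √C * (1 * √C) := by
        gcongr
        · exact key _ _ h₂'
        · refine (ContinuousLinearMap.opNorm_comp_le _ _).trans ?_
          gcongr
          · exact norm_mulOp_le hκ hb
          · exact key _ _ h₁'
    _ = C := by rw [one_mul, Real.mul_self_sqrt hC.le]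

/-- With constant coefficient and equal orders the form is a multiple of `∫ v w`. -/
lemma exists_integral_lift_mul [Nontrivial E] {θ : ℝ} (hθ : 0 < θ) : ∃ c C : ℝ, 0 < c ∧ 0 < C ∧
    ∀ (σ : ℝ) (hσ : σ ∈ Set.Ioo (0 : ℝ) 1), σ ∈ Set.Ioo θ (1 - θ) → ∃ γ : ℝ, c ≤ γ ∧ γ ≤ C ∧
      ∀ v w : Lp ℂ 2 (volume : Measure E),
        ∫ z, lift σ hσ v z * lift σ hσ w z = (γ : ℂ) * ∫ x, v x * w x := by
  obtain ⟨c, C, hc, hC, h⟩ := exists_norm_lift (E := E) hθ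
  refine ⟨c, C, hc, hC, fun σ hσ hσ' ↦ ?_⟩
  obtain ⟨γ, h1, h2, h⟩ := h σ hσ hσ'
  refine ⟨γ, h1, h2, fun v w ↦ ?_⟩
  rw [← inner_star_Lp, ← inner_star_Lp, ← lift_star]
  have hin : ∀ x y : Lp ℂ 2 (volume : Measure E),
      inner ℂ (lift σ hσ x) (lift σ hσ y) = (γ : ℂ) * inner ℂ x y := by
    intro x y
    rw [inner_eq_sum_norm_sq_div_four, inner_eq_sum_norm_sq_div_four (𝕜 := ℂ) x y]
    simp only [← map_add, ← map_sub, ← map_smul, ← Complex.ofReal_pow, h, Complex.coe_algebraMap]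
    push_cast
    ring
  exact hin _ _

/-! ### Calderón–Zygmund decomposition -/

/-- Finitely many measurable sets can be shrunk to disjoint ones with the same union. -/
lemma exists_disjoint_refinement {ι α : Type*} [MeasurableSpace α] (t : Finset ι) {A : ι → Set α}
    (hA : ∀ i, MeasurableSet (A i)) : ∃ Q : ι → Set α, (∀ i ∈ t, Q i ⊆ A i) ∧
      (∀ i, MeasurableSet (Q i)) ∧ (t : Set ι).PairwiseDisjoint Q ∧
      ⋃ i ∈ t, Q i = ⋃ i ∈ t, A i := by
  classical
  induction t using Finset.induction_on with
  | empty => exact ⟨A, by simp, hA, by simp, by simp⟩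
  | insert a s ha ih =>
    obtain ⟨Q, h1, h2, h3, h4⟩ := ih
    have hne : ∀ i ∈ s, i ≠ a := fun i hi h ↦ ha (h ▸ hi)
    have hU : ⋃ i ∈ s, Function.update Q a (A a \ ⋃ i ∈ s, A i) i = ⋃ i ∈ s, A i := by
      rw [← h4]
      refine Set.iUnion₂_congr fun i hi ↦ ?_
      rw [Function.update_of_ne (hne i hi)]
    refine ⟨Function.update Q a (A a \ ⋃ i ∈ s, A i), ?_, ?_, ?_, ?_⟩
    · intro i hi
      rcases Finset.mem_insert.1 hi with rfl | hi
      · simp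
      · rw [Function.update_of_ne (hne i hi)]
        exact h1 i hi
    · intro i
      by_cases h : i = a
      · subst h
        rw [Function.update_self]
        exact (hA i).diff (s.measurableSet_biUnion fun i _ ↦ hA i)
      · rw [Function.update_of_ne h]
        exact h2 i
    · rw [Finset.coe_insert, Set.pairwiseDisjoint_insert]
      constructor
      · intro i hi j hj hij
        rw [Function.onFun, Function.update_of_ne (hne i hi), Function.update_of_ne (hne j hj)]
        exact h3 hi hj hij
      · intro j hj _
        rw [Function.update_self, Function.update_of_ne (hne j hj)]
        refine Set.disjoint_left.2 fun x hx hxj ↦ hx.2 ?_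
        exact Set.mem_iUnion₂.2 ⟨j, hj, h1 j hj hxj⟩
    · rw [Finset.set_biUnion_insert, Finset.set_biUnion_insert, hU, Function.update_self,
        Set.sdiff_union_self]

/-- Vitali selection for the balls on which the average of `F` exceeds `lam`, the radii being
almost maximal, so that the average over the enlarged balls is at most `lam`. -/
lemma exists_vitali_balls [Nontrivial E] {F : E → ℝ≥0∞} (hF : ∫⁻ x, F x ≠ ⊤) {lam : ℝ≥0∞}
    (hl : lam ≠ 0) {K : Set E} (hK : IsCompact K)
    (hlt : ∀ x ∈ K, ∃ r : ℝ, 0 < r ∧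
      lam * volume (Metric.closedBall x r) < ∫⁻ y in Metric.closedBall x r, F y) :
    ∃ (t : Finset E) (r : E → ℝ), (∀ c ∈ t, 0 < r c) ∧
      (t : Set E).PairwiseDisjoint (fun c ↦ Metric.closedBall c (r c)) ∧
      K ⊆ ⋃ c ∈ t, Metric.closedBall c (5 * r c) ∧
      (∀ c ∈ t, lam * volume (Metric.closedBall c (r c)) ≤ ∫⁻ y in Metric.closedBall c (r c), F y) ∧
      ∀ c ∈ t, ∫⁻ y in Metric.closedBall c (5 * r c), F y ≤
        lam * volume (Metric.closedBall c (5 * r c)) := by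
  -- A ball over which the average exceeds `lam` has volume at most `lam⁻¹ ∫ F`, so its radius is
  -- bounded.
  obtain ⟨R, hR1, hR⟩ : ∃ R : ℝ, 1 ≤ R ∧ ∀ x : E, ∀ r : ℝ, 0 < r →
      lam * volume (Metric.closedBall x r) < ∫⁻ y in Metric.closedBall x r, F y → r ≤ R := by
    have hv : volume (Metric.ball (0 : E) 1) ≠ 0 := (Metric.measure_ball_pos _ _ one_pos).ne'
    have hv' : lam * volume (Metric.ball (0 : E) 1) ≠ 0 := mul_ne_zero hl hv
    refine ⟨max 1 ((∫⁻ x, F x) / (lam * volume (Metric.ball (0 : E) 1))).toReal, le_max_left _ _,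
      fun x r hr h ↦ ?_⟩
    rcases le_or_gt r 1 with h1 | h1
    · exact h1.trans (le_max_left _ _)
    refine le_max_of_le_right ((ENNReal.ofReal_le_iff_le_toReal
      (ENNReal.div_ne_top hF hv')).1 ?_)
    rw [ENNReal.le_div_iff_mul_le (Or.inl hv') (Or.inr hF)]
    calc ENNReal.ofReal r * (lam * volume (Metric.ball (0 : E) 1))
        ≤ ENNReal.ofReal (r ^ Module.finrank ℝ E) * (lam * volume (Metric.ball (0 : E) 1)) := by
          gcongr
          exact le_self_pow₀ h1.le Module.finrank_pos.ne'
      _ = lam * volume (Metric.closedBall x r) := by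
          rw [Measure.addHaar_closedBall _ _ hr.le]
          ring
      _ ≤ ∫⁻ y in Metric.closedBall x r, F y := h.le
      _ ≤ ∫⁻ x, F x := setLIntegral_le_lintegral _ _
  have hchoice : ∀ x : E, ∃ r : ℝ, 0 < r ∧ (x ∈ K →
      lam * volume (Metric.closedBall x r) < ∫⁻ y in Metric.closedBall x r, F y) ∧ (x ∈ K →
      ∫⁻ y in Metric.closedBall x (5 * r), F y ≤ lam * volume (Metric.closedBall x (5 * r))) := by
    intro x
    by_cases hx : x ∈ K
    swap
    · exact ⟨1, one_pos, fun h ↦ absurd h hx, fun h ↦ absurd h hx⟩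
    set S : Set ℝ := {r | 0 < r ∧
      lam * volume (Metric.closedBall x r) < ∫⁻ y in Metric.closedBall x r, F y} with hS
    have hne : S.Nonempty := hlt x hx
    have hbdd : BddAbove S := ⟨R, fun r hr ↦ hR x r hr.1 hr.2⟩
    have hpos : 0 < sSup S := by
      obtain ⟨r, hr⟩ := hne
      exact hr.1.trans_le (le_csSup hbdd hr)
    -- A radius above half of the supremum: then `5 r` is beyond the supremum, and the average over
    -- the enlarged ball is at most `lam`.
    obtain ⟨r, hr, hr2⟩ := exists_lt_of_lt_csSup hne (half_lt_self hpos)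
    refine ⟨r, hr.1, fun _ ↦ hr.2, fun _ ↦ ?_⟩
    by_contra! hcon
    have := le_csSup hbdd (show 5 * r ∈ S from ⟨by linarith [hr.1], hcon⟩)
    linarith [hr.1]
  choose r hr0 hr1 hr2 using hchoice
  obtain ⟨t, htK, htc⟩ := hK.elim_nhds_subcover (fun x ↦ Metric.closedBall x (r x))
    (fun x _ ↦ Metric.closedBall_mem_nhds x (hr0 x))
  obtain ⟨u, hut, hud, huc⟩ := Vitali.exists_disjoint_subfamily_covering_enlargement_closedBall
    (t : Set E) id r R (fun x hx ↦ hR x _ (hr0 x) (hr1 x (htK x hx))) 5 (by norm_num)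
  have hfin : u.Finite := t.finite_toSet.subset hut
  refine ⟨hfin.toFinset, r, fun c _ ↦ hr0 c, by simpa using hud, ?_, fun c hc ↦ ?_, fun c hc ↦ ?_⟩
  · intro x hx
    obtain ⟨a, ha, hxa⟩ := Set.mem_iUnion₂.1 (htc hx)
    obtain ⟨b, hb, hab⟩ := huc a ha
    exact Set.mem_iUnion₂.2 ⟨b, by simpa using hb, hab hxa⟩
  · exact (hr1 c (htK c (hut (by simpa using hc)))).le
  · exact hr2 c (htK c (hut (by simpa using hc)))

/-- By the Lebesgue differentiation theorem, almost every point where `F > lam` is the center of a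
ball over which the average of `F` exceeds `lam`. -/
lemma ae_exists_average_gt {F : E → ℝ≥0∞} (hFm : Measurable F) (hF : ∫⁻ x, F x ≠ ⊤)
    (lam : ℝ≥0∞) : ∀ᵐ x, lam < F x → ∃ r : ℝ, 0 < r ∧
      lam * volume (Metric.closedBall x r) < ∫⁻ y in Metric.closedBall x r, F y := by
  filter_upwards [(IsUnifLocDoublingMeasure.vitaliFamily (volume : Measure E)
    1).ae_tendsto_lintegral_div hFm.aemeasurable hF] with x hx hlt
  have h1 := hx.comp (IsUnifLocDoublingMeasure.tendsto_closedBall_filterAt (K := 1)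
    (volume : Measure E) (l := 𝓝[>] (0 : ℝ)) (fun _ ↦ x) (fun r ↦ r) tendsto_id (by
      filter_upwards [self_mem_nhdsWithin] with r hr
      exact Metric.mem_closedBall_self (by simpa using le_of_lt hr)))
  obtain ⟨r, h2, hr⟩ := ((h1.eventually (lt_mem_nhds hlt)).and self_mem_nhdsWithin).exists
  refine ⟨r, hr, ?_⟩
  simp only [Function.comp_apply] at h2
  rwa [ENNReal.lt_div_iff_mul_lt (Or.inl (Metric.measure_closedBall_pos _ _ hr).ne')
    (Or.inl measure_closedBall_lt_top.ne)] at h2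

/-- Calderón–Zygmund decomposition at height `lam`, up to an error `ρ` of small `L²` norm, which
makes finitely many balls suffice. -/
theorem exists_czDecomposition [Nontrivial E] {f : E → ℂ} (hf : Measurable f)
    (h1 : ∫⁻ x, ‖f x‖ₑ ≠ ⊤) (h2 : ∫⁻ x, ‖f x‖ₑ ^ 2 ≠ ⊤) {lam : ℝ≥0∞} (hl : lam ≠ 0)
    {δ : ℝ≥0∞} (hδ : δ ≠ 0) :
    ∃ (t : Finset E) (r : E → ℝ) (g ρ : E → ℂ) (b : E → E → ℂ),
      (∀ c ∈ t, 0 < r c) ∧ Measurable g ∧ Measurable ρ ∧ (∀ c, Measurable (b c)) ∧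
      (∀ x, f x = g x + ρ x + ∑ c ∈ t, b c x) ∧
      (∀ x, ‖g x‖ₑ ≤ (1 + 5 ^ Module.finrank ℝ E) * lam) ∧
      ∫⁻ x, ‖g x‖ₑ ≤ 2 * ∫⁻ x, ‖f x‖ₑ ∧ ∫⁻ x, ‖ρ x‖ₑ ^ 2 ≤ δ ∧
      (∀ c ∈ t, ∀ x ∉ Metric.closedBall c (r c), b c x = 0) ∧
      (∀ c ∈ t, ∫ x, b c x = 0) ∧ (∀ c, MemLp (b c) 2) ∧
      ∑ c ∈ t, ∫⁻ x, ‖b c x‖ₑ ≤ 2 * ∫⁻ x, ‖f x‖ₑ ∧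
      lam * ∑ c ∈ t, volume (Metric.closedBall c (3 * r c)) ≤
        15 ^ Module.finrank ℝ E * ∫⁻ x, ‖f x‖ₑ := by
  classical
  set d := Module.finrank ℝ E with hd
  set F : E → ℝ≥0∞ := fun x ↦ ‖f x‖ₑ with hFdef
  have hFm : Measurable F := hf.enorm
  -- The error is measured by the finite measure `|f|²`, inner regularity of which replaces the set
  -- `{|f| > lam}` by a compact subset `K`, covered by finitely many balls.
  set ν : Measure E := volume.withDensity (fun x ↦ F x ^ 2) with hν
  have : IsFiniteMeasure ν := isFiniteMeasure_withDensity h2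
  set P : Set E := {x | lam < F x → ∃ r : ℝ, 0 < r ∧
      lam * volume (Metric.closedBall x r) < ∫⁻ y in Metric.closedBall x r, F y} with hP
  have hPae : volume Pᶜ = 0 := ae_exists_average_gt hFm h1 lam
  set Z := toMeasurable volume Pᶜ with hZ
  have hZ0 : volume Z = 0 := by rw [hZ, measure_toMeasurable, hPae]
  have hZm : MeasurableSet Z := measurableSet_toMeasurable _ _
  set Ω : Set E := {x | lam < F x} with hΩ
  have hΩm : MeasurableSet Ω := measurableSet_lt measurable_const hFm
  obtain ⟨K, hKs, hKc, hKδ⟩ := (hΩm.diff hZm).exists_isCompact_sdiff_lt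
    (measure_ne_top ν (Ω \ Z)) hδ
  obtain ⟨t, r, hr, hdisj, hcov, hlow, hup⟩ := exists_vitali_balls h1 hl hKc (fun x hx ↦ by
    have hx' := hKs hx
    have : x ∈ P := by
      by_contra hcon
      exact hx'.2 (subset_toMeasurable _ _ hcon)
    exact this hx'.1)
  obtain ⟨Q, hQsub, hQm, hQd, hQU⟩ := exists_disjoint_refinement t
    (A := fun c ↦ Metric.closedBall c (5 * r c)) (fun _ ↦ measurableSet_closedBall)
  set W : Set E := ⋃ c ∈ t, Q c with hW
  have hWm : MeasurableSet W := t.measurableSet_biUnion fun c _ ↦ hQm c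
  set B : E → Set E := fun c ↦ Metric.closedBall c (r c) with hB
  have hBm : ∀ c, MeasurableSet (B c) := fun c ↦ measurableSet_closedBall
  have hBtop : ∀ c, volume (B c) ≠ ⊤ := fun c ↦ measure_closedBall_lt_top.ne
  have hB0 : ∀ c ∈ t, volume (B c) ≠ 0 := fun c hc ↦ (Metric.measure_closedBall_pos _ _ (hr c hc)).ne'
  have hscale : ∀ c ∈ t, ∀ a : ℕ, volume (Metric.closedBall c (a * r c)) =
      (a : ℝ≥0∞) ^ d * volume (B c) := by
    intro c hc a
    have := hr c hc
    rw [hB, Measure.addHaar_closedBall _ _ (by positivity), Measure.addHaar_closedBall _ _ this.le,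
      mul_pow, ENNReal.ofReal_mul (by positivity), ENNReal.ofReal_pow (by positivity),
      ENNReal.ofReal_natCast, mul_assoc]
  set a : E → ℂ := fun c ↦ ((volume (B c)).toReal : ℂ)⁻¹ * ∫ y in Q c, f y with ha
  have hnorma : ∀ c ∈ t, ‖a c‖ₑ = (volume (B c))⁻¹ * ‖∫ y in Q c, f y‖ₑ := by
    intro c hc
    have h0 : ((volume (B c)).toReal : ℂ) ≠ 0 := by
      exact_mod_cast (ENNReal.toReal_pos (hB0 c hc) (hBtop c)).ne'
    rw [ha, enorm_mul, enorm_inv h0, ← ofReal_norm, Complex.norm_real,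
      Real.norm_of_nonneg ENNReal.toReal_nonneg, ENNReal.ofReal_toReal (hBtop c)]
  have hint : ∀ c ∈ t, ‖∫ y in Q c, f y‖ₑ ≤ ∫⁻ y in Q c, F y := fun c _ ↦
    enorm_integral_le_lintegral_enorm _
  have haB : ∀ c ∈ t, ‖a c‖ₑ * volume (B c) ≤ ∫⁻ y in Q c, F y := by
    intro c hc
    rw [hnorma c hc, mul_right_comm, ENNReal.inv_mul_cancel (hB0 c hc) (hBtop c), one_mul]
    exact hint c hc
  have hale : ∀ c ∈ t, ‖a c‖ₑ ≤ 5 ^ d * lam := by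
    intro c hc
    rw [hnorma c hc]
    calc (volume (B c))⁻¹ * ‖∫ y in Q c, f y‖ₑ
        ≤ (volume (B c))⁻¹ * (lam * (5 ^ d * volume (B c))) := by
          gcongr
          refine (hint c hc).trans ((lintegral_mono_set (hQsub c hc)).trans ((hup c hc).trans ?_))
          exact (congrArg (lam * ·) (hscale c hc 5)).le
      _ = (5 ^ d * lam) * ((volume (B c))⁻¹ * volume (B c)) := by ring
      _ = _ := by rw [ENNReal.inv_mul_cancel (hB0 c hc) (hBtop c), mul_one]
  have hsumQ : ∑ c ∈ t, ∫⁻ y in Q c, F y = ∫⁻ y in W, F y := by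
    rw [hW, lintegral_biUnion_finset hQd (fun c _ ↦ hQm c)]
  have hfi : Integrable f := ⟨hf.aestronglyMeasurable, h1.lt_top⟩
  have hf2 : MemLp f 2 := (memLp_two_iff hf).2 h2.lt_top
  have hind : ∀ c, MemLp ((B c).indicator fun _ ↦ a c) 2 := fun c ↦
    memLp_indicator_const 2 (hBm c) _ (Or.inr (hBtop c))
  -- The good part is `f` off the balls and off `{|f| > lam}`, plus the constants `a c` on the small
  -- balls `B c`; these constants have the integral of `f` over `Q c`, which gives `b c` mean zero.
  -- The error `ρ` is `f` on the part of `{|f| > lam}` that the balls miss.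
  refine ⟨t, fun c ↦ 5 * r c,
    fun x ↦ (W ∪ Ω)ᶜ.indicator f x + ∑ c ∈ t, (B c).indicator (fun _ ↦ a c) x,
    (Ω \ W).indicator f, fun c x ↦ (Q c).indicator f x - (B c).indicator (fun _ ↦ a c) x,
    fun c hc ↦ by have := hr c hc; positivity, ?_, hf.indicator (hΩm.diff hWm), ?_, ?_, ?_, ?_, ?_,
    ?_, ?_, ?_, ?_, ?_⟩
  · exact (hf.indicator (hWm.union hΩm).compl).add
      (Finset.measurable_sum _ fun c _ ↦ measurable_const.indicator (hBm c))
  · exact fun c ↦ (hf.indicator (hQm c)).sub (measurable_const.indicator (hBm c))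
  · intro x
    rw [Finset.sum_sub_distrib]
    have e : W.indicator f x = ∑ c ∈ t, (Q c).indicator f x := by
      rw [hW, Finset.indicator_biUnion _ _ hQd]
    rw [← e]
    by_cases hxW : x ∈ W <;> by_cases hxΩ : x ∈ Ω <;> simp [Set.indicator, hxW, hxΩ]
  · intro x
    rw [add_mul, one_mul]
    refine (enorm_add_le _ _).trans (add_le_add ?_ ?_)
    · by_cases hx : x ∈ (W ∪ Ω)ᶜ
      · rw [Set.indicator_of_mem hx]
        have : x ∉ Ω := fun h ↦ hx (Or.inr h)
        exact not_lt.1 this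
      · rw [Set.indicator_of_notMem hx]
        simp
    · by_cases hx : ∃ c ∈ t, x ∈ B c
      · obtain ⟨c, hc, hxc⟩ := hx
        rw [Finset.sum_eq_single_of_mem c hc, Set.indicator_of_mem hxc]
        · exact hale c hc
        · intro c' hc' hne
          exact Set.indicator_of_notMem (fun h ↦ Set.disjoint_left.1 (hdisj hc' hc hne) h hxc) _
      · rw [Finset.sum_eq_zero fun c hc ↦ Set.indicator_of_notMem (fun h ↦ hx ⟨c, hc, h⟩) _]
        simp
  · have hm : ∀ c ∈ t, Measurable (fun x ↦ ‖(B c).indicator (fun _ ↦ a c) x‖ₑ) := fun c _ ↦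
      (measurable_const.indicator (hBm c)).enorm
    calc _ ≤ ∫⁻ x, (‖(W ∪ Ω)ᶜ.indicator f x‖ₑ + ∑ c ∈ t, ‖(B c).indicator (fun _ ↦ a c) x‖ₑ) := by
          gcongr with x
          refine (enorm_add_le _ _).trans (add_le_add le_rfl ?_)
          exact enorm_sum_le _ _
      _ = (∫⁻ x, ‖(W ∪ Ω)ᶜ.indicator f x‖ₑ) +
            ∑ c ∈ t, ∫⁻ x, ‖(B c).indicator (fun _ ↦ a c) x‖ₑ := by
          rw [lintegral_add_left (hf.indicator (hWm.union hΩm).compl).enorm,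
            lintegral_finsetSum _ hm]
      _ ≤ (∫⁻ x, F x) + ∑ c ∈ t, ∫⁻ y in Q c, F y := by
          refine add_le_add (lintegral_mono fun x ↦ enorm_indicator_le_enorm_self _ _)
            (Finset.sum_le_sum fun c hc ↦ le_trans (le_of_eq ?_) (haB c hc))
          simp_rw [enorm_indicator_eq_indicator_enorm]
          rw [lintegral_indicator_const (hBm c)]
      _ ≤ (∫⁻ x, F x) + ∫⁻ x, F x := by
          rw [hsumQ]
          gcongr
          exact Measure.restrict_le_self
      _ = _ := (two_mul _).symm
  · calc _ = ν (Ω \ W) := by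
          rw [hν, withDensity_apply _ (hΩm.diff hWm), ← lintegral_indicator (hΩm.diff hWm)]
          refine lintegral_congr fun x ↦ ?_
          by_cases hx : x ∈ Ω \ W
          · rw [Set.indicator_of_mem hx, Set.indicator_of_mem hx]
          · rw [Set.indicator_of_notMem hx, Set.indicator_of_notMem hx]
            simp
      _ ≤ ν ((Ω \ Z) \ K ∪ Z) := by
          apply measure_mono
          rintro x ⟨hx1, hx2⟩
          by_cases hxZ : x ∈ Z
          · exact Or.inr hxZ
          · refine Or.inl ⟨⟨hx1, hxZ⟩, fun hxK ↦ hx2 ?_⟩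
            rw [hQU]
            exact hcov hxK
      _ ≤ ν ((Ω \ Z) \ K) + ν Z := measure_union_le _ _
      _ ≤ δ + 0 := by
          gcongr
          exact (withDensity_absolutelyContinuous _ _ hZ0).le
      _ = δ := add_zero _
  · intro c hc x hx
    have e1 : x ∉ Q c := fun h ↦ hx (hQsub c hc h)
    have e2 : x ∉ B c := fun h ↦ hx
      (Metric.closedBall_subset_closedBall (by linarith [hr c hc]) h)
    simp [e1, e2]
  · intro c hc
    have h0 : ((volume (B c)).toReal : ℂ) ≠ 0 := by
      exact_mod_cast (ENNReal.toReal_pos (hB0 c hc) (hBtop c)).ne'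
    rw [integral_sub (hfi.indicator (hQm c))
      ((integrable_indicator_iff (hBm c)).2 (integrableOn_const (hBtop c))),
      integral_indicator (hQm c), integral_indicator_const _ (hBm c), Measure.real,
      Complex.real_smul, ha, mul_inv_cancel_left₀ h0, sub_self]
  · exact fun c ↦ (hf2.indicator (hQm c)).sub (hind c)
  · calc _ ≤ ∑ c ∈ t, ((∫⁻ y in Q c, F y) + ∫⁻ y in Q c, F y) := by
          apply Finset.sum_le_sum fun c hc ↦ ?_
          calc _ ≤ ∫⁻ x, (‖(Q c).indicator f x‖ₑ + ‖(B c).indicator (fun _ ↦ a c) x‖ₑ) := by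
                gcongr with x
                exact enorm_sub_le
            _ = _ := lintegral_add_left (hf.indicator (hQm c)).enorm _
            _ ≤ _ := by
                refine add_le_add (le_of_eq ?_) (le_trans (le_of_eq ?_) (haB c hc))
                · simp_rw [enorm_indicator_eq_indicator_enorm]
                  rw [lintegral_indicator (hQm c)]
                · simp_rw [enorm_indicator_eq_indicator_enorm]
                  rw [lintegral_indicator_const (hBm c)]
      _ = 2 * ∫⁻ x in W, F x := by
          rw [Finset.sum_add_distrib, hsumQ, two_mul]
      _ ≤ _ := by
          gcongr
          exact Measure.restrict_le_self
  -- The tripled balls of the decomposition have radius `3 * (5 * r c)`, and the balls `B c` are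
  -- disjoint with averages at least `lam`.
  · calc _ = 15 ^ d * ∑ c ∈ t, lam * volume (B c) := by
          rw [Finset.mul_sum, Finset.mul_sum]
          refine Finset.sum_congr rfl fun c hc ↦ ?_
          have := hscale c hc 15
          rw [← mul_assoc, show (3 : ℝ) * 5 = ((15 : ℕ) : ℝ) by norm_num, this]
          push_cast
          ring
      _ ≤ 15 ^ d * ∑ c ∈ t, ∫⁻ y in B c, F y := by
          gcongr with c hc
          exact hlow c hc
      _ = 15 ^ d * ∫⁻ y in ⋃ c ∈ t, B c, F y := by
          rw [lintegral_biUnion_finset hdisj (fun c _ ↦ hBm c)]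
      _ ≤ _ := by
          gcongr
          exact Measure.restrict_le_self

/-! ### Weak type `(1, 1)` -/

/-- Complex-valued square-integrable functions. -/
abbrev L2 (E : Type*) [MeasureSpace E] := Lp ℂ 2 (volume : Measure E)

/-- The cancellation estimate for `S` on mean-zero functions supported in a ball, away from
the tripled ball. -/
def HormanderBound (S : L2 E →L[ℂ] L2 E) (A : ℝ≥0∞) : Prop :=
  ∀ (c : E) (R : ℝ), 0 < R → ∀ b : L2 E, (∀ᵐ x, x ∉ Metric.closedBall c R → b x = 0) →
    ∫ x, b x = 0 → ∫⁻ x in (Metric.closedBall c (3 * R))ᶜ, ‖S b x‖ₑ ≤ A * ∫⁻ x, ‖b x‖ₑ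

/-- The constant in the weak-type estimate `mul_volume_lt_enorm_le`. -/
def weakConst (d : ℕ) (A : ℝ≥0∞) : ℝ≥0∞ :=
  15 ^ d + 18 * A ^ 2 * (1 + 5 ^ d) + 9 * A ^ 2 + 6 * A

lemma lintegral_enorm_sq_apply_le {S : L2 E →L[ℂ] L2 E} {A : ℝ≥0∞}
    (hS : ∀ f, ‖S f‖ₑ ≤ A * ‖f‖ₑ) (f : L2 E) :
    ∫⁻ x, ‖S f x‖ₑ ^ 2 ≤ A ^ 2 * ∫⁻ x, ‖f x‖ₑ ^ 2 := by
  rw [← enorm_sq_Lp, ← enorm_sq_Lp, ← mul_pow]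
  gcongr
  exact hS f

lemma sq_mul_volume_le_enorm {S : L2 E →L[ℂ] L2 E} {A : ℝ≥0∞}
    (hS : ∀ f, ‖S f‖ₑ ≤ A * ‖f‖ₑ) (f : L2 E) (m : ℝ≥0∞) :
    m ^ 2 * volume {x | m ≤ ‖S f x‖ₑ} ≤ A ^ 2 * ∫⁻ x, ‖f x‖ₑ ^ 2 := by
  refine le_trans ?_ (lintegral_enorm_sq_apply_le hS f)
  refine le_trans ?_ (mul_meas_ge_le_lintegral
    ((measurable_coeFn_Lp (S f)).enorm.pow_const 2) (m ^ 2))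
  exact mul_le_mul' le_rfl (measure_mono fun x hx ↦ ENNReal.pow_le_pow_left hx)

/-- The weak-type `(1, 1)` estimate for an `L²`-bounded operator satisfying the cancellation
estimate. -/
theorem mul_volume_lt_enorm_le [Nontrivial E] {S : L2 E →L[ℂ] L2 E} {A : ℝ≥0∞}
    (hS : ∀ f, ‖S f‖ₑ ≤ A * ‖f‖ₑ) (hH : HormanderBound S A) (f : L2 E) {lam : ℝ≥0∞}
    (hl : lam ≠ 0) (hl' : lam ≠ ⊤) :
    lam * volume {x | lam < ‖S f x‖ₑ} ≤
      weakConst (Module.finrank ℝ E) A * ∫⁻ x, ‖f x‖ₑ := by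
  set d := Module.finrank ℝ E with hd
  set I := ∫⁻ x, ‖f x‖ₑ with hI
  rcases eq_or_ne I ⊤ with hIt | hIt
  · have : weakConst d A ≠ 0 := by
      simp [weakConst]
    rw [hIt, ENNReal.mul_top this]
    exact le_top
  rcases eq_or_ne I 0 with hI0 | hI0
  · have hf0 : f = 0 := by
      rw [hI, lintegral_eq_zero_iff (measurable_coeFn_Lp f).enorm] at hI0
      rw [Lp.eq_zero_iff_ae_eq_zero]
      filter_upwards [hI0] with x hx
      simpa using hx
    have : volume {x | lam < ‖S f x‖ₑ} = 0 := by
      have h0 : ∀ᵐ x : E, ¬ lam < ‖S f x‖ₑ := by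
        rw [hf0, map_zero]
        filter_upwards [Lp.coeFn_zero ℂ 2 (volume : Measure E)] with x hx
        rw [hx]
        simp
      simpa only [ae_iff, not_not] using h0
    rw [this, mul_zero]
    exact zero_le
  -- Each of the three parts of the decomposition gets a third of the height.
  set m := lam / 3 with hm
  have h3m : lam = 3 * m := by
    rw [hm, ENNReal.mul_div_cancel (by norm_num) (by norm_num)]
  have hm0 : m ≠ 0 := by
    rintro h
    rw [h, mul_zero] at h3m
    exact hl h3m
  have hmt : m ≠ ⊤ := ENNReal.div_ne_top hl' (by norm_num)
  have hf2 : ∫⁻ x, ‖f x‖ₑ ^ 2 ≠ ⊤ := by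
    rw [← enorm_sq_Lp]
    finiteness
  -- The error `δ = lam * I` has the size of the `L²` bound for the good part, so that it
  -- contributes a term of the same order.
  obtain ⟨t, r, g, ρ, b, hr, hgm, hρm, hbm, hdec, hgb, hg1, hρ, hbs, hb0, hb2, hb1, hvol⟩ :=
    exists_czDecomposition (measurable_coeFn_Lp f) hIt hf2 hl (δ := lam * I) (mul_ne_zero hl hI0)
  rw [← hd, ← hI] at *
  have hg2 : ∫⁻ x, ‖g x‖ₑ ^ 2 ≤ (1 + 5 ^ d) * lam * (2 * I) := by
    calc _ ≤ ∫⁻ x, (1 + 5 ^ d) * lam * ‖g x‖ₑ := by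
          gcongr with x
          rw [sq]
          gcongr
          exact hgb x
      _ = (1 + 5 ^ d) * lam * ∫⁻ x, ‖g x‖ₑ := lintegral_const_mul _ hgm.enorm
      _ ≤ _ := by gcongr
  have hgL : MemLp g 2 := (memLp_two_iff hgm).2 (hg2.trans_lt (by finiteness))
  have hρL : MemLp ρ 2 := (memLp_two_iff hρm).2 (hρ.trans_lt (by finiteness))
  set G : L2 E := hgL.toLp g with hG
  set P : L2 E := hρL.toLp ρ with hP
  set Bf : E → L2 E := fun c ↦ (hb2 c).toLp (b c) with hBf
  have hsum : f = G + P + ∑ c ∈ t, Bf c := by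
    apply Lp.ext
    have h1 : ∀ᵐ x, ∀ c ∈ t, Bf c x = b c x :=
      (ae_ball_iff t.countable_toSet).2 fun c _ ↦ (hb2 c).coeFn_toLp
    filter_upwards [Lp.coeFn_add (G + P) (∑ c ∈ t, Bf c), Lp.coeFn_add G P,
      Lp.coeFn_finsetSum t Bf, hgL.coeFn_toLp, hρL.coeFn_toLp, h1] with x e1 e2 e3 e4 e5 e6
    rw [e1, Pi.add_apply, e2, Pi.add_apply, e3, e4, e5, hdec, Finset.sum_apply,
      Finset.sum_congr rfl e6]
  have hSsum : ∀ᵐ x, ‖S f x‖ₑ ≤ ‖S G x‖ₑ + ‖S P x‖ₑ + ∑ c ∈ t, ‖S (Bf c) x‖ₑ := by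
    have e : S f = S G + S P + ∑ c ∈ t, S (Bf c) := by
      rw [hsum, map_add, map_add, map_sum]
    filter_upwards [Lp.coeFn_add (S G + S P) (∑ c ∈ t, S (Bf c)), Lp.coeFn_add (S G) (S P),
      Lp.coeFn_finsetSum t (fun c ↦ S (Bf c))] with x e1 e2 e3
    rw [e, e1, Pi.add_apply, e2, Pi.add_apply, e3, Finset.sum_apply]
    refine (enorm_add_le _ _).trans (add_le_add (enorm_add_le _ _) (enorm_sum_le _ _))
  set U : Set E := ⋃ c ∈ t, Metric.closedBall c (3 * r c) with hU
  have hUm : MeasurableSet U := t.measurableSet_biUnion fun c _ ↦ measurableSet_closedBall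
  have hBm : Measurable (fun x ↦ ∑ c ∈ t, ‖S (Bf c) x‖ₑ) :=
    Finset.measurable_sum _ fun c _ ↦ (measurable_coeFn_Lp _).enorm
  have hsub : volume {x | lam < ‖S f x‖ₑ} ≤ volume {x | m ≤ ‖S G x‖ₑ} +
      volume {x | m ≤ ‖S P x‖ₑ} + volume U +
      volume.restrict Uᶜ {x | m ≤ ∑ c ∈ t, ‖S (Bf c) x‖ₑ} := by
    set V : Set E := (({x | m ≤ ‖S G x‖ₑ} ∪ {x | m ≤ ‖S P x‖ₑ}) ∪ U) ∪
      ({x | m ≤ ∑ c ∈ t, ‖S (Bf c) x‖ₑ} ∩ Uᶜ) with hV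
    have hae : {x | lam < ‖S f x‖ₑ} ≤ᵐ[volume] V := by
      filter_upwards [hSsum] with x hx hlx
      change lam < ‖S f x‖ₑ at hlx
      change x ∈ V
      by_contra hcon
      rw [hV] at hcon
      simp only [Set.mem_union, Set.mem_inter_iff, Set.mem_ofPred_eq, Set.mem_compl_iff,
        not_or, not_and, not_not, not_le] at hcon
      obtain ⟨⟨⟨c1, c2⟩, c3⟩, c4⟩ := hcon
      have c5 : ∑ c ∈ t, ‖S (Bf c) x‖ₑ < m := by
        by_contra! h
        exact c3 (c4 h)
      have := ENNReal.add_lt_add (ENNReal.add_lt_add c1 c2) c5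
      have h4 : m + m + m = lam := by rw [h3m]; ring
      rw [h4] at this
      exact absurd (hlx.trans_le hx) this.not_gt
    refine (measure_mono_ae hae).trans ?_
    refine (measure_union_le _ _).trans (add_le_add ((measure_union_le _ _).trans
      (add_le_add (measure_union_le _ _) le_rfl)) ?_)
    rw [Measure.restrict_apply (measurableSet_le measurable_const hBm)]
  have cancel : ∀ {v c : ℝ≥0∞}, m ^ 2 * v ≤ m * c → m * v ≤ c := by
    intro v c h
    rw [sq, mul_assoc] at h
    exact (ENNReal.mul_le_mul_iff_right hm0 hmt).1 h
  -- Chebyshev in `L²` for the good part and the error, the volume of the exceptional set `U`, and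
  -- Chebyshev in `L¹` off `U` for the mean-zero parts.
  have hA1 : m * volume {x | m ≤ ‖S G x‖ₑ} ≤ 6 * A ^ 2 * (1 + 5 ^ d) * I := by
    apply cancel
    refine (sq_mul_volume_le_enorm hS G m).trans ?_
    have : ∫⁻ x, ‖G x‖ₑ ^ 2 = ∫⁻ x, ‖g x‖ₑ ^ 2 := by
      apply lintegral_congr_ae
      filter_upwards [hgL.coeFn_toLp] with x hx
      rw [hx]
    rw [this]
    calc _ ≤ A ^ 2 * ((1 + 5 ^ d) * lam * (2 * I)) := by gcongr
      _ = _ := by rw [h3m]; ring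
  have hA2 : m * volume {x | m ≤ ‖S P x‖ₑ} ≤ 3 * A ^ 2 * I := by
    apply cancel
    refine (sq_mul_volume_le_enorm hS P m).trans ?_
    have : ∫⁻ x, ‖P x‖ₑ ^ 2 = ∫⁻ x, ‖ρ x‖ₑ ^ 2 := by
      apply lintegral_congr_ae
      filter_upwards [hρL.coeFn_toLp] with x hx
      rw [hx]
    rw [this]
    calc _ ≤ A ^ 2 * (lam * I) := by gcongr
      _ = _ := by rw [h3m]; ring
  have hA3 : lam * volume U ≤ 15 ^ d * I := by
    refine le_trans ?_ hvol
    gcongr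
    exact measure_biUnion_finset_le _ _
  have hA4 : m * volume.restrict Uᶜ {x | m ≤ ∑ c ∈ t, ‖S (Bf c) x‖ₑ} ≤ 2 * A * I := by
    refine (mul_meas_ge_le_lintegral hBm m).trans ?_
    rw [lintegral_finsetSum _ fun c _ ↦ (measurable_coeFn_Lp _).enorm]
    calc _ ≤ ∑ c ∈ t, A * ∫⁻ x, ‖b c x‖ₑ := by
          apply Finset.sum_le_sum fun c hc ↦ ?_
          have e : Bf c =ᵐ[volume] b c := (hb2 c).coeFn_toLp
          have h1 : ∫⁻ x, ‖Bf c x‖ₑ = ∫⁻ x, ‖b c x‖ₑ := by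
            apply lintegral_congr_ae
            filter_upwards [e] with x hx
            rw [hx]
          rw [← h1]
          refine le_trans (lintegral_mono_set ?_) (hH c (r c) (hr c hc) (Bf c) ?_ ?_)
          · exact Set.compl_subset_compl.2 (Set.subset_biUnion_of_mem
              (u := fun c ↦ Metric.closedBall c (3 * r c)) hc)
          · filter_upwards [e] with x hx hx2
            rw [hx, hbs c hc x hx2]
          · rw [integral_congr_ae e, hb0 c hc]
      _ = A * ∑ c ∈ t, ∫⁻ x, ‖b c x‖ₑ := by rw [Finset.mul_sum]
      _ ≤ A * (2 * I) := by gcongr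
      _ = _ := by ring
  calc _ ≤ lam * (volume {x | m ≤ ‖S G x‖ₑ} +
      volume {x | m ≤ ‖S P x‖ₑ} + volume U +
      volume.restrict Uᶜ {x | m ≤ ∑ c ∈ t, ‖S (Bf c) x‖ₑ}) := by gcongr
    _ = 3 * (m * volume {x | m ≤ ‖S G x‖ₑ}) + 3 * (m * volume {x | m ≤ ‖S P x‖ₑ}) +
        lam * volume U + 3 * (m * volume.restrict Uᶜ {x | m ≤ ∑ c ∈ t, ‖S (Bf c) x‖ₑ}) := by
      rw [mul_add, mul_add, mul_add]
      nth_rw 1 2 4 [h3m]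
      ring
    _ ≤ 3 * (6 * A ^ 2 * (1 + 5 ^ d) * I) + 3 * (3 * A ^ 2 * I) + 15 ^ d * I +
        3 * (2 * A * I) := by gcongr
    _ = _ := by
      rw [weakConst]
      ring

/-! ### Interpolation -/

lemma lintegral_Ioi_indicator_lt {q a : ℝ} (hq : 1 < q) (ha : 0 ≤ a) :
    ∫⁻ t in Set.Ioi (0 : ℝ), {t | t < a}.indicator (fun t ↦ ENNReal.ofReal (t ^ (q - 2))) t ≤
      ENNReal.ofReal (1 / (q - 1)) * ENNReal.ofReal (a ^ (q - 1)) := by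
  have hm : MeasurableSet {t : ℝ | t < a} := measurableSet_Iio
  rw [lintegral_indicator hm, Measure.restrict_restrict hm]
  calc _ ≤ ∫⁻ t in Set.Ioc 0 a, ENNReal.ofReal (t ^ (q - 2)) :=
        lintegral_mono_set fun t ht ↦ ⟨ht.2, le_of_lt ht.1⟩
    _ = ENNReal.ofReal (∫ t in Set.Ioc 0 a, t ^ (q - 2)) := by
        rw [ofReal_integral_eq_lintegral_ofReal]
        · exact (intervalIntegrable_iff_integrableOn_Ioc_of_le ha).1
            (intervalIntegral.intervalIntegrable_rpow' (by linarith))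
        · refine (ae_restrict_iff' measurableSet_Ioc).2 (Eventually.of_forall fun t ht ↦ ?_)
          have := ht.1
          simp only [Pi.zero_apply]
          positivity
    _ = _ := by
        have : 0 < q - 1 := by linarith
        rw [← intervalIntegral.integral_of_le ha, integral_rpow (by left; linarith),
          ← ENNReal.ofReal_mul (by positivity), show q - 2 + 1 = q - 1 by ring,
          Real.zero_rpow this.ne']
        congr 1
        ring

lemma lintegral_Ioi_indicator_ge {q r a : ℝ} (hqr : q < r) (ha : 0 < a) :
    ∫⁻ t in Set.Ioi (0 : ℝ), {t | a ≤ t}.indicator (fun t ↦ ENNReal.ofReal (t ^ (q - 1 - r))) t ≤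
      ENNReal.ofReal (1 / (r - q)) * ENNReal.ofReal (a ^ (q - r)) := by
  have hm : MeasurableSet {t : ℝ | a ≤ t} := measurableSet_Ici
  rw [lintegral_indicator hm, Measure.restrict_restrict hm]
  calc _ ≤ ∫⁻ t in Set.Ici a, ENNReal.ofReal (t ^ (q - 1 - r)) :=
        lintegral_mono_set fun t ht ↦ ht.1
    _ = ENNReal.ofReal (∫ t in Set.Ioi a, t ^ (q - 1 - r)) := by
        rw [setLIntegral_congr Ioi_ae_eq_Ici.symm, ofReal_integral_eq_lintegral_ofReal]
        · exact integrableOn_Ioi_rpow_of_lt (by linarith) ha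
        · refine (ae_restrict_iff' measurableSet_Ioi).2 (Eventually.of_forall fun t ht ↦ ?_)
          have : 0 < t := ha.trans ht
          simp only [Pi.zero_apply]
          positivity
    _ = _ := by
        have : 0 < r - q := by linarith
        have h2 : q - r ≠ 0 := by linarith
        rw [integral_Ioi_rpow_of_lt (by linarith) ha, ← ENNReal.ofReal_mul (by positivity),
          show q - 1 - r + 1 = q - r by ring]
        congr 1
        field_simp
        ring

lemma memLp_indicator_Lp (f : L2 E) {s : Set E} (hs : MeasurableSet s) :
    MemLp (s.indicator f) 2 := (Lp.memLp f).indicator hs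

/-- Splitting `f` at height `t` in the distribution function of `S f`. -/
lemma volume_lt_le_of_weak_of_strong {S : L2 E →L[ℂ] L2 E} {W : ℝ≥0∞}
    (hW : ∀ (f : L2 E) (lam : ℝ≥0∞), lam ≠ 0 → lam ≠ ⊤ →
      lam * volume {x | lam < ‖S f x‖ₑ} ≤ W * ∫⁻ x, ‖f x‖ₑ)
    {r q : ℝ} (hr : 0 < r) {M : ℝ≥0∞}
    (hM : ∀ f : L2 E, ∫⁻ x, ‖S f x‖ₑ ^ r ≤ M * ∫⁻ x, ‖f x‖ₑ ^ r) (f : L2 E) {t : ℝ} (ht : 0 < t) :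
    volume {x | t < ‖S f x‖} * ENNReal.ofReal (t ^ (q - 1)) ≤
      2 * W * (∫⁻ x, {x | t < ‖f x‖}.indicator
        (fun x ↦ ENNReal.ofReal (t ^ (q - 2)) * ‖f x‖ₑ) x) +
      2 ^ r * M * ∫⁻ x, {x | ‖f x‖ ≤ t}.indicator
        (fun x ↦ ENNReal.ofReal (t ^ (q - 1 - r)) * ‖f x‖ₑ ^ r) x := by
  have hfm := measurable_coeFn_Lp f
  have hs1 : MeasurableSet {x | t < ‖f x‖} := measurableSet_lt measurable_const hfm.norm
  have hs2 : MeasurableSet {x | ‖f x‖ ≤ t} := measurableSet_le hfm.norm measurable_const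
  set f1 : L2 E := (memLp_indicator_Lp f hs1).toLp _ with hf1
  set f2 : L2 E := (memLp_indicator_Lp f hs2).toLp _ with hf2
  have e1 : f1 =ᵐ[volume] {x | t < ‖f x‖}.indicator f := (memLp_indicator_Lp f hs1).coeFn_toLp
  have e2 : f2 =ᵐ[volume] {x | ‖f x‖ ≤ t}.indicator f := (memLp_indicator_Lp f hs2).coeFn_toLp
  have hsum : f = f1 + f2 := by
    apply Lp.ext
    filter_upwards [Lp.coeFn_add f1 f2, e1, e2] with x h1 h2 h3
    rw [h1, Pi.add_apply, h2, h3]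
    by_cases hx : t < ‖f x‖
    · simp [Set.indicator, hx, not_le.2 hx]
    · simp [Set.indicator, hx, not_lt.1 hx]
  set m : ℝ≥0∞ := ENNReal.ofReal (t / 2) with hm
  have hm0 : m ≠ 0 := by simp [hm, ht]
  have hmt : m ≠ ⊤ := ENNReal.ofReal_ne_top
  have hsub : volume {x | t < ‖S f x‖} ≤
      volume {x | m < ‖S f1 x‖ₑ} + volume {x | m ^ r ≤ ‖S f2 x‖ₑ ^ r} := by
    set V : Set E := {x | m < ‖S f1 x‖ₑ} ∪ {x | m ^ r ≤ ‖S f2 x‖ₑ ^ r} with hV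
    have hae : {x | t < ‖S f x‖} ≤ᵐ[volume] V := by
      have e : S f = S f1 + S f2 := by rw [hsum, map_add]
      filter_upwards [Lp.coeFn_add (S f1) (S f2)] with x hx hlx
      change t < ‖S f x‖ at hlx
      change x ∈ V
      by_contra hcon
      rw [hV] at hcon
      simp only [Set.mem_union, Set.mem_ofPred_eq, not_or, not_lt, not_le] at hcon
      have h2 : ‖S f2 x‖ₑ < m := (ENNReal.rpow_lt_rpow_iff hr).1 hcon.2
      have h3 : ‖S f x‖ₑ ≤ m + m := by
        rw [e, hx]
        exact (enorm_add_le _ _).trans (add_le_add hcon.1 h2.le)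
      rw [← ofReal_norm, hm, ← ENNReal.ofReal_add (by positivity) (by positivity), add_halves,
        ENNReal.ofReal_le_ofReal_iff ht.le] at h3
      exact absurd hlx h3.not_gt
    exact (measure_mono_ae hae).trans (measure_union_le _ _)
  have h1 : volume {x | m < ‖S f1 x‖ₑ} * ENNReal.ofReal (t ^ (q - 1)) ≤
      2 * W * (∫⁻ x, {x | t < ‖f x‖}.indicator
        (fun x ↦ ENNReal.ofReal (t ^ (q - 2)) * ‖f x‖ₑ) x) := by
    have h3 : ENNReal.ofReal (t ^ (q - 1)) = 2 * ENNReal.ofReal (t ^ (q - 2)) * m := by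
      rw [hm, ← ENNReal.ofReal_ofNat, ← ENNReal.ofReal_mul (by positivity),
        ← ENNReal.ofReal_mul (by positivity), show q - 1 = q - 2 + 1 by ring,
        Real.rpow_add_one ht.ne']
      congr 1
      ring
    have h4 : ∫⁻ x, {x | t < ‖f x‖}.indicator
        (fun x ↦ ENNReal.ofReal (t ^ (q - 2)) * ‖f x‖ₑ) x =
        ENNReal.ofReal (t ^ (q - 2)) * ∫⁻ x, ‖f1 x‖ₑ := by
      rw [← lintegral_const_mul' _ _ (by finiteness)]
      apply lintegral_congr_ae
      filter_upwards [e1] with x hx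
      rw [hx]
      by_cases h : x ∈ {x | t < ‖f x‖}
      · rw [Set.indicator_of_mem h, Set.indicator_of_mem h]
      · rw [Set.indicator_of_notMem h, Set.indicator_of_notMem h]
        simp
    rw [h4, h3]
    calc _ = 2 * ENNReal.ofReal (t ^ (q - 2)) * (m * volume {x | m < ‖S f1 x‖ₑ}) := by ring
      _ ≤ 2 * ENNReal.ofReal (t ^ (q - 2)) * (W * ∫⁻ x, ‖f1 x‖ₑ) := by
          exact mul_le_mul' le_rfl (hW f1 m hm0 hmt)
      _ = _ := by ring
  have h2 : volume {x | m ^ r ≤ ‖S f2 x‖ₑ ^ r} * ENNReal.ofReal (t ^ (q - 1)) ≤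
      2 ^ r * M * (∫⁻ x, {x | ‖f x‖ ≤ t}.indicator
        (fun x ↦ ENNReal.ofReal (t ^ (q - 1 - r)) * ‖f x‖ₑ ^ r) x) := by
    have h3 : ENNReal.ofReal (t ^ (q - 1)) =
        2 ^ r * ENNReal.ofReal (t ^ (q - 1 - r)) * m ^ r := by
      have h2r : (2 : ℝ≥0∞) ^ r = ENNReal.ofReal (2 ^ r) := by
        rw [← ENNReal.ofReal_rpow_of_pos two_pos, ENNReal.ofReal_ofNat]
      rw [hm, h2r, ENNReal.ofReal_rpow_of_pos (by positivity),
        ← ENNReal.ofReal_mul (by positivity),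
        ← ENNReal.ofReal_mul (by positivity), Real.div_rpow ht.le two_pos.le]
      congr 1
      have : t ^ (q - 1) = t ^ (q - 1 - r) * t ^ r := by
        rw [← Real.rpow_add ht]
        congr 1
        ring
      rw [this]
      have : (2 : ℝ) ^ r ≠ 0 := by positivity
      field_simp
    have h4 : ∫⁻ x, {x | ‖f x‖ ≤ t}.indicator
        (fun x ↦ ENNReal.ofReal (t ^ (q - 1 - r)) * ‖f x‖ₑ ^ r) x =
        ENNReal.ofReal (t ^ (q - 1 - r)) * ∫⁻ x, ‖f2 x‖ₑ ^ r := by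
      rw [← lintegral_const_mul' _ _ (by finiteness)]
      apply lintegral_congr_ae
      filter_upwards [e2] with x hx
      rw [hx]
      by_cases h : x ∈ {x | ‖f x‖ ≤ t}
      · rw [Set.indicator_of_mem h, Set.indicator_of_mem h]
      · rw [Set.indicator_of_notMem h, Set.indicator_of_notMem h]
        simp [hr]
    rw [h4, h3]
    calc _ = 2 ^ r * ENNReal.ofReal (t ^ (q - 1 - r)) *
          (m ^ r * volume {x | m ^ r ≤ ‖S f2 x‖ₑ ^ r}) := by ring
      _ ≤ 2 ^ r * ENNReal.ofReal (t ^ (q - 1 - r)) * (M * ∫⁻ x, ‖f2 x‖ₑ ^ r) := by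
          exact mul_le_mul' le_rfl ((mul_meas_ge_le_lintegral
            ((measurable_coeFn_Lp (S f2)).enorm.pow_const r) _).trans (hM f2))
      _ = _ := by ring
  calc _ ≤ (volume {x | m < ‖S f1 x‖ₑ} + volume {x | m ^ r ≤ ‖S f2 x‖ₑ ^ r}) *
        ENNReal.ofReal (t ^ (q - 1)) := by gcongr
    _ ≤ _ := by
        rw [add_mul]
        exact add_le_add h1 h2

/-- Marcinkiewicz interpolation between weak type `(1, 1)` and strong type `(r, r)`. -/
theorem lintegral_rpow_apply_le_of_weak_of_strong {S : L2 E →L[ℂ] L2 E} {W : ℝ≥0∞} (hWt : W ≠ ⊤)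
    (hW : ∀ (f : L2 E) (lam : ℝ≥0∞), lam ≠ 0 → lam ≠ ⊤ →
      lam * volume {x | lam < ‖S f x‖ₑ} ≤ W * ∫⁻ x, ‖f x‖ₑ)
    {r q : ℝ} (hq : 1 < q) (hqr : q < r) {M : ℝ≥0∞} (hMt : M ≠ ⊤)
    (hM : ∀ f : L2 E, ∫⁻ x, ‖S f x‖ₑ ^ r ≤ M * ∫⁻ x, ‖f x‖ₑ ^ r) (f : L2 E) :
    ∫⁻ x, ‖S f x‖ₑ ^ q ≤ ENNReal.ofReal q * (2 * W * ENNReal.ofReal (1 / (q - 1)) +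
      2 ^ r * M * ENNReal.ofReal (1 / (r - q))) * ∫⁻ x, ‖f x‖ₑ ^ q := by
  have hq0 : 0 < q := by linarith
  have hr0 : 0 < r := by linarith
  have hfm := measurable_coeFn_Lp f
  have hconv : ∀ g : L2 E, ∀ x, ‖g x‖ₑ ^ q = ENNReal.ofReal (‖g x‖ ^ q) := by
    intro g x
    rw [← ofReal_norm, ENNReal.ofReal_rpow_of_nonneg (norm_nonneg _) hq0.le]
  -- The weak type estimate is applied to the part of `f` above the height `t` of the layer, the
  -- strong one to the part below it; `u1` and `u2` are the resulting integrands.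
  set u1 : ℝ × E → ℝ≥0∞ := {z : ℝ × E | z.1 < ‖f z.2‖}.indicator
    (fun z ↦ ENNReal.ofReal (z.1 ^ (q - 2)) * ‖f z.2‖ₑ) with hu1
  set u2 : ℝ × E → ℝ≥0∞ := {z : ℝ × E | ‖f z.2‖ ≤ z.1}.indicator
    (fun z ↦ ENNReal.ofReal (z.1 ^ (q - 1 - r)) * ‖f z.2‖ₑ ^ r) with hu2
  have hf2 : Measurable (fun z : ℝ × E ↦ f z.2) := hfm.comp measurable_snd
  have hmu1 : Measurable u1 := by
    refine Measurable.indicator ?_ (measurableSet_lt measurable_fst hf2.norm)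
    have : Measurable fun z : ℝ × E ↦ ENNReal.ofReal (z.1 ^ (q - 2)) := by fun_prop
    exact this.mul hf2.enorm
  have hmu2 : Measurable u2 := by
    refine Measurable.indicator ?_ (measurableSet_le hf2.norm measurable_fst)
    have : Measurable fun z : ℝ × E ↦ ENNReal.ofReal (z.1 ^ (q - 1 - r)) := by fun_prop
    exact this.mul (hf2.enorm.pow_const r)
  have hi1 : ∫⁻ t in Set.Ioi (0 : ℝ), ∫⁻ x, u1 (t, x) ≤
      ENNReal.ofReal (1 / (q - 1)) * ∫⁻ x, ‖f x‖ₑ ^ q := by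
    rw [lintegral_lintegral_swap (by exact hmu1.aemeasurable),
      ← lintegral_const_mul' _ _ (by finiteness)]
    refine lintegral_mono fun x ↦ ?_
    calc ∫⁻ t in Set.Ioi (0 : ℝ), u1 (t, x)
        = ∫⁻ t in Set.Ioi (0 : ℝ), ‖f x‖ₑ *
          {t | t < ‖f x‖}.indicator (fun t ↦ ENNReal.ofReal (t ^ (q - 2))) t := by
          refine lintegral_congr fun t ↦ ?_
          by_cases h : t < ‖f x‖ <;> simp [hu1, Set.indicator, h, mul_comm]
      _ = ‖f x‖ₑ * ∫⁻ t in Set.Ioi (0 : ℝ),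
          {t | t < ‖f x‖}.indicator (fun t ↦ ENNReal.ofReal (t ^ (q - 2))) t :=
          lintegral_const_mul' _ _ (by finiteness)
      _ ≤ ‖f x‖ₑ * (ENNReal.ofReal (1 / (q - 1)) * ENNReal.ofReal (‖f x‖ ^ (q - 1))) := by
          gcongr
          exact lintegral_Ioi_indicator_lt hq (norm_nonneg _)
      _ = ENNReal.ofReal (1 / (q - 1)) * ‖f x‖ₑ ^ q := by
          rw [mul_left_comm, hconv, ← ofReal_norm, ← ENNReal.ofReal_mul (norm_nonneg _)]
          congr 2
          rcases (norm_nonneg (f x)).eq_or_lt with h | h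
          · rw [← h, Real.zero_rpow hq0.ne', zero_mul]
          · rw [mul_comm, ← Real.rpow_add_one h.ne', sub_add_cancel]
  have hi2 : ∫⁻ t in Set.Ioi (0 : ℝ), ∫⁻ x, u2 (t, x) ≤
      ENNReal.ofReal (1 / (r - q)) * ∫⁻ x, ‖f x‖ₑ ^ q := by
    rw [lintegral_lintegral_swap (by exact hmu2.aemeasurable),
      ← lintegral_const_mul' _ _ (by finiteness)]
    refine lintegral_mono fun x ↦ ?_
    calc ∫⁻ t in Set.Ioi (0 : ℝ), u2 (t, x)
        = ∫⁻ t in Set.Ioi (0 : ℝ), ‖f x‖ₑ ^ r *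
          {t | ‖f x‖ ≤ t}.indicator (fun t ↦ ENNReal.ofReal (t ^ (q - 1 - r))) t := by
          refine lintegral_congr fun t ↦ ?_
          by_cases h : ‖f x‖ ≤ t <;> simp [hu2, Set.indicator, h, mul_comm]
      _ = ‖f x‖ₑ ^ r * ∫⁻ t in Set.Ioi (0 : ℝ),
          {t | ‖f x‖ ≤ t}.indicator (fun t ↦ ENNReal.ofReal (t ^ (q - 1 - r))) t :=
          lintegral_const_mul' _ _ (by finiteness)
      _ ≤ ENNReal.ofReal (1 / (r - q)) * ‖f x‖ₑ ^ q := by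
          rcases (norm_nonneg (f x)).eq_or_lt with h | h
          · have h0 : f x = 0 := norm_eq_zero.1 h.symm
            rw [h0, enorm_zero, ENNReal.zero_rpow_of_pos hr0, zero_mul]
            exact zero_le
          · calc _ ≤ ‖f x‖ₑ ^ r * (ENNReal.ofReal (1 / (r - q)) *
                  ENNReal.ofReal (‖f x‖ ^ (q - r))) := by
                  gcongr
                  exact lintegral_Ioi_indicator_ge hqr h
              _ = _ := by
                  rw [mul_left_comm, hconv, ← ofReal_norm,
                    ENNReal.ofReal_rpow_of_pos h, ← ENNReal.ofReal_mul (by positivity),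
                    ← Real.rpow_add h]
                  congr 3
                  ring
  calc ∫⁻ x, ‖S f x‖ₑ ^ q = ENNReal.ofReal q * ∫⁻ t in Set.Ioi (0 : ℝ),
        volume {x | t < ‖S f x‖} * ENNReal.ofReal (t ^ (q - 1)) := by
        simp_rw [hconv]
        exact lintegral_rpow_eq_lintegral_meas_lt_mul _
          (Eventually.of_forall fun x ↦ norm_nonneg _)
          (measurable_coeFn_Lp (S f)).norm.aemeasurable hq0
    _ ≤ ENNReal.ofReal q * ∫⁻ t in Set.Ioi (0 : ℝ),
        (2 * W * (∫⁻ x, u1 (t, x)) + 2 ^ r * M * ∫⁻ x, u2 (t, x)) := by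
        refine mul_le_mul' le_rfl (setLIntegral_mono' measurableSet_Ioi fun t ht ↦ ?_)
        exact volume_lt_le_of_weak_of_strong hW hr0 hM f (t := t) ht
    _ = ENNReal.ofReal q * (2 * W * (∫⁻ t in Set.Ioi (0 : ℝ), ∫⁻ x, u1 (t, x)) +
        2 ^ r * M * ∫⁻ t in Set.Ioi (0 : ℝ), ∫⁻ x, u2 (t, x)) := by
        rw [lintegral_add_left (hmu1.lintegral_prod_right'.const_mul _),
          lintegral_const_mul' _ _ (by finiteness), lintegral_const_mul' _ _ (by finiteness)]
    _ ≤ ENNReal.ofReal q * (2 * W * (ENNReal.ofReal (1 / (q - 1)) * ∫⁻ x, ‖f x‖ₑ ^ q) +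
        2 ^ r * M * (ENNReal.ofReal (1 / (r - q)) * ∫⁻ x, ‖f x‖ₑ ^ q)) := by gcongr
    _ = _ := by ring

/-! ### Duality and uniform `L^p` bounds -/

lemma enorm_integral_mul_le {p q : ℝ} (hpq : p.HolderConjugate q) (f g : L2 E) :
    ‖∫ x, f x * g x‖ₑ ≤ eLpNorm' f p volume * eLpNorm' g q volume := by
  refine (enorm_integral_le_lintegral_enorm _).trans ?_
  simp_rw [enorm_mul]
  exact ENNReal.lintegral_mul_le_Lp_mul_Lq volume hpq (measurable_coeFn_Lp f).enorm.aemeasurable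
    (measurable_coeFn_Lp g).enorm.aemeasurable

/-- The `L^p` norm as a supremum over test functions in `L²`. -/
lemma eLpNorm'_le_of_enorm_integral_mul_le {p q : ℝ} (hpq : p.HolderConjugate q) (F : L2 E)
    {M : ℝ≥0∞} (h : ∀ φ : L2 E, ‖∫ x, F x * φ x‖ₑ ≤ M * eLpNorm' φ q volume) :
    eLpNorm' F p volume ≤ M := by
  have hFm := measurable_coeFn_Lp F
  have hp0 := hpq.pos
  have hp1 := hpq.lt
  have hq0 := hpq.symm.pos
  -- Finiteness of the norm is not known beforehand, so the extremal test function
  -- `|F|^{p-2} conj F` is cut off to bounded sets on which `F` is bounded.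
  set A : ℕ → Set E := fun k ↦ {x | ‖F x‖ ≤ k} ∩ Metric.closedBall 0 k with hA
  have hAm : ∀ k, MeasurableSet (A k) := fun k ↦
    (measurableSet_le hFm.norm measurable_const).inter measurableSet_closedBall
  have hAmono : Monotone A := by
    intro i j hij x hx
    have : (i : ℝ) ≤ j := by exact_mod_cast hij
    exact ⟨le_trans hx.1 this, Metric.closedBall_subset_closedBall this hx.2⟩
  have hAU : ⋃ k, A k = Set.univ := by
    refine Set.eq_univ_of_forall fun x ↦ Set.mem_iUnion.2 ?_
    obtain ⟨k, hk⟩ := exists_nat_ge (max ‖F x‖ ‖x‖)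
    exact ⟨k, (le_max_left _ _).trans hk, by simpa using (le_max_right _ _).trans hk⟩
  have key : ∀ k, ∫⁻ x in A k, ‖F x‖ₑ ^ p ≤ M ^ p := by
    intro k
    set I := ∫⁻ x in A k, ‖F x‖ₑ ^ p with hI
    set φ : E → ℂ := (A k).indicator fun x ↦ ((‖F x‖ ^ (p - 2) : ℝ) : ℂ) * star (F x) with hφ
    have hφn : ∀ x ∈ A k, ‖φ x‖ = ‖F x‖ ^ (p - 1) := by
      intro x hx
      rw [hφ, Set.indicator_of_mem hx, norm_mul, norm_star, Complex.norm_real,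
        Real.norm_of_nonneg (by positivity)]
      rcases (norm_nonneg (F x)).eq_or_lt with h0 | h0
      · rw [← h0, mul_zero, Real.zero_rpow (by linarith)]
      · rw [← Real.rpow_add_one h0.ne']
        congr 1
        ring
    have hφm : Measurable φ := by
      refine Measurable.indicator ?_ (hAm k)
      have : Measurable fun x ↦ ((‖F x‖ ^ (p - 2) : ℝ) : ℂ) :=
        Complex.measurable_ofReal.comp (hFm.norm.pow_const _)
      exact this.mul (continuous_star.measurable.comp hFm)
    have hkt : volume (A k) < ⊤ :=
      (measure_mono Set.inter_subset_right).trans_lt measure_closedBall_lt_top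
    have hφL : MemLp φ 2 := by
      rw [memLp_two_iff hφm]
      calc ∫⁻ x, ‖φ x‖ₑ ^ 2 ≤ ∫⁻ x, (A k).indicator
            (fun _ ↦ ENNReal.ofReal ((k : ℝ) ^ (p - 1)) ^ 2) x := by
            refine lintegral_mono fun x ↦ ?_
            by_cases hx : x ∈ A k
            · rw [Set.indicator_of_mem hx, ← ofReal_norm, hφn x hx]
              exact ENNReal.pow_le_pow_left (ENNReal.ofReal_le_ofReal
                (Real.rpow_le_rpow (norm_nonneg _) hx.1 (by linarith)))
            · rw [hφ, Set.indicator_of_notMem hx, Set.indicator_of_notMem hx]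
              simp
        _ < ⊤ := by
            rw [lintegral_indicator_const (hAm k)]
            finiteness
    have hconv : ∀ x, ‖F x‖ₑ ^ p = ENNReal.ofReal (‖F x‖ ^ p) := by
      intro x
      rw [← ofReal_norm, ENNReal.ofReal_rpow_of_nonneg (norm_nonneg _) hp0.le]
    have hIt : I ≠ ⊤ := by
      refine ne_top_of_le_ne_top (b := ∫⁻ x in A k, ENNReal.ofReal ((k : ℝ) ^ p)) ?_ ?_
      · rw [setLIntegral_const]
        finiteness
      · refine setLIntegral_mono' (hAm k) fun x hx ↦ ?_
        rw [hconv]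
        gcongr
        exact hx.1
    have h1 : ‖∫ x, F x * hφL.toLp φ x‖ₑ = I := by
      have e : ∫ x, F x * hφL.toLp φ x =
          ∫ x, (((A k).indicator (fun x ↦ ‖F x‖ ^ p) x : ℝ) : ℂ) := by
        apply integral_congr_ae
        filter_upwards [hφL.coeFn_toLp] with x hx
        rw [hx, hφ]
        by_cases hxA : x ∈ A k
        · rw [Set.indicator_of_mem hxA, Set.indicator_of_mem hxA]
          rcases (norm_nonneg (F x)).eq_or_lt with h0 | h0
          · rw [← h0, norm_eq_zero.1 h0.symm, zero_mul, Real.zero_rpow hp0.ne']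
            simp
          · rw [mul_left_comm, Complex.star_def, Complex.mul_conj, Complex.normSq_eq_norm_sq,
              ← Complex.ofReal_mul]
            congr 1
            rw [← Real.rpow_natCast, ← Real.rpow_add h0]
            congr 1
            push_cast
            ring
        · rw [Set.indicator_of_notMem hxA, Set.indicator_of_notMem hxA]
          simp
      have e2 : ∫⁻ x, ENNReal.ofReal ((A k).indicator (fun x ↦ ‖F x‖ ^ p) x) = I := by
        rw [hI, ← lintegral_indicator (hAm k)]
        refine lintegral_congr fun x ↦ ?_
        by_cases hxA : x ∈ A k
        · rw [Set.indicator_of_mem hxA, Set.indicator_of_mem hxA, hconv]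
        · rw [Set.indicator_of_notMem hxA, Set.indicator_of_notMem hxA, ENNReal.ofReal_zero]
      have hnn : ∀ x, 0 ≤ (A k).indicator (fun x ↦ ‖F x‖ ^ p) x :=
        fun x ↦ Set.indicator_nonneg (fun x _ ↦ by positivity) x
      have hi : Integrable ((A k).indicator (fun x ↦ ‖F x‖ ^ p)) := by
        refine ⟨((hFm.norm.pow_const p).indicator (hAm k)).aestronglyMeasurable, ?_⟩
        rw [hasFiniteIntegral_iff_ofReal (Eventually.of_forall hnn), e2]
        exact hIt.lt_top
      rw [e, integral_complex_ofReal, ← ofReal_norm, Complex.norm_real,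
        Real.norm_of_nonneg (integral_nonneg hnn),
        ofReal_integral_eq_lintegral_ofReal hi (Eventually.of_forall hnn), e2]
    have h2 : eLpNorm' (hφL.toLp φ) q volume = I ^ (1 / q) := by
      rw [eLpNorm', hI, ← lintegral_indicator (hAm k)]
      congr 1
      apply lintegral_congr_ae
      filter_upwards [hφL.coeFn_toLp] with x hx
      rw [hx]
      by_cases hxA : x ∈ A k
      · rw [Set.indicator_of_mem hxA, ← ofReal_norm, hφn x hxA, hconv,
          ENNReal.ofReal_rpow_of_nonneg (by positivity) hq0.le,
          ← Real.rpow_mul (norm_nonneg _), hpq.sub_one_mul_conj]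
      · rw [Set.indicator_of_notMem hxA, hφ, Set.indicator_of_notMem hxA, enorm_zero,
          ENNReal.zero_rpow_of_pos hq0]
    have h3 := h (hφL.toLp φ)
    rw [h1, h2] at h3
    rcases eq_or_ne I 0 with hI0 | hI0
    · rw [hI0]
      exact zero_le
    rw [← ENNReal.rpow_inv_le_iff hp0]
    have h4 : I = I ^ p⁻¹ * I ^ (1 / q) := by
      rw [← ENNReal.rpow_add _ _ hI0 hIt, one_div, hpq.inv_add_inv_eq_one, ENNReal.rpow_one]
    have h5 : I ^ (1 / q) ≠ 0 := by
      simp [hI0, hIt]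
    have h6 : I ^ (1 / q) ≠ ⊤ := ENNReal.rpow_ne_top_of_nonneg (by positivity) hIt
    -- `I ≤ M I^{1/q}` with `I` finite and nonzero, and `I = I^{1/p} I^{1/q}`.
    conv_lhs at h3 => rw [h4]
    exact (ENNReal.mul_le_mul_iff_left h5 h6).1 h3
  rw [eLpNorm', one_div, ENNReal.rpow_inv_le_iff hp0, ← setLIntegral_univ, ← hAU,
    setLIntegral_iUnion_of_directed _ hAmono.directed_le]
  exact iSup_le key

/-- An `L^q` bound for the transpose is an `L^p` bound for the operator. -/
lemma eLpNorm'_apply_le_of_transpose {S S' : L2 E →L[ℂ] L2 E}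
    (hT : ∀ v w : L2 E, ∫ x, S v x * w x = ∫ x, v x * S' w x)
    {p q : ℝ} (hpq : p.HolderConjugate q) {M : ℝ≥0∞}
    (h : ∀ f : L2 E, eLpNorm' (S' f) q volume ≤ M * eLpNorm' f q volume) (f : L2 E) :
    eLpNorm' (S f) p volume ≤ M * eLpNorm' f p volume := by
  refine eLpNorm'_le_of_enorm_integral_mul_le hpq _ fun φ ↦ ?_
  rw [hT]
  calc _ ≤ eLpNorm' f p volume * eLpNorm' (S' φ) q volume := enorm_integral_mul_le hpq _ _
    _ ≤ eLpNorm' f p volume * (M * eLpNorm' φ q volume) := by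
        gcongr
        exact h φ
    _ = _ := by ring

lemma eLpNorm'_le_of_lintegral_rpow_le {q : ℝ} (hq : 0 < q) {f g : E → ℂ} {M : ℝ≥0∞}
    (h : ∫⁻ x, ‖g x‖ₑ ^ q ≤ M * ∫⁻ x, ‖f x‖ₑ ^ q) :
    eLpNorm' g q volume ≤ M ^ (1 / q) * eLpNorm' f q volume := by
  rw [eLpNorm', eLpNorm', ← ENNReal.mul_rpow_of_nonneg _ _ (by positivity)]
  gcongr

lemma lintegral_rpow_le_of_eLpNorm'_le {q : ℝ} (hq : 0 < q) {f g : E → ℂ} {M : ℝ≥0∞}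
    (h : eLpNorm' g q volume ≤ M * eLpNorm' f q volume) :
    ∫⁻ x, ‖g x‖ₑ ^ q ≤ M ^ q * ∫⁻ x, ‖f x‖ₑ ^ q := by
  rw [eLpNorm', eLpNorm', one_div, ENNReal.rpow_inv_le_iff hq,
    ENNReal.mul_rpow_of_nonneg _ _ hq.le, ENNReal.rpow_inv_rpow hq.ne'] at h
  exact h

/-- `L^p` bounds, uniform for `2 ≤ p < 1/θ`, for an `L²`-bounded operator of weak type `(1, 1)`
whose transpose has the same properties. Interpolating twice, with `L²` and then with `L⁴` as the
strong endpoint, keeps the constants bounded near `p = 2`. -/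
theorem exists_eLpNorm'_apply_le {θ : ℝ} (hθ : 0 < θ) {A W : ℝ≥0∞} (hAt : A ≠ ⊤) (hWt : W ≠ ⊤) :
    ∃ C : ℝ≥0∞, C ≠ ⊤ ∧ ∀ S S' : L2 E →L[ℂ] L2 E,
      (∀ v w : L2 E, ∫ x, S v x * w x = ∫ x, v x * S' w x) →
      (∀ f, ‖S f‖ₑ ≤ A * ‖f‖ₑ) → (∀ f, ‖S' f‖ₑ ≤ A * ‖f‖ₑ) →
      (∀ (f : L2 E) (lam : ℝ≥0∞), lam ≠ 0 → lam ≠ ⊤ →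
        lam * volume {x | lam < ‖S f x‖ₑ} ≤ W * ∫⁻ x, ‖f x‖ₑ) →
      (∀ (f : L2 E) (lam : ℝ≥0∞), lam ≠ 0 → lam ≠ ⊤ →
        lam * volume {x | lam < ‖S' f x‖ₑ} ≤ W * ∫⁻ x, ‖f x‖ₑ) →
      ∀ p ∈ Set.Ico 2 (1 / θ), ∀ f : L2 E,
        eLpNorm' (S f) p volume ≤ C * eLpNorm' f p volume := by
  set N₁ : ℝ≥0∞ := ENNReal.ofReal (4 / 3) * (2 * W * ENNReal.ofReal (1 / (4 / 3 - 1)) +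
      2 ^ (2 : ℝ) * A ^ 2 * ENNReal.ofReal (1 / (2 - 4 / 3))) with hN₁
  have hN₁t : N₁ ≠ ⊤ := by finiteness
  set M : ℝ≥0∞ := N₁ ^ (1 / (4 / 3) : ℝ) with hM
  have hMt : M ≠ ⊤ := ENNReal.rpow_ne_top_of_nonneg (by norm_num) hN₁t
  set N₂ : ℝ≥0∞ := ENNReal.ofReal 2 * (2 * W * ENNReal.ofReal (1 / θ) +
      2 ^ (4 : ℝ) * M ^ (4 : ℝ) * ENNReal.ofReal 1) with hN₂
  have hM4t : M ^ (4 : ℝ) ≠ ⊤ := ENNReal.rpow_ne_top_of_nonneg (by norm_num) hMt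
  have hN₂t : N₂ ≠ ⊤ := by finiteness
  refine ⟨1 + N₂, by finiteness, fun S S' hT hS hS' hW hW' p hp ↦ ?_⟩
  have hT' : ∀ v w : L2 E, ∫ x, S' v x * w x = ∫ x, v x * S w x := by
    intro v w
    have := hT w v
    simp_rw [mul_comm (S' v _), mul_comm (v _), this]
  have step : ∀ S : L2 E →L[ℂ] L2 E, (∀ f, ‖S f‖ₑ ≤ A * ‖f‖ₑ) →
      (∀ (f : L2 E) (lam : ℝ≥0∞), lam ≠ 0 → lam ≠ ⊤ →
        lam * volume {x | lam < ‖S f x‖ₑ} ≤ W * ∫⁻ x, ‖f x‖ₑ) →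
      ∀ f, eLpNorm' (S f) (4 / 3) volume ≤ M * eLpNorm' f (4 / 3) volume := by
    intro S hS hW f
    apply eLpNorm'_le_of_lintegral_rpow_le (by norm_num)
    refine lintegral_rpow_apply_le_of_weak_of_strong hWt hW (by norm_num) (by norm_num)
      (M := A ^ 2) (by finiteness) (fun f ↦ ?_) f
    simpa using lintegral_enorm_sq_apply_le hS f
  have h43 : (4 : ℝ).HolderConjugate (4 / 3) := by
    rw [Real.holderConjugate_iff]
    norm_num
  have h4 : ∀ f, eLpNorm' (S' f) 4 volume ≤ M * eLpNorm' f 4 volume :=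
    eLpNorm'_apply_le_of_transpose hT' h43 (step S hS hW)
  have hp1 : 1 < p := by linarith [hp.1]
  have hpq : p.HolderConjugate (p / (p - 1)) := by
    simpa [Real.conjExponent] using Real.HolderConjugate.conjExponent hp1
  -- The dual exponent `q` lies in `(1, 2]`, away from `1` as `1 / (q - 1) = p - 1 < 1 / θ`, and away
  -- from the strong endpoint `4`.
  refine eLpNorm'_apply_le_of_transpose hT hpq fun f ↦ ?_
  set q := p / (p - 1) with hq
  have hq1 : q - 1 = 1 / (p - 1) := by
    rw [hq]
    have : p - 1 ≠ 0 := by linarith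
    field_simp
    ring
  have hq2 : q ≤ 2 := by
    have : 1 / (p - 1) ≤ 1 := by
      rw [div_le_one (by linarith)]
      linarith [hp.1]
    linarith
  have hq3 : 1 < q := hpq.symm.lt
  have hN := lintegral_rpow_apply_le_of_weak_of_strong hWt hW' hq3 (r := 4) (by linarith)
    (M := M ^ (4 : ℝ)) hM4t (fun f ↦ lintegral_rpow_le_of_eLpNorm'_le (by norm_num) (h4 f)) f
  have hNle : ENNReal.ofReal q * (2 * W * ENNReal.ofReal (1 / (q - 1)) +
      2 ^ (4 : ℝ) * M ^ (4 : ℝ) * ENNReal.ofReal (1 / (4 - q))) ≤ N₂ := by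
    rw [hN₂]
    gcongr
    · have := (lt_div_iff₀ hθ).1 hp.2
      rw [hq1, le_div_iff₀ (by linarith)]
      linarith
    · rw [div_le_one (by linarith)]
      linarith
  refine (eLpNorm'_le_of_lintegral_rpow_le (f := f) (M := N₂) (by linarith) (hN.trans ?_)).trans ?_
  · gcongr
  · gcongr
    rcases le_total N₂ 1 with h | h
    · exact (ENNReal.rpow_le_one h (by positivity)).trans le_self_add
    · refine le_trans ?_ le_add_self
      calc N₂ ^ (1 / q) ≤ N₂ ^ (1 : ℝ) := by
            apply ENNReal.rpow_le_rpow_of_exponent_le h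
            rw [div_le_one (by linarith)]
            exact hq3.le
        _ = N₂ := ENNReal.rpow_one _

/-! ### Kernel estimates on slices -/

/-- Schur-type bound for a kernel `G` applied to a density `β`: only the masses of the slices
`G(·, y)` with `β y ≠ 0` matter. -/
lemma setLIntegral_lintegral_mul_le {G : E → E → ℝ≥0∞} (hG : Measurable (fun z : E × E ↦ G z.1 z.2))
    {β : E → ℝ≥0∞} (hβ : Measurable β) {B : ℝ≥0∞} (hB : B ≠ ⊤) (s : Set E)
    (h : ∀ᵐ y, β y ≠ 0 → ∫⁻ x in s, G x y ≤ B) :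
    ∫⁻ x in s, ∫⁻ y, G x y * β y ≤ B * ∫⁻ y, β y := by
  have hm : Measurable (fun z : E × E ↦ G z.1 z.2 * β z.2) := hG.mul (hβ.comp measurable_snd)
  rw [lintegral_lintegral_swap hm.aemeasurable, ← lintegral_const_mul' _ _ hB]
  apply lintegral_mono_ae
  filter_upwards [h] with y hy
  have hGy : Measurable (fun x ↦ G x y) :=
    hG.comp (f := fun x : E ↦ (x, y)) measurable_prodMk_right
  rw [lintegral_mul_const _ hGy]
  rcases eq_or_ne (β y) 0 with h0 | h0
  · simp [h0]
  · gcongr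
    exact hy h0

/-- The `L¹` norm of a square-integrable function on a set, by duality. -/
lemma setLIntegral_enorm_le_of_forall (F : L2 E) {D : Set E} (hD : MeasurableSet D) {M : ℝ≥0∞}
    (h : ∀ φ : L2 E, (∀ᵐ x, ‖φ x‖ₑ ≤ 1) → (∀ᵐ x, x ∉ D → φ x = 0) → ‖∫ x, F x * φ x‖ₑ ≤ M) :
    ∫⁻ x in D, ‖F x‖ₑ ≤ M := by
  have hFm := measurable_coeFn_Lp F
  set A : ℕ → Set E := fun k ↦ D ∩ Metric.closedBall 0 k with hA
  have hAm : ∀ k, MeasurableSet (A k) := fun k ↦ hD.inter measurableSet_closedBall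
  have hAmono : Monotone A := by
    intro i j hij x hx
    have : (i : ℝ) ≤ j := by exact_mod_cast hij
    exact ⟨hx.1, Metric.closedBall_subset_closedBall this hx.2⟩
  have hAU : ⋃ k, A k = D := by
    refine Set.Subset.antisymm (Set.iUnion_subset fun k ↦ Set.inter_subset_left) fun x hx ↦ ?_
    obtain ⟨k, hk⟩ := exists_nat_ge ‖x‖
    exact Set.mem_iUnion.2 ⟨k, hx, by simpa using hk⟩
  rw [← hAU, setLIntegral_iUnion_of_directed _ hAmono.directed_le]
  refine iSup_le fun k ↦ ?_
  -- The test function is the conjugate of the sign of `F`; it vanishes where `F` does, as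
  -- `0⁻¹ = 0`.
  set φ : E → ℂ := (A k).indicator fun x ↦ ((‖F x‖⁻¹ : ℝ) : ℂ) * star (F x) with hφ
  have hφm : Measurable φ := by
    refine Measurable.indicator ?_ (hAm k)
    have : Measurable fun x ↦ ((‖F x‖⁻¹ : ℝ) : ℂ) :=
      Complex.measurable_ofReal.comp hFm.norm.inv
    exact this.mul (continuous_star.measurable.comp hFm)
  have hkt : volume (A k) < ⊤ :=
    (measure_mono Set.inter_subset_right).trans_lt measure_closedBall_lt_top
  have hφ1 : ∀ x, ‖φ x‖ₑ ≤ (A k).indicator (fun _ ↦ 1) x := by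
    intro x
    by_cases hx : x ∈ A k
    · rw [hφ, Set.indicator_of_mem hx, Set.indicator_of_mem hx, ← ofReal_norm, norm_mul, norm_star,
        Complex.norm_real, Real.norm_of_nonneg (by positivity)]
      exact ENNReal.ofReal_le_one.2 (inv_mul_le_one)
    · rw [hφ, Set.indicator_of_notMem hx, Set.indicator_of_notMem hx, enorm_zero]
  have hφL : MemLp φ 2 := by
    rw [memLp_two_iff hφm]
    calc ∫⁻ x, ‖φ x‖ₑ ^ 2 ≤ ∫⁻ x, (A k).indicator (fun _ ↦ 1) x := by
          refine lintegral_mono fun x ↦ ?_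
          refine (ENNReal.pow_le_pow_left (hφ1 x)).trans (le_of_eq ?_)
          by_cases hx : x ∈ A k
          · rw [Set.indicator_of_mem hx, one_pow]
          · rw [Set.indicator_of_notMem hx, zero_pow two_ne_zero]
      _ < ⊤ := by
          rw [lintegral_indicator_const (hAm k)]
          finiteness
  refine le_trans (le_of_eq ?_) (h (hφL.toLp φ) ?_ ?_)
  · have e : ∫ x, F x * hφL.toLp φ x = ∫ x, (((A k).indicator (fun x ↦ ‖F x‖) x : ℝ) : ℂ) := by
      apply integral_congr_ae
      filter_upwards [hφL.coeFn_toLp] with x hx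
      rw [hx, hφ]
      by_cases hxA : x ∈ A k
      · rw [Set.indicator_of_mem hxA, Set.indicator_of_mem hxA]
        rcases (norm_nonneg (F x)).eq_or_lt with h0 | h0
        · rw [← h0, norm_eq_zero.1 h0.symm, zero_mul]
          simp
        · rw [mul_left_comm, Complex.star_def, Complex.mul_conj, Complex.normSq_eq_norm_sq,
            ← Complex.ofReal_mul]
          congr 1
          field_simp
      · rw [Set.indicator_of_notMem hxA, Set.indicator_of_notMem hxA]
        simp
    have hnn : ∀ x, 0 ≤ (A k).indicator (fun x ↦ ‖F x‖) x :=
      fun x ↦ Set.indicator_nonneg (fun x _ ↦ norm_nonneg _) x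
    have hF1 : IntegrableOn F (A k) := by
      have : IsFiniteMeasure (volume.restrict (A k)) := ⟨by simpa using hkt⟩
      exact ((Lp.memLp F).restrict (A k)).integrable (by norm_num)
    have hi : Integrable ((A k).indicator (fun x ↦ ‖F x‖)) :=
      (integrable_indicator_iff (hAm k)).2 hF1.norm
    rw [e, integral_complex_ofReal, ← ofReal_norm, Complex.norm_real,
      Real.norm_of_nonneg (integral_nonneg hnn),
      ofReal_integral_eq_lintegral_ofReal hi (Eventually.of_forall hnn),
      ← lintegral_indicator (hAm k)]
    refine lintegral_congr fun x ↦ ?_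
    by_cases hxA : x ∈ A k
    · rw [Set.indicator_of_mem hxA, Set.indicator_of_mem hxA, ofReal_norm]
    · rw [Set.indicator_of_notMem hxA, Set.indicator_of_notMem hxA, ENNReal.ofReal_zero]
  · filter_upwards [hφL.coeFn_toLp] with x hx
    rw [hx]
    exact (hφ1 x).trans (Set.indicator_le' (fun _ _ ↦ le_rfl) (fun _ _ ↦ zero_le) x)
  · filter_upwards [hφL.coeFn_toLp] with x hx hxD
    rw [hx, hφ, Set.indicator_of_notMem fun h ↦ hxD h.1]

lemma enorm_potIncr_le (σ : ℝ) (w : E → ℂ) (h x : E) :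
    ‖potIncr σ w h x‖ₑ ≤ ∫⁻ y, ‖rieszIncr σ h (x - y)‖ₑ * ‖w y‖ₑ := by
  refine (enorm_integral_le_lintegral_enorm _).trans (le_of_eq ?_)
  refine lintegral_congr fun y ↦ ?_
  rw [enorm_mul]
  congr 1
  rw [← ofReal_norm, Complex.norm_real, ofReal_norm]

lemma enorm_potIncr_le_of_le_one (σ : ℝ) {g : E → ℂ} (hg : ∀ᵐ y, ‖g y‖ₑ ≤ 1) (h x : E) :
    ‖potIncr σ g h x‖ₑ ≤ ∫⁻ y, ‖rieszIncr σ h y‖ₑ := by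
  refine (enorm_potIncr_le σ g h x).trans ?_
  rw [← lintegral_sub_left_eq_self (fun y ↦ ‖rieszIncr σ h y‖ₑ) x]
  apply lintegral_mono_ae
  filter_upwards [hg] with y hy
  exact mul_le_of_le_one_right' hy

/-- On the doubled ball, the potential of a function supported off the tripled ball only sees the
tail of the kernel. -/
lemma enorm_potIncr_le_of_far (σ : ℝ) {g : E → ℂ} (hg : ∀ᵐ y, ‖g y‖ₑ ≤ 1) {c : E} {R : ℝ}
    (hs : ∀ᵐ y, y ∈ Metric.closedBall c (3 * R) → g y = 0) (h : E) {x : E}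
    (hx : x ∈ Metric.closedBall c (2 * R)) :
    ‖potIncr σ g h x‖ₑ ≤ ∫⁻ y in {y | R ≤ ‖y‖}, ‖rieszIncr σ h y‖ₑ := by
  have hm : MeasurableSet {y : E | R ≤ ‖y‖} := measurableSet_le measurable_const measurable_norm
  refine (enorm_potIncr_le σ g h x).trans ?_
  rw [← lintegral_indicator hm, ← lintegral_sub_left_eq_self
    ({y : E | R ≤ ‖y‖}.indicator fun y ↦ ‖rieszIncr σ h y‖ₑ) x]
  apply lintegral_mono_ae
  filter_upwards [hg, hs] with y hy hy2
  by_cases hR : R ≤ ‖x - y‖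
  · rw [Set.indicator_of_mem (show x - y ∈ {y : E | R ≤ ‖y‖} from hR)]
    exact mul_le_of_le_one_right' hy
  · have : y ∈ Metric.closedBall c (3 * R) := by
      rw [Metric.mem_closedBall] at hx ⊢
      have h1 := dist_triangle y x c
      have h2 : dist y x < R := by
        rw [dist_comm, dist_eq_norm]
        exact not_le.1 hR
      linarith
    rw [hy2 this, enorm_zero, mul_zero]
    exact zero_le

lemma measurable_enorm_rieszIncr_sub (σ : ℝ) (h : E) :
    Measurable (fun z : E × E ↦ ‖rieszIncr σ h (z.1 - z.2)‖ₑ) :=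
  ((measurable_rieszIncr_right σ h).comp (measurable_fst.sub measurable_snd)).enorm

lemma lintegral_enorm_potIncr_le (σ : ℝ) {b : E → ℂ} (hb : Measurable b) (h : E) {B : ℝ≥0∞}
    (hB : B ≠ ⊤) (hk : ∫⁻ x, ‖rieszIncr σ h x‖ₑ ≤ B) :
    ∫⁻ x, ‖potIncr σ b h x‖ₑ ≤ B * ∫⁻ x, ‖b x‖ₑ := by
  refine (lintegral_mono fun x ↦ enorm_potIncr_le σ b h x).trans ?_
  rw [← setLIntegral_univ]
  refine setLIntegral_lintegral_mul_le (measurable_enorm_rieszIncr_sub σ h) hb.enorm hB _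
    (Eventually.of_forall fun y _ ↦ ?_)
  rw [setLIntegral_univ, lintegral_sub_right_eq_self (fun x ↦ ‖rieszIncr σ h x‖ₑ) y]
  exact hk

/-- Off the doubled ball, the potential of a function supported in the ball only sees the tail of
the kernel. -/
lemma lintegral_enorm_potIncr_le_of_far (σ : ℝ) {b : E → ℂ} (hb : Measurable b) {c : E} {R : ℝ}
    (hs : ∀ᵐ y, y ∉ Metric.closedBall c R → b y = 0) (h : E) {B : ℝ≥0∞} (hB : B ≠ ⊤)
    (hk : ∫⁻ x in {x | R ≤ ‖x‖}, ‖rieszIncr σ h x‖ₑ ≤ B) :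
    ∫⁻ x in (Metric.closedBall c (2 * R))ᶜ, ‖potIncr σ b h x‖ₑ ≤ B * ∫⁻ x, ‖b x‖ₑ := by
  refine (lintegral_mono fun x ↦ enorm_potIncr_le σ b h x).trans ?_
  have hm : MeasurableSet {y : E | R ≤ ‖y‖} := measurableSet_le measurable_const measurable_norm
  refine setLIntegral_lintegral_mul_le (measurable_enorm_rieszIncr_sub σ h) hb.enorm hB _ ?_
  filter_upwards [hs] with y hy hy0
  refine le_trans ?_ hk
  have hyB : y ∈ Metric.closedBall c R := by
    by_contra hcon
    exact hy0 (by rw [hy hcon, enorm_zero])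
  rw [← lintegral_indicator hm, ← lintegral_sub_right_eq_self
    ({y : E | R ≤ ‖y‖}.indicator fun y ↦ ‖rieszIncr σ h y‖ₑ) y,
    ← lintegral_indicator measurableSet_closedBall.compl]
  refine lintegral_mono fun x ↦ ?_
  by_cases hx : x ∈ (Metric.closedBall c (2 * R))ᶜ
  · have : R ≤ ‖x - y‖ := by
      rw [Set.mem_compl_iff, Metric.mem_closedBall, not_le] at hx
      rw [Metric.mem_closedBall] at hyB
      have := dist_triangle x y c
      rw [← dist_eq_norm]
      linarith
    rw [Set.indicator_of_mem hx, Set.indicator_of_mem (show x - y ∈ {y : E | R ≤ ‖y‖} from this)]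
  · rw [Set.indicator_of_notMem hx]
    exact zero_le

/-- Cancellation: for mean-zero `b` supported in a ball of radius `R`, the increments of the
potential of `b` are controlled by the `L¹` modulus of continuity of the kernel at scale `R`. -/
lemma lintegral_enorm_potIncr_le_of_integral_eq_zero {σ : ℝ} (h0 : 0 < σ) (h1 : σ < 1) {b : E → ℂ}
    (hb : Measurable b) (hbi : Integrable b) (hb0 : ∫ y, b y = 0) {c : E} {R : ℝ}
    (hs : ∀ᵐ y, y ∉ Metric.closedBall c R → b y = 0) (h : E) {B : ℝ≥0∞} (hB : B ≠ ⊤)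
    (hk : ∀ z : E, ‖z‖ ≤ R → ∫⁻ x, ‖rieszIncr σ h (x + z) - rieszIncr σ h x‖ₑ ≤ B) :
    ∫⁻ x, ‖potIncr σ b h x‖ₑ ≤ B * ∫⁻ x, ‖b x‖ₑ := by
  have hkm := measurable_rieszIncr_right σ h
  have hint : ∀ᵐ x : E, Integrable (fun y ↦ (rieszIncr σ h (x - y) : ℂ) * b y) :=
    ae_integrable_conv (k := fun y ↦ (rieszIncr σ h y : ℂ)) (w := b) (p := 1)
      (measurable_ofReal_rieszIncr σ h) hb le_rfl
      (integrable_rieszIncr h0 h1 h) (by simpa using memLp_one_iff_integrable.2 hbi)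
  -- As `b` has mean zero, the value of the kernel at the center may be subtracted.
  have hle : ∀ᵐ x : E, ‖potIncr σ b h x‖ₑ ≤
      ∫⁻ y, ‖rieszIncr σ h (x - y) - rieszIncr σ h (x - c)‖ₑ * ‖b y‖ₑ := by
    filter_upwards [hint] with x hx
    have e : potIncr σ b h x =
        ∫ y, ((rieszIncr σ h (x - y) - rieszIncr σ h (x - c) : ℝ) : ℂ) * b y := by
      have e1 := integral_sub hx (hbi.const_mul (rieszIncr σ h (x - c) : ℂ))
      rw [integral_const_mul, hb0, mul_zero, sub_zero] at e1
      refine e1.symm.trans ?_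
      congr 1 with y
      push_cast
      ring
    rw [e]
    refine (enorm_integral_le_lintegral_enorm _).trans (le_of_eq ?_)
    refine lintegral_congr fun y ↦ ?_
    rw [enorm_mul]
    congr 1
    rw [← ofReal_norm, Complex.norm_real, ofReal_norm]
  refine (lintegral_mono_ae hle).trans ?_
  rw [← setLIntegral_univ]
  refine setLIntegral_lintegral_mul_le
    (G := fun x y ↦ ‖rieszIncr σ h (x - y) - rieszIncr σ h (x - c)‖ₑ) ?_ hb.enorm hB _ ?_
  · exact ((hkm.comp (measurable_fst.sub measurable_snd)).sub
      (hkm.comp (measurable_fst.sub measurable_const))).enorm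
  · filter_upwards [hs] with y hy hy0
    have hyB : y ∈ Metric.closedBall c R := by
      by_contra hcon
      exact hy0 (by rw [hy hcon, enorm_zero])
    rw [setLIntegral_univ]
    refine le_trans (le_of_eq ?_) (hk (c - y) ?_)
    · rw [← lintegral_sub_right_eq_self
        (fun x ↦ ‖rieszIncr σ h (x + (c - y)) - rieszIncr σ h x‖ₑ) c]
      simp
    · rwa [Metric.mem_closedBall, dist_comm, dist_eq_norm] at hyB

/-! ### Cancellation and `L^p` bounds for the form -/

/-- The weight for small increments: size of one factor times tail of the other is integrable at the
origin in `d` dimensions. -/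
lemma rpow_weight_near_le {θ σ₁ σ₂ t R : ℝ} (d : ℝ) (h₂ : σ₂ < 1 - θ) (ht : 0 < t) (htR : t ≤ R) :
    t ^ (-d - σ₁ - σ₂) * (t * R ^ (σ₂ - 1) * t ^ σ₁) ≤ R ^ (-θ) * t ^ (θ - d) := by
  have hR : 0 < R := ht.trans_le htR
  calc _ = t ^ (θ - d) * R ^ (σ₂ - 1) * t ^ (1 - σ₂ - θ) := by
        have : t ^ (-d - σ₁ - σ₂) * t * t ^ σ₁ = t ^ (θ - d) * t ^ (1 - σ₂ - θ) := by
          rw [← Real.rpow_add_one ht.ne', ← Real.rpow_add ht, ← Real.rpow_add ht]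
          congr 1
          ring
        linear_combination R ^ (σ₂ - 1) * this
    _ ≤ t ^ (θ - d) * R ^ (σ₂ - 1) * R ^ (1 - σ₂ - θ) := by
        gcongr
        linarith
    _ = _ := by
        rw [mul_assoc, ← Real.rpow_add hR, mul_comm]
        congr 2
        ring

/-- The weight for large increments: size of one factor times modulus of continuity of the other is
integrable at infinity in `d` dimensions. -/
lemma rpow_weight_far_le {θ σ₁ σ₂ t R : ℝ} (d : ℝ) (h₁ : θ < σ₁) (hR : 0 < R) (htR : R ≤ t) :
    t ^ (-d - σ₁ - σ₂) * (t ^ σ₂ * R ^ σ₁) ≤ R ^ θ * t ^ (-θ - d) := by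
  have ht : 0 < t := hR.trans_le htR
  calc _ = t ^ (-θ - d) * R ^ σ₁ * t ^ (θ - σ₁) := by
        have : t ^ (-d - σ₁ - σ₂) * t ^ σ₂ = t ^ (-θ - d) * t ^ (θ - σ₁) := by
          rw [← Real.rpow_add ht, ← Real.rpow_add ht]
          congr 1
          ring
        linear_combination R ^ σ₁ * this
    _ ≤ t ^ (-θ - d) * R ^ σ₁ * R ^ (θ - σ₁) := by
        gcongr 1
        exact Real.rpow_le_rpow_of_nonpos hR htR (by linarith)
    _ = _ := by
        rw [mul_assoc, ← Real.rpow_add hR, mul_comm]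
        congr 2
        ring

lemma enorm_weight_mul {σ₁ σ₂ : ℝ} {h : E} (hh : h ≠ 0) :
    ‖((‖h‖ ^ (-((Module.finrank ℝ E : ℝ) / 2 + σ₁)) : ℝ) : ℂ)‖ₑ *
      ‖((‖h‖ ^ (-((Module.finrank ℝ E : ℝ) / 2 + σ₂)) : ℝ) : ℂ)‖ₑ =
      ENNReal.ofReal (‖h‖ ^ (-(Module.finrank ℝ E : ℝ) - σ₁ - σ₂)) := by
  have hn := norm_pos_iff.2 hh
  rw [← enorm_mul, ← ofReal_norm, ← Complex.ofReal_mul, Complex.norm_real,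
    Real.norm_of_nonneg (by positivity), ← Real.rpow_add hn]
  congr 2
  ring

/-- The form is controlled by the `L¹` norms on the slices of constant increment. -/
lemma enorm_incrForm_le {κ : E × E → ℝ} (hb : ∀ z, |κ z| ≤ 1) {σ₁ σ₂ : ℝ} {v w : E → ℂ}
    (hv : Measurable v) (hw : Measurable w) :
    ‖incrForm κ σ₁ σ₂ v w‖ₑ ≤
      ∫⁻ h : E, ‖((‖h‖ ^ (-((Module.finrank ℝ E : ℝ) / 2 + σ₁)) : ℝ) : ℂ)‖ₑ *
        ‖((‖h‖ ^ (-((Module.finrank ℝ E : ℝ) / 2 + σ₂)) : ℝ) : ℂ)‖ₑ *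
        ∫⁻ x, ‖potIncr σ₁ v h x‖ₑ * ‖potIncr σ₂ w h x‖ₑ := by
  have hm1 := measurable_liftFun σ₁ hv
  have hm2 := measurable_liftFun σ₂ hw
  calc _ ≤ ∫⁻ z : E × E, ‖(κ z : ℂ) * liftFun σ₁ v z * liftFun σ₂ w z‖ₑ :=
        enorm_integral_le_lintegral_enorm _
    _ ≤ ∫⁻ z : E × E, ‖liftFun σ₁ v z‖ₑ * ‖liftFun σ₂ w z‖ₑ := by
        refine lintegral_mono fun z ↦ ?_
        rw [enorm_mul, enorm_mul]
        refine mul_le_mul' (mul_le_of_le_one_left' ?_) le_rfl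
        rw [← ofReal_norm, Complex.norm_real, Real.norm_eq_abs]
        exact ENNReal.ofReal_le_one.2 (hb z)
    _ = ∫⁻ h : E, ∫⁻ x : E, ‖liftFun σ₁ v (h, x)‖ₑ * ‖liftFun σ₂ w (h, x)‖ₑ := by
        rw [Measure.volume_eq_prod]
        exact lintegral_prod _ (hm1.enorm.mul hm2.enorm).aemeasurable
    _ = _ := by
        refine lintegral_congr fun h ↦ ?_
        rw [← lintegral_const_mul' _ _ (by finiteness)]
        refine lintegral_congr fun x ↦ ?_
        rw [liftFun, liftFun, enorm_mul, enorm_mul]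
        ring

/-- The cancellation estimate in bilinear form: mean-zero `b` supported in a ball, tested against
a bounded function vanishing on the tripled ball. -/
theorem exists_enorm_incrForm_le [Nontrivial E] {θ : ℝ} (hθ : 0 < θ) : ∃ A : ℝ, 0 < A ∧
    ∀ (κ : E × E → ℝ) (_ : ∀ z, |κ z| ≤ 1), ∀ σ₁ ∈ Set.Ioo θ (1 - θ), ∀ σ₂ ∈ Set.Ioo θ (1 - θ),
      ∀ (c : E) (R : ℝ), 0 < R → ∀ b φ : E → ℂ, Measurable b → Measurable φ → Integrable b →
      (∀ᵐ x, x ∉ Metric.closedBall c R → b x = 0) → ∫ x, b x = 0 → (∀ᵐ x, ‖φ x‖ₑ ≤ 1) →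
      (∀ᵐ x, x ∈ Metric.closedBall c (3 * R) → φ x = 0) →
      ‖incrForm κ σ₁ σ₂ b φ‖ₑ ≤ ENNReal.ofReal A * ∫⁻ x, ‖b x‖ₑ := by
  obtain ⟨C, hC, hk⟩ := exists_rieszIncr_bound (E := E) hθ
  obtain ⟨K, hK, hr⟩ := exists_radial_bound (E := E) hθ
  refine ⟨3 * C ^ 2 * K, by positivity, fun κ hκb σ₁ h₁ σ₂ h₂ c R hR b φ hb hφ hbi hbs hb0 hφ1 hφs ↦ ?_⟩
  set d : ℝ := (Module.finrank ℝ E : ℝ) with hd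
  set N := ∫⁻ x, ‖b x‖ₑ with hN
  have hmp1 : ∀ h, Measurable (potIncr σ₁ b h) := fun h ↦
    (measurable_potIncr σ₁ hb).comp (f := fun x : E ↦ (h, x)) measurable_prodMk_left
  set Φ : E → ℝ≥0∞ := fun h ↦ ‖((‖h‖ ^ (-(d / 2 + σ₁)) : ℝ) : ℂ)‖ₑ *
        ‖((‖h‖ ^ (-(d / 2 + σ₂)) : ℝ) : ℂ)‖ₑ *
        ∫⁻ x, ‖potIncr σ₁ b h x‖ₑ * ‖potIncr σ₂ φ h x‖ₑ with hΦ
  have hσ₁0 : 0 < σ₁ := hθ.trans h₁.1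
  have hσ₁1 : σ₁ < 1 := by linarith [h₁.2]
  -- For `‖h‖ ≤ R` no cancellation is needed: on the doubled ball the increment of the potential of
  -- `φ` is small by the tail bound, and off it that of `b`.
  have hnear : ∀ᵐ h : E, h ∈ {h : E | ‖h‖ ≤ R} → Φ h ≤
      ENNReal.ofReal (2 * C ^ 2 * R ^ (-θ)) * N * ENNReal.ofReal (‖h‖ ^ (θ - d)) := by
    have hnt : ∀ᵐ ξ : E, ξ ≠ 0 := by simp [ae_iff]
    filter_upwards [hnt] with h hh hhR
    have hn := norm_pos_iff.2 hh
    obtain ⟨a1, a2, -⟩ := hk σ₁ h₁ h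
    obtain ⟨b1, b2, -⟩ := hk σ₂ h₂ h
    have p1 : ∫⁻ x in Metric.closedBall c (2 * R), ‖potIncr σ₁ b h x‖ₑ * ‖potIncr σ₂ φ h x‖ₑ ≤
        ENNReal.ofReal (C * ‖h‖ ^ σ₁) * N * ENNReal.ofReal (C * (‖h‖ * R ^ (σ₂ - 1))) := by
      calc _ ≤ ∫⁻ x in Metric.closedBall c (2 * R), ‖potIncr σ₁ b h x‖ₑ *
            ENNReal.ofReal (C * (‖h‖ * R ^ (σ₂ - 1))) :=
            setLIntegral_mono' measurableSet_closedBall fun x hx ↦ mul_le_mul' le_rfl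
              ((enorm_potIncr_le_of_far σ₂ hφ1 hφs h hx).trans (b2 R hR))
        _ = (∫⁻ x in Metric.closedBall c (2 * R), ‖potIncr σ₁ b h x‖ₑ) *
            ENNReal.ofReal (C * (‖h‖ * R ^ (σ₂ - 1))) := lintegral_mul_const' _ _ (by finiteness)
        _ ≤ _ := mul_le_mul' ((setLIntegral_le_lintegral _ _).trans
            (lintegral_enorm_potIncr_le σ₁ hb h (by finiteness) a1)) le_rfl
    have p2 : ∫⁻ x in (Metric.closedBall c (2 * R))ᶜ,
        ‖potIncr σ₁ b h x‖ₑ * ‖potIncr σ₂ φ h x‖ₑ ≤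
        ENNReal.ofReal (C * (‖h‖ * R ^ (σ₁ - 1))) * N * ENNReal.ofReal (C * ‖h‖ ^ σ₂) := by
      calc _ ≤ ∫⁻ x in (Metric.closedBall c (2 * R))ᶜ, ‖potIncr σ₁ b h x‖ₑ *
            ENNReal.ofReal (C * ‖h‖ ^ σ₂) :=
            lintegral_mono fun x ↦ mul_le_mul' le_rfl
              ((enorm_potIncr_le_of_le_one σ₂ hφ1 h x).trans b1)
        _ = (∫⁻ x in (Metric.closedBall c (2 * R))ᶜ, ‖potIncr σ₁ b h x‖ₑ) *
            ENNReal.ofReal (C * ‖h‖ ^ σ₂) := lintegral_mul_const' _ _ (by finiteness)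
        _ ≤ _ := mul_le_mul'
            (lintegral_enorm_potIncr_le_of_far σ₁ hb hbs h (by finiteness) (a2 R hR)) le_rfl
    rw [hΦ]
    simp only
    rw [enorm_weight_mul hh, ← hd, ← lintegral_add_compl _ (measurableSet_closedBall (x := c)
      (ε := 2 * R))]
    refine (mul_le_mul' le_rfl (add_le_add p1 p2)).trans ?_
    have q1 := rpow_weight_near_le (σ₁ := σ₁) d h₂.2 hn hhR
    have q2 := rpow_weight_near_le (σ₁ := σ₂) d h₁.2 hn hhR
    rw [show -d - σ₂ - σ₁ = -d - σ₁ - σ₂ by ring] at q2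
    calc _ = ENNReal.ofReal (C ^ 2 * (‖h‖ ^ (-d - σ₁ - σ₂) * (‖h‖ * R ^ (σ₂ - 1) * ‖h‖ ^ σ₁)) +
          C ^ 2 * (‖h‖ ^ (-d - σ₁ - σ₂) * (‖h‖ * R ^ (σ₁ - 1) * ‖h‖ ^ σ₂))) * N := by
          rw [mul_right_comm _ N, mul_right_comm _ N, ← add_mul,
            ← ENNReal.ofReal_mul (by positivity), ← ENNReal.ofReal_mul (by positivity),
            ← ENNReal.ofReal_add (by positivity) (by positivity), ← mul_assoc,
            ← ENNReal.ofReal_mul (by positivity)]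
          ring_nf
      _ ≤ ENNReal.ofReal (C ^ 2 * (R ^ (-θ) * ‖h‖ ^ (θ - d)) +
          C ^ 2 * (R ^ (-θ) * ‖h‖ ^ (θ - d))) * N := by gcongr
      _ = _ := by
          rw [mul_right_comm, ← ENNReal.ofReal_mul (by positivity)]
          ring_nf
  -- For `‖h‖ ≥ R` the mean zero of `b` replaces the total mass `‖h‖^σ₁` of the kernel by its modulus
  -- of continuity `R^σ₁`.
  have hfar : ∀ᵐ h : E, h ∈ {h : E | R ≤ ‖h‖} → Φ h ≤
      ENNReal.ofReal (C ^ 2 * R ^ θ) * N * ENNReal.ofReal (‖h‖ ^ (-θ - d)) := by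
    refine Eventually.of_forall fun h hhR ↦ ?_
    have hn : 0 < ‖h‖ := hR.trans_le hhR
    have hh := norm_pos_iff.1 hn
    obtain ⟨a1, a2, a3⟩ := hk σ₁ h₁ h
    obtain ⟨b1, b2, -⟩ := hk σ₂ h₂ h
    have p : ∫⁻ x, ‖potIncr σ₁ b h x‖ₑ * ‖potIncr σ₂ φ h x‖ₑ ≤
        ENNReal.ofReal (C * R ^ σ₁) * N * ENNReal.ofReal (C * ‖h‖ ^ σ₂) := by
      calc _ ≤ ∫⁻ x, ‖potIncr σ₁ b h x‖ₑ * ENNReal.ofReal (C * ‖h‖ ^ σ₂) :=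
            lintegral_mono fun x ↦ mul_le_mul' le_rfl
              ((enorm_potIncr_le_of_le_one σ₂ hφ1 h x).trans b1)
        _ = (∫⁻ x, ‖potIncr σ₁ b h x‖ₑ) * ENNReal.ofReal (C * ‖h‖ ^ σ₂) :=
            lintegral_mul_const' _ _ (by finiteness)
        _ ≤ _ := by
            refine mul_le_mul' ?_ le_rfl
            refine lintegral_enorm_potIncr_le_of_integral_eq_zero hσ₁0 hσ₁1 hb hbi hb0 hbs h
              (by finiteness) fun z hz ↦ (a3 z).trans ?_
            gcongr
    rw [hΦ]
    simp only
    rw [enorm_weight_mul hh, ← hd]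
    refine (mul_le_mul' le_rfl p).trans ?_
    have q := rpow_weight_far_le (σ₂ := σ₂) d h₁.1 hR hhR
    calc _ = ENNReal.ofReal (C ^ 2 * (‖h‖ ^ (-d - σ₁ - σ₂) * (‖h‖ ^ σ₂ * R ^ σ₁))) * N := by
          rw [mul_right_comm _ N, ← ENNReal.ofReal_mul (by positivity), ← mul_assoc,
            ← ENNReal.ofReal_mul (by positivity)]
          ring_nf
      _ ≤ ENNReal.ofReal (C ^ 2 * (R ^ θ * ‖h‖ ^ (-θ - d))) * N := by gcongr
      _ = _ := by
          rw [mul_right_comm, ← ENNReal.ofReal_mul (by positivity)]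
          ring_nf
  have hms1 : MeasurableSet {h : E | ‖h‖ ≤ R} := measurableSet_le measurable_norm measurable_const
  have hms2 : MeasurableSet {h : E | R ≤ ‖h‖} := measurableSet_le measurable_const measurable_norm
  have hcancel : R ^ θ * R ^ (-θ) = 1 := by rw [← Real.rpow_add hR, add_neg_cancel, Real.rpow_zero]
  have hmw : ∀ a : ℝ, Measurable fun h : E ↦ ENNReal.ofReal (‖h‖ ^ a) := fun a ↦ by fun_prop
  have i1 : ∫⁻ h in {h : E | ‖h‖ ≤ R}, Φ h ≤ ENNReal.ofReal (2 * C ^ 2 * K) * N := by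
    calc _ ≤ ∫⁻ h : E in {h : E | ‖h‖ ≤ R}, ENNReal.ofReal (2 * C ^ 2 * R ^ (-θ)) * N *
          ENNReal.ofReal (‖h‖ ^ (θ - d)) :=
          lintegral_mono_ae ((ae_restrict_iff' hms1).2 hnear)
      _ = ENNReal.ofReal (2 * C ^ 2 * R ^ (-θ)) * N *
          ∫⁻ h : E in {h : E | ‖h‖ ≤ R}, ENNReal.ofReal (‖h‖ ^ (θ - d)) :=
          lintegral_const_mul _ (hmw _)
      _ ≤ ENNReal.ofReal (2 * C ^ 2 * R ^ (-θ)) * N * ENNReal.ofReal (K * R ^ θ) :=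
          mul_le_mul' le_rfl (hr R hR).1
      _ = _ := by
          rw [mul_right_comm, ← ENNReal.ofReal_mul (by positivity)]
          congr 2
          linear_combination 2 * C ^ 2 * K * hcancel
  have i2 : ∫⁻ h in {h : E | R ≤ ‖h‖}, Φ h ≤ ENNReal.ofReal (C ^ 2 * K) * N := by
    calc _ ≤ ∫⁻ h : E in {h : E | R ≤ ‖h‖}, ENNReal.ofReal (C ^ 2 * R ^ θ) * N *
          ENNReal.ofReal (‖h‖ ^ (-θ - d)) :=
          lintegral_mono_ae ((ae_restrict_iff' hms2).2 hfar)
      _ = ENNReal.ofReal (C ^ 2 * R ^ θ) * N *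
          ∫⁻ h : E in {h : E | R ≤ ‖h‖}, ENNReal.ofReal (‖h‖ ^ (-θ - d)) :=
          lintegral_const_mul _ (hmw _)
      _ ≤ ENNReal.ofReal (C ^ 2 * R ^ θ) * N * ENNReal.ofReal (K * R ^ (-θ)) :=
          mul_le_mul' le_rfl (hr R hR).2
      _ = _ := by
          rw [mul_right_comm, ← ENNReal.ofReal_mul (by positivity)]
          congr 2
          linear_combination C ^ 2 * K * hcancel
  calc _ ≤ ∫⁻ h, Φ h := enorm_incrForm_le hκb hb hφ
    _ = ∫⁻ h in {h : E | ‖h‖ ≤ R} ∪ {h : E | R ≤ ‖h‖}, Φ h := by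
        rw [← setLIntegral_univ]
        congr 2
        exact (Set.eq_univ_of_forall fun h : E ↦ (Set.mem_union h _ _).2 (le_total ‖h‖ R)).symm
    _ ≤ ENNReal.ofReal (2 * C ^ 2 * K) * N + ENNReal.ofReal (C ^ 2 * K) * N :=
        (lintegral_union_le _ _ _).trans (add_le_add i1 i2)
    _ = _ := by
        rw [← add_mul, ← ENNReal.ofReal_add (by positivity) (by positivity)]
        ring_nf

/-- The operators `incrOp` satisfy the cancellation estimate, uniformly in the coefficient and the
orders: `L¹` norms off the tripled ball are tested against bounded functions supported there. -/
lemma exists_hormanderBound_incrOp [Nontrivial E] {θ : ℝ} (hθ : 0 < θ) : ∃ A : ℝ, 0 < A ∧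
    ∀ (κ : E × E → ℝ) (hκ : Measurable κ) (hb : ∀ z, |κ z| ≤ 1) (σ₁ σ₂ : ℝ)
      (h₁ : σ₁ ∈ Set.Ioo (0 : ℝ) 1) (h₂ : σ₂ ∈ Set.Ioo (0 : ℝ) 1), σ₁ ∈ Set.Ioo θ (1 - θ) →
      σ₂ ∈ Set.Ioo θ (1 - θ) → HormanderBound (incrOp κ hκ hb h₁ h₂) (ENNReal.ofReal A) := by
  obtain ⟨A, hA, h⟩ := exists_enorm_incrForm_le (E := E) hθ
  refine ⟨A, hA, fun κ hκ hb σ₁ σ₂ h₁ h₂ h₁' h₂' c R hR b hbs hb0 ↦ ?_⟩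
  have hbi : Integrable b := by
    have hfin : IsFiniteMeasure (volume.restrict (Metric.closedBall c R)) :=
      ⟨by simpa using measure_closedBall_lt_top⟩
    have h1 : IntegrableOn b (Metric.closedBall c R) :=
      ((Lp.memLp b).restrict _).integrable (by norm_num)
    refine ((integrable_indicator_iff measurableSet_closedBall).2 h1).congr ?_
    filter_upwards [hbs] with x hx
    by_cases hxB : x ∈ Metric.closedBall c R
    · rw [Set.indicator_of_mem hxB]
    · rw [Set.indicator_of_notMem hxB, hx hxB]
  refine setLIntegral_enorm_le_of_forall _ measurableSet_closedBall.compl fun φ hφ1 hφs ↦ ?_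
  rw [integral_incrOp_mul]
  refine h κ hb σ₁ h₁' σ₂ h₂' c R hR b φ (measurable_coeFn_Lp b) (measurable_coeFn_Lp φ) hbi hbs
    hb0 hφ1 ?_
  filter_upwards [hφs] with x hx hxB
  exact hx fun h ↦ h hxB

/-- The operators `incrOp` are bounded on `L^p`, uniformly for `2 ≤ p < 1/θ` and for orders
in `(θ, 1 - θ)`. -/
theorem exists_eLpNorm'_incrOp_le [Nontrivial E] {θ : ℝ} (hθ : 0 < θ) : ∃ C : ℝ≥0∞, C ≠ ⊤ ∧
    ∀ (κ : E × E → ℝ) (hκ : Measurable κ) (hb : ∀ z, |κ z| ≤ 1) (σ₁ σ₂ : ℝ)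
      (h₁ : σ₁ ∈ Set.Ioo (0 : ℝ) 1) (h₂ : σ₂ ∈ Set.Ioo (0 : ℝ) 1), σ₁ ∈ Set.Ioo θ (1 - θ) →
      σ₂ ∈ Set.Ioo θ (1 - θ) → ∀ p ∈ Set.Ico 2 (1 / θ), ∀ f : L2 E,
        eLpNorm' (incrOp κ hκ hb h₁ h₂ f) p volume ≤ C * eLpNorm' f p volume := by
  obtain ⟨A₁, hA₁, hS⟩ := exists_norm_incrOp_le (E := E) hθ
  obtain ⟨A₂, hA₂, hH⟩ := exists_hormanderBound_incrOp (E := E) hθ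
  set A : ℝ≥0∞ := ENNReal.ofReal (max A₁ A₂) with hA
  have hAt : A ≠ ⊤ := ENNReal.ofReal_ne_top
  set W := weakConst (Module.finrank ℝ E) A with hW
  have hWt : W ≠ ⊤ := by
    rw [hW, weakConst]
    finiteness
  obtain ⟨C, hC, h⟩ := exists_eLpNorm'_apply_le (E := E) hθ hAt hWt
  refine ⟨C, hC, fun κ hκ hb σ₁ σ₂ h₁ h₂ h₁' h₂' p hp f ↦ ?_⟩
  have hS' : ∀ (σ₁ σ₂ : ℝ) (h₁ : σ₁ ∈ Set.Ioo (0 : ℝ) 1) (h₂ : σ₂ ∈ Set.Ioo (0 : ℝ) 1),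
      σ₁ ∈ Set.Ioo θ (1 - θ) → σ₂ ∈ Set.Ioo θ (1 - θ) →
      ∀ f : L2 E, ‖incrOp κ hκ hb h₁ h₂ f‖ₑ ≤ A * ‖f‖ₑ := by
    intro σ₁ σ₂ h₁ h₂ h₁' h₂' f
    rw [← ofReal_norm, ← ofReal_norm, hA, ← ENNReal.ofReal_mul (by positivity)]
    refine ENNReal.ofReal_le_ofReal ((ContinuousLinearMap.le_opNorm _ _).trans ?_)
    gcongr
    exact (hS κ hκ hb σ₁ σ₂ h₁ h₂ h₁' h₂').trans (le_max_left _ _)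
  have hH' : ∀ (σ₁ σ₂ : ℝ) (h₁ : σ₁ ∈ Set.Ioo (0 : ℝ) 1) (h₂ : σ₂ ∈ Set.Ioo (0 : ℝ) 1),
      σ₁ ∈ Set.Ioo θ (1 - θ) → σ₂ ∈ Set.Ioo θ (1 - θ) →
      HormanderBound (incrOp κ hκ hb h₁ h₂) A := by
    intro σ₁ σ₂ h₁ h₂ h₁' h₂' c R hR b hbs hb0
    refine (hH κ hκ hb σ₁ σ₂ h₁ h₂ h₁' h₂' c R hR b hbs hb0).trans ?_
    exact mul_le_mul' (ENNReal.ofReal_le_ofReal (le_max_right _ _)) le_rfl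
  exact h _ (incrOp κ hκ hb h₂ h₁) (integral_incrOp_mul_comm hκ hb h₁ h₂)
    (hS' _ _ h₁ h₂ h₁' h₂') (hS' _ _ h₂ h₁ h₂' h₁')
    (fun f _ ↦ mul_volume_lt_enorm_le (hS' _ _ h₁ h₂ h₁' h₂') (hH' _ _ h₁ h₂ h₁' h₂') f)
    (fun f _ ↦ mul_volume_lt_enorm_le (hS' _ _ h₂ h₁ h₂' h₁') (hH' _ _ h₂ h₁ h₂' h₁') f) p hp f

/-! ### Fractional powers and mollification -/

/-- Translation is continuous in `L^p`. -/
lemma exists_forall_lintegral_sub_rpow_le {p : ℝ} (hp : 1 ≤ p)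
    (G : Lp ℂ (ENNReal.ofReal p) (volume : Measure E)) {δ : ℝ} (hδ : 0 < δ) :
    ∃ r : ℝ, 0 < r ∧ ∀ y : E, ‖y‖ ≤ r → ∫⁻ x, ‖G (x - y) - G x‖ₑ ^ p ≤ ENNReal.ofReal δ := by
  have hp0 : 0 < p := by linarith
  have hF : Fact (1 ≤ ENNReal.ofReal p) := ⟨by simpa using hp⟩
  have hmp : ∀ y : E, MeasurePreserving
      (ContinuousMap.mk (fun x : E ↦ x - y) (by fun_prop)) volume volume := fun y ↦
    measurePreserving_sub_right volume y
  have hcont : Continuous fun y : E ↦ Lp.compMeasurePreserving _ (hmp y) G := by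
    refine Continuous.compMeasurePreservingLp continuous_const ?_ hmp ENNReal.ofReal_ne_top
    exact ContinuousMap.continuous_of_continuous_uncurry _ (by
      change Continuous fun z : E × E ↦ z.2 - z.1
      fun_prop)
  have h0 : Lp.compMeasurePreserving _ (hmp 0) G = G := by
    apply Lp.ext
    filter_upwards [Lp.coeFn_compMeasurePreserving G (hmp 0)] with x hx
    rw [hx]
    simp
  have hlim := Metric.continuous_iff.1 hcont 0 (δ ^ p⁻¹) (by positivity)
  obtain ⟨r, hr, h⟩ := hlim
  refine ⟨r / 2, by positivity, fun y hy ↦ ?_⟩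
  have h1 := (h y (by rw [dist_zero_right]; linarith)).le
  rw [h0, dist_eq_norm] at h1
  have h2 := ENNReal.ofReal_le_ofReal h1
  rw [ofReal_norm, Lp.enorm_def, eLpNorm_eq_lintegral_rpow_enorm_toReal (by simpa using hp0)
    ENNReal.ofReal_ne_top, ENNReal.toReal_ofReal hp0.le, one_div,
    ENNReal.rpow_inv_le_iff hp0, ENNReal.ofReal_rpow_of_nonneg (by positivity) hp0.le,
    Real.rpow_inv_rpow hδ.le hp0.ne'] at h2
  refine le_trans (le_of_eq ?_) h2
  apply lintegral_congr_ae
  filter_upwards [Lp.coeFn_sub (Lp.compMeasurePreserving _ (hmp y) G) G,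
    Lp.coeFn_compMeasurePreserving G (hmp y)] with x h3 h4
  rw [h3, Pi.sub_apply, h4]
  rfl

/-- The error of mollification is at most the `L^p` modulus of continuity, by Jensen. -/
lemma lintegral_conv_sub_rpow_le {k G : E → ℂ} (hk : Measurable k) (hG : Measurable G) {p : ℝ}
    (hp : 1 ≤ p) (hGp : MemLp G (ENNReal.ofReal p)) (hk1 : ∫⁻ x, ‖k x‖ₑ = 1)
    (hki : ∫ x, k x = 1) {r : ℝ} (hks : ∀ x, r < ‖x‖ → k x = 0) {δ : ℝ≥0∞}
    (hδ : ∀ y : E, ‖y‖ ≤ r → ∫⁻ x, ‖G (x - y) - G x‖ₑ ^ p ≤ δ) :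
    ∫⁻ x, ‖conv k G x - G x‖ₑ ^ p ≤ δ := by
  have hp0 : 0 < p := by linarith
  have hkI : Integrable k := ⟨hk.aestronglyMeasurable, by
    rw [HasFiniteIntegral, hk1]
    exact ENNReal.one_lt_top⟩
  have hle : ∀ᵐ x, ‖conv k G x - G x‖ₑ ^ p ≤ ∫⁻ y, ‖k y‖ₑ * ‖G (x - y) - G x‖ₑ ^ p := by
    filter_upwards [ae_integrable_conv hk hG hp hkI hGp] with x hx
    have e : conv k G x - G x = ∫ y, k (x - y) * (G y - G x) := by
      have e1 := integral_sub hx ((hkI.comp_sub_left x).mul_const (G x))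
      rw [integral_mul_const, integral_sub_left_eq_self, hki, one_mul] at e1
      refine e1.symm.trans ?_
      congr 1 with y
      ring
    have e2 : ‖conv k G x - G x‖ₑ ≤ ∫⁻ y, ‖k y‖ₑ * ‖G (x - y) - G x‖ₑ := by
      rw [e, ← lintegral_sub_left_eq_self (fun y ↦ ‖k y‖ₑ * ‖G (x - y) - G x‖ₑ) x]
      refine (enorm_integral_le_lintegral_enorm _).trans (le_of_eq ?_)
      refine lintegral_congr fun y ↦ ?_
      rw [enorm_mul, sub_sub_cancel]
    refine (ENNReal.rpow_le_rpow e2 hp0.le).trans ?_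
    refine (lintegral_mul_rpow_le hk.enorm.aemeasurable
      (f := fun y ↦ ‖G (x - y) - G x‖ₑ) ?_ hp).trans ?_
    · exact ((hG.comp (measurable_const.sub measurable_id)).sub measurable_const).enorm.aemeasurable
    · rw [hk1, ENNReal.one_rpow, one_mul]
  refine (lintegral_mono_ae hle).trans ?_
  have hm : Measurable (fun z : E × E ↦ ‖k z.2‖ₑ * ‖G (z.1 - z.2) - G z.1‖ₑ ^ p) :=
    (hk.comp measurable_snd).enorm.mul
      (((hG.comp (measurable_fst.sub measurable_snd)).sub
        (hG.comp measurable_fst)).enorm.pow_const p)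
  rw [lintegral_lintegral_swap hm.aemeasurable]
  calc _ ≤ ∫⁻ y, ‖k y‖ₑ * δ := by
        refine lintegral_mono fun y ↦ ?_
        rw [lintegral_const_mul' _ _ (by finiteness)]
        by_cases hy : ‖y‖ ≤ r
        · exact mul_le_mul' le_rfl (hδ y hy)
        · rw [hks y (not_le.1 hy)]
          simp
    _ = δ := by rw [lintegral_mul_const _ hk.enorm, hk1, one_mul]

/-- Smooth nonnegative functions of integral one with arbitrarily small support. -/
lemma exists_mollifier {r : ℝ} (hr : 0 < r) : ∃ k : 𝓢(E, ℂ), ∫⁻ x, ‖k x‖ₑ = 1 ∧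
    ∫ x, k x = 1 ∧ ∀ x, r < ‖x‖ → k x = 0 := by
  set f : ContDiffBump (0 : E) := ⟨r / 2, r, by positivity, by linarith⟩ with hf
  have hc : HasCompactSupport (fun x ↦ (f.normed volume x : ℂ)) :=
    f.hasCompactSupport_normed.comp_left (g := ((↑) : ℝ → ℂ)) (by simp)
  have hs : ContDiff ℝ ∞ (fun x ↦ (f.normed volume x : ℂ)) :=
    Complex.ofRealCLM.contDiff.comp f.contDiff_normed
  refine ⟨hc.toSchwartzMap hs, ?_, ?_, fun x hx ↦ ?_⟩
  · have e : ∀ x, ‖(hc.toSchwartzMap hs : 𝓢(E, ℂ)) x‖ₑ = ENNReal.ofReal (f.normed volume x) := by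
      intro x
      rw [HasCompactSupport.toSchwartzMap_toFun, ← ofReal_norm, Complex.norm_real,
        Real.norm_of_nonneg (f.nonneg_normed x)]
    simp_rw [e]
    rw [← ofReal_integral_eq_lintegral_ofReal f.integrable_normed
      (Eventually.of_forall f.nonneg_normed), f.integral_normed, ENNReal.ofReal_one]
  · simp only [HasCompactSupport.toSchwartzMap_toFun]
    rw [integral_complex_ofReal, f.integral_normed, Complex.ofReal_one]
  · rw [HasCompactSupport.toSchwartzMap_toFun]
    have : x ∉ Function.support (f.normed volume) := by
      rw [f.support_normed_eq, Metric.mem_ball, dist_zero_right]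
      exact not_lt.2 hx.le
    rw [Function.notMem_support.1 this, Complex.ofReal_zero]

/-- `g = (-Δ)^{τ/2} w` for square-integrable `w` and `g`, on the Fourier side. The symbol is even, so
the inverse transform serves as well as the transform, and `2π‖ξ‖` stands for the frequency in the
normalization `e^{-2πi⟨x,ξ⟩}`. -/
def IsFracPow (τ : ℝ) (w g : L2 E) : Prop :=
  ∀ᵐ ξ, (𝓕⁻ g : L2 E) ξ = (((2 * Real.pi * ‖ξ‖) ^ τ : ℝ) : ℂ) * (𝓕⁻ w : L2 E) ξ

/-- `G = (-Δ)^{τ/2} F` in the sense of tempered distributions, with the test functions on the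
Fourier side. -/
def HasFracPow (τ : ℝ) (F : L2 E) (G : E → ℂ) : Prop :=
  ∀ η : 𝓢(E, ℂ), ∫ ξ, (((2 * Real.pi * ‖ξ‖) ^ τ : ℝ) : ℂ) * (𝓕⁻ F : L2 E) ξ * η ξ =
    ∫ x, G x * (𝓕⁻ η) x

lemma locallyIntegrable_rpow_mul {τ : ℝ} (hτ : 0 ≤ τ) (F : L2 E) :
    LocallyIntegrable (fun ξ : E ↦ (((2 * Real.pi * ‖ξ‖) ^ τ : ℝ) : ℂ) * F ξ) := by
  have hc : Continuous (fun ξ : E ↦ (((2 * Real.pi * ‖ξ‖) ^ τ : ℝ) : ℂ)) :=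
    Complex.continuous_ofReal.comp ((by fun_prop : Continuous fun ξ : E ↦
      2 * Real.pi * ‖ξ‖).rpow_const fun _ ↦ Or.inr hτ)
  rw [locallyIntegrable_iff]
  intro K hK
  exact ((locallyIntegrable_iff.1 (locallyIntegrable_Lp F)) K hK).continuousOn_mul hc.continuousOn hK

lemma IsFracPow.hasFracPow {τ : ℝ} {w g : L2 E} (h : IsFracPow τ w g) : HasFracPow τ w g := by
  intro η
  rw [integral_mul_fourierInv_schwartz]
  apply integral_congr_ae
  filter_upwards [h] with ξ hξ
  rw [hξ]

lemma HasFracPow.isFracPow {τ : ℝ} (hτ : 0 ≤ τ) {w g : L2 E} (h : HasFracPow τ w g) :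
    IsFracPow τ w g := by
  refine ae_eq_of_integral_mul_schwartz (locallyIntegrable_Lp _)
    (locallyIntegrable_rpow_mul hτ _) fun φ _ ↦ ?_
  rw [h φ, integral_mul_fourierInv_schwartz]

lemma rpow_le_one_add {τ a : ℝ} (h0 : 0 ≤ τ) (h1 : τ ≤ 1) (ha : 0 ≤ a) : a ^ τ ≤ 1 + a := by
  rcases le_total a 1 with h | h
  · exact (Real.rpow_le_one ha h h0).trans (by linarith)
  · calc _ ≤ a ^ (1 : ℝ) := Real.rpow_le_rpow_of_exponent_le h h1
      _ ≤ _ := by rw [Real.rpow_one]; linarith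

lemma exists_rpow_mul_schwartz_le {τ : ℝ} (h0 : 0 ≤ τ) (h1 : τ ≤ 1) (η : 𝓢(E, ℂ)) :
    ∃ C : ℝ, ∀ ξ, ‖(((2 * Real.pi * ‖ξ‖) ^ τ : ℝ) : ℂ) * η ξ‖ ≤ C := by
  obtain ⟨C0, hC0, hd0⟩ := η.decay 0 0
  obtain ⟨C1, hC1, hd1⟩ := η.decay 1 0
  refine ⟨C0 + 2 * Real.pi * C1, fun ξ ↦ ?_⟩
  have a0 := hd0 ξ
  have a1 := hd1 ξ
  simp only [pow_zero, pow_one, norm_iteratedFDeriv_zero, one_mul] at a0 a1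
  have hp := Real.pi_pos
  rw [norm_mul, Complex.norm_real, Real.norm_of_nonneg (by positivity)]
  have : (2 * Real.pi * ‖ξ‖) ^ τ ≤ 1 + 2 * Real.pi * ‖ξ‖ :=
    rpow_le_one_add h0 h1 (by positivity)
  calc _ ≤ (1 + 2 * Real.pi * ‖ξ‖) * ‖η ξ‖ := by gcongr
    _ = ‖η ξ‖ + 2 * Real.pi * (‖ξ‖ * ‖η ξ‖) := by ring
    _ ≤ _ := by gcongr

/-- Mollification regularizes a distributional relation `G = (-Δ)^{τ/2} F` to one between
square-integrable functions. -/
lemma exists_isFracPow_near {τ : ℝ} (h0 : 0 ≤ τ) (h1 : τ ≤ 1) {p : ℝ} (hp : 1 < p) {F : L2 E}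
    {G : Lp ℂ (ENNReal.ofReal p) (volume : Measure E)} (h : HasFracPow τ F G)
    {δ : ℝ} (hδ : 0 < δ) :
    ∃ F' G' : L2 E, IsFracPow τ F' G' ∧ ∫⁻ x, ‖F' x - F x‖ₑ ^ 2 ≤ ENNReal.ofReal δ ∧
      ∫⁻ x, ‖G' x - G x‖ₑ ^ p ≤ ENNReal.ofReal δ := by
  have e2 : (2 : ℝ≥0∞) = ENNReal.ofReal 2 := by simp
  have hFm := measurable_coeFn_Lp F
  have hGm := measurable_coeFn_Lp G
  obtain ⟨r1, hr1, hG⟩ := exists_forall_lintegral_sub_rpow_le hp.le G hδ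
  obtain ⟨r2, hr2, hF⟩ : ∃ r : ℝ, 0 < r ∧ ∀ y : E, ‖y‖ ≤ r →
      ∫⁻ x, ‖F (x - y) - F x‖ₑ ^ (2 : ℝ) ≤ ENNReal.ofReal δ := by
    have hmem : MemLp F (ENNReal.ofReal 2) volume := by
      rw [← e2]
      exact Lp.memLp F
    obtain ⟨r, hr, hF⟩ := exists_forall_lintegral_sub_rpow_le one_le_two (hmem.toLp F) hδ
    refine ⟨r, hr, fun y hy ↦ le_trans (le_of_eq ?_) (hF y hy)⟩
    apply lintegral_congr_ae
    have e := hmem.coeFn_toLp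
    filter_upwards [e, (measurePreserving_sub_right volume y).quasiMeasurePreserving.ae e]
      with x h3 h4
    rw [h3, h4]
  obtain ⟨k, hk1, hki, hks⟩ := exists_mollifier (E := E) (lt_min hr1 hr2)
  have hkm : Measurable k := k.continuous.measurable
  have hkI : Integrable k := k.integrable
  have hF2 := memLp_two_conv hkm hFm hkI (Lp.memLp F)
  -- `F'` is the mollification of `F` by `k`. The transform of `k` decays, so `(-Δ)^{τ/2} F'` is
  -- square integrable, and it is the mollification of `G`.
  set F' : L2 E := hF2.toLp _ with hF'
  have hfF : (𝓕⁻ F' : L2 E) =ᵐ[volume] fun ξ ↦ (𝓕⁻ k) ξ * (𝓕⁻ F : L2 E) ξ := by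
    have := fourierInv_conv hkm hFm hkI (Lp.memLp F)
    rw [Lp.toLp_coeFn] at this
    filter_upwards [this] with ξ hξ
    rw [hξ, SchwartzMap.fourierInv_coe]
  obtain ⟨C, hC⟩ := exists_rpow_mul_schwartz_le h0 h1 (𝓕⁻ k : 𝓢(E, ℂ))
  have hmw : Measurable (fun ξ : E ↦ (((2 * Real.pi * ‖ξ‖) ^ τ : ℝ) : ℂ)) :=
    Complex.measurable_ofReal.comp (by fun_prop)
  have hmul : MemLp (fun ξ ↦ (((2 * Real.pi * ‖ξ‖) ^ τ : ℝ) : ℂ) * (𝓕⁻ F' : L2 E) ξ) 2 := by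
    refine MemLp.of_le_mul (c := C) (Lp.memLp (𝓕⁻ F : L2 E))
      (hmw.aestronglyMeasurable.mul (Lp.aestronglyMeasurable _)) ?_
    filter_upwards [hfF] with ξ hξ
    rw [hξ, ← mul_assoc, norm_mul]
    gcongr
    exact hC ξ
  set G' : L2 E := 𝓕 (hmul.toLp _) with hG'
  have hfG : IsFracPow τ F' G' := by
    have e : (𝓕⁻ G' : L2 E) = hmul.toLp _ := (Lp.fourierTransformₗᵢ E ℂ).symm_apply_apply _
    unfold IsFracPow
    rw [e]
    exact hmul.coeFn_toLp
  have hGconv : G' =ᵐ[volume] conv k G := by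
    have hLp := memLp_conv hkm hGm hp.le hkI (Lp.memLp G)
    refine ae_eq_of_integral_mul_schwartz (locallyIntegrable_Lp _)
      (hLp.locallyIntegrable (by simpa using hp.le)) fun φ _ ↦ ?_
    set η : 𝓢(E, ℂ) := 𝓕 φ with hη
    have hφη : φ = 𝓕⁻ η := (FourierPair.fourierInv_fourier_eq φ).symm
    set η' : 𝓢(E, ℂ) := SchwartzMap.smulLeftCLM ℂ (𝓕⁻ k : 𝓢(E, ℂ)) η with hη'
    have hη'x : ∀ ξ, η' ξ = (𝓕⁻ k) ξ * η ξ := fun ξ ↦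
      SchwartzMap.smulLeftCLM_apply_apply (SchwartzMap.hasTemperateGrowth _) _ _
    calc ∫ x, G' x * φ x = ∫ ξ, (((2 * Real.pi * ‖ξ‖) ^ τ : ℝ) : ℂ) * (𝓕⁻ F' : L2 E) ξ * η ξ := by
          rw [hφη]
          exact (hfG.hasFracPow η).symm
      _ = ∫ ξ, (((2 * Real.pi * ‖ξ‖) ^ τ : ℝ) : ℂ) * (𝓕⁻ F : L2 E) ξ * η' ξ := by
          apply integral_congr_ae
          filter_upwards [hfF] with ξ hξ
          rw [hξ, hη'x]
          ring
      _ = ∫ y, G y * (𝓕⁻ η') y := h η'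
      _ = ∫ y, G y * ∫ x, k (x - y) * φ x := by
          congr 1 with y
          congr 1
          have := fourierInv_fourierInv_mul hkI η.integrable y
          have e : (η' : E → ℂ) = fun ξ ↦ 𝓕⁻ (k : E → ℂ) ξ * η ξ :=
            funext fun ξ ↦ by rw [hη'x, SchwartzMap.fourierInv_coe]
          rw [hφη, SchwartzMap.fourierInv_coe, SchwartzMap.fourierInv_coe, e, ← this]
      _ = ∫ x, conv k G x * φ x :=
          (integral_conv_mul hkm hGm φ.continuous.measurable (Real.HolderConjugate.conjExponent hp)
            hkI (Lp.memLp G) (φ.memLp _)).symm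
  refine ⟨F', G', hfG, ?_, ?_⟩
  · have := lintegral_conv_sub_rpow_le hkm hFm one_le_two (by rw [← e2]; exact Lp.memLp F) hk1 hki
      hks fun y hy ↦ hF y (hy.trans (min_le_right _ _))
    refine le_trans (le_of_eq ?_) this
    apply lintegral_congr_ae
    filter_upwards [hF2.coeFn_toLp] with x hx
    rw [hx]
    simp
  · have := lintegral_conv_sub_rpow_le hkm hGm hp.le (Lp.memLp G) hk1 hki
      hks fun y hy ↦ hG y (hy.trans (min_le_left _ _))
    refine le_trans (le_of_eq ?_) this
    apply lintegral_congr_ae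
    filter_upwards [hGconv] with x hx
    rw [hx]

/-! ### Intertwining by fractional derivatives -/

lemma memLp_rpow_mul_schwartz {τ : ℝ} (h0 : 0 ≤ τ) (h1 : τ ≤ 1) (η : 𝓢(E, ℂ)) (q : ℝ≥0∞) :
    MemLp (fun ξ ↦ (((2 * Real.pi * ‖ξ‖) ^ τ : ℝ) : ℂ) * η ξ) q := by
  have hg : Function.HasTemperateGrowth (fun ξ : E ↦ ((1 + ‖ξ‖ ^ 2 : ℝ) : ℂ)) := by fun_prop
  set η' : 𝓢(E, ℂ) := SchwartzMap.smulLeftCLM ℂ (fun ξ : E ↦ ((1 + ‖ξ‖ ^ 2 : ℝ) : ℂ)) η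
  have hη' : ∀ ξ, η' ξ = ((1 + ‖ξ‖ ^ 2 : ℝ) : ℂ) * η ξ := fun ξ ↦
    SchwartzMap.smulLeftCLM_apply_apply hg _ _
  have hm : Measurable (fun ξ : E ↦ (((2 * Real.pi * ‖ξ‖) ^ τ : ℝ) : ℂ)) :=
    Complex.measurable_ofReal.comp (by fun_prop)
  refine MemLp.of_le_mul (c := 1 + 2 * Real.pi) (η'.memLp q)
    (hm.mul η.continuous.measurable).aestronglyMeasurable (Eventually.of_forall fun ξ ↦ ?_)
  have hp := Real.pi_pos
  rw [hη', norm_mul, norm_mul, Complex.norm_real, Complex.norm_real,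
    Real.norm_of_nonneg (by positivity), Real.norm_of_nonneg (by positivity), ← mul_assoc]
  gcongr
  have : (2 * Real.pi * ‖ξ‖) ^ τ ≤ 1 + 2 * Real.pi * ‖ξ‖ :=
    rpow_le_one_add h0 h1 (by positivity)
  have h2 : ‖ξ‖ ≤ 1 + ‖ξ‖ ^ 2 := by nlinarith [sq_nonneg (‖ξ‖ - 1)]
  nlinarith [sq_nonneg ‖ξ‖]

lemma fourierInv_fourierInv_schwartz (φ : 𝓢(E, ℂ)) (x : E) : (𝓕⁻ (𝓕⁻ φ)) x = φ (-x) := by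
  have h : 𝓕 (𝓕⁻ φ) = φ := FourierInvPair.fourier_fourierInv_eq φ
  rw [SchwartzMap.fourierInv_coe, Real.fourierInv_eq_fourier_neg, ← SchwartzMap.fourier_coe, h]

/-- On `L²`, the inverse Fourier transform is an involution up to reflection. -/
lemma fourierInv_fourierInv_ae (b : L2 E) :
    (𝓕⁻ (𝓕⁻ b : L2 E) : L2 E) =ᵐ[volume] fun ξ ↦ b (-ξ) := by
  have hb : MemLp (fun ξ ↦ b (-ξ)) 2 :=
    (Lp.memLp b).comp_measurePreserving (Measure.measurePreserving_neg volume)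
  refine ae_eq_of_integral_mul_schwartz (locallyIntegrable_Lp _)
    (hb.locallyIntegrable one_le_two) fun φ _ ↦ ?_
  rw [← integral_mul_fourierInv_schwartz, ← integral_mul_fourierInv_schwartz,
    ← integral_neg_eq_self]
  simp only [fourierInv_fourierInv_schwartz, neg_neg]

/-- `(-Δ)^{τ/2} φ` of a Schwartz function `φ`, given on the Fourier side, is its fractional
derivative in the sense of `IsFracPow`. -/
lemma isFracPow_schwartz {τ : ℝ} {b : L2 E} {η : 𝓢(E, ℂ)}
    (hb : b =ᵐ[volume] fun ξ ↦ (((2 * Real.pi * ‖ξ‖) ^ τ : ℝ) : ℂ) * η ξ) :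
    IsFracPow τ ((𝓕⁻ η).toLp 2) (𝓕⁻ b) := by
  have hneg := (Measure.measurePreserving_neg (volume : Measure E)).quasiMeasurePreserving
  have h2 := fourierInv_fourierInv_ae (η.toLp 2)
  rw [SchwartzMap.toLp_fourierInv_eq] at h2
  filter_upwards [fourierInv_fourierInv_ae b, h2, hneg.ae hb, hneg.ae (η.coeFn_toLp 2 volume)]
    with ξ h1 h2 h3 h4
  rw [h1, h2, h4, h3, norm_neg]

/-- Increments of potentials of different orders of `F` and `(-Δ)^{τ/2} F` agree. -/
lemma IsFracPow.potIncr_ae_eq [Nontrivial E] {τ σ σ' : ℝ} {F G : L2 E} (h : IsFracPow τ F G)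
    (hσ : σ ∈ Set.Ioo (0 : ℝ) 1) (hσ' : σ' ∈ Set.Ioo (0 : ℝ) 1) (e : σ' = σ + τ) (y : E) :
    potIncr σ F y =ᵐ[volume] potIncr σ' G y := by
  refine NonlocalCZ.potIncr_ae_eq hσ.1 hσ.2 hσ'.1 hσ'.2 ?_ y
  filter_upwards [h, Measure.ae_ne volume 0] with ξ hξ h0
  rw [hξ, ← mul_assoc, ← Complex.ofReal_mul, ← Real.rpow_add (by positivity)]
  congr 4
  linarith

/-- A fractional derivative of order `τ` can be moved from one argument of the form to the other.
The increments do not change, and neither does the product of the weights `|h|^{-d/2-σ}`, as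
`2 s = s₁ + s₂`. -/
lemma incrForm_eq_of_isFracPow [Nontrivial E] (κ : E × E → ℝ) {s s₁ s₂ τ : ℝ}
    (hs : s ∈ Set.Ioo (0 : ℝ) 1) (h₁ : s₁ ∈ Set.Ioo (0 : ℝ) 1) (h₂ : s₂ ∈ Set.Ioo (0 : ℝ) 1)
    (e₁ : s₁ = s + τ) (e₂ : s = s₂ + τ) {F G ψ χ : L2 E} (hF : IsFracPow τ F G)
    (hψ : IsFracPow τ ψ χ) : incrForm κ s s F χ = incrForm κ s₁ s₂ G ψ := by
  have hm := fun (σ : ℝ) (w : L2 E) ↦ measurable_liftFun σ (measurable_coeFn_Lp w)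
  unfold incrForm
  apply integral_congr_ae
  have : ∀ᵐ z : E × E, liftFun s F z * liftFun s χ z = liftFun s₁ G z * liftFun s₂ ψ z := by
    rw [Measure.volume_eq_prod]
    refine (Measure.ae_prod_iff_ae_ae
      (measurableSet_eq_fun ((hm _ _).mul (hm _ _)) ((hm _ _).mul (hm _ _)))).2 ?_
    filter_upwards [Measure.ae_ne volume 0] with y hy
    filter_upwards [hF.potIncr_ae_eq hs h₁ e₁ y, hψ.potIncr_ae_eq h₂ hs e₂ y] with x h1 h2
    change liftFun s F (y, x) * liftFun s χ (y, x) = liftFun s₁ G (y, x) * liftFun s₂ ψ (y, x)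
    simp only [liftFun]
    rw [h1, h2, mul_mul_mul_comm, mul_mul_mul_comm (((‖y‖ ^ (-(_ / 2 + s₁)) : ℝ) : ℂ)),
      ← Complex.ofReal_mul, ← Complex.ofReal_mul, ← Real.rpow_add (by positivity),
      ← Real.rpow_add (by positivity)]
    congr 3
    linarith
  filter_upwards [this] with z hz
  rw [mul_assoc, hz, mul_assoc]

/-- Fractional derivatives intertwine the operators `incrOp` of different orders. -/
lemma IsFracPow.incrOp [Nontrivial E] {κ : E × E → ℝ} (hκ : Measurable κ) (hb : ∀ z, |κ z| ≤ 1)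
    {s s₁ s₂ τ : ℝ} (hs : s ∈ Set.Ioo (0 : ℝ) 1) (h₁ : s₁ ∈ Set.Ioo (0 : ℝ) 1)
    (h₂ : s₂ ∈ Set.Ioo (0 : ℝ) 1) (hτ : 0 ≤ τ) (e₁ : s₁ = s + τ) (e₂ : s = s₂ + τ) {F G : L2 E}
    (h : IsFracPow τ F G) :
    IsFracPow τ (incrOp κ hκ hb hs hs F) (incrOp κ hκ hb h₁ h₂ G) := by
  -- Testing `T_{s,s} F` against `(-Δ)^{τ/2} ψ` gives the form at `F` and `(-Δ)^{τ/2} ψ`, which is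
  -- the form of orders `s₁`, `s₂` at `(-Δ)^{τ/2} F` and `ψ`.
  refine HasFracPow.isFracPow hτ fun η ↦ ?_
  have hm := memLp_rpow_mul_schwartz hτ (by linarith [hs.1, h₁.2]) η 2
  have hψ := isFracPow_schwartz hm.coeFn_toLp
  have e := incrForm_eq_of_isFracPow κ hs h₁ h₂ e₁ e₂ h hψ
  rw [← integral_incrOp_mul hκ hb hs hs, ← integral_incrOp_mul hκ hb h₁ h₂, integral_mul_fourierInv] at e
  convert e using 1
  · apply integral_congr_ae
    filter_upwards [hm.coeFn_toLp] with ξ hξ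
    rw [hξ]
    ring
  · apply integral_congr_ae
    filter_upwards [(𝓕⁻ η).coeFn_toLp 2] with ξ hξ
    rw [hξ]

/-! ### Neumann series in `L²` and `L^p` -/

lemma tendsto_integral_mul_schwartz {ι : Type*} {l : Filter ι} {q : ℝ≥0∞} [Fact (1 ≤ q)]
    {f : ι → Lp ℂ q (volume : Measure E)} {g : Lp ℂ q (volume : Measure E)}
    (h : Tendsto f l (𝓝 g)) (φ : 𝓢(E, ℂ)) :
    Tendsto (fun i ↦ ∫ x, f i x * φ x) l (𝓝 (∫ x, g x * φ x)) := by
  have h1 := ((PointwiseConvergenceCLM.evalCLM (RingHom.id ℂ) ℂ φ).continuous.comp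
    (Lp.toTemperedDistributionCLM ℂ (volume : Measure E) q).continuous).tendsto g
  have e : ∀ f : Lp ℂ q (volume : Measure E),
      ∫ x, f x * φ x = (Lp.toTemperedDistribution f : 𝓢'(E, ℂ)) φ := fun f ↦ by
    rw [Lp.toTemperedDistribution_apply]
    exact integral_congr_ae (Eventually.of_forall fun x ↦ mul_comm _ _)
  simp_rw [e]
  exact h1.comp h

lemma tendsto_integral_mul {ι : Type*} {l : Filter ι} {f : ι → L2 E} {g : L2 E}
    (h : Tendsto f l (𝓝 g)) (v : L2 E) :
    Tendsto (fun i ↦ ∫ x, f i x * v x) l (𝓝 (∫ x, g x * v x)) := by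
  simp only [← inner_star_Lp]
  exact ((continuous_const.inner continuous_id).tendsto g).comp h

/-- The relation `G = (-Δ)^{τ/2} F` is closed under limits of `F` in `L²` and of `G` in `L^q`. -/
lemma hasFracPow_of_tendsto {ι : Type*} {l : Filter ι} [l.NeBot] {τ : ℝ} (h0 : 0 ≤ τ)
    (h1 : τ ≤ 1) {q : ℝ≥0∞} [Fact (1 ≤ q)] {F : ι → L2 E} {F' : L2 E}
    {G : ι → Lp ℂ q (volume : Measure E)} {G' : Lp ℂ q (volume : Measure E)}
    (hF : Tendsto F l (𝓝 F')) (hG : Tendsto G l (𝓝 G')) (h : ∀ i, HasFracPow τ (F i) (G i)) :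
    HasFracPow τ F' G' := by
  intro η
  have hm := memLp_rpow_mul_schwartz h0 h1 η 2
  have e : ∀ F : L2 E, ∫ ξ, (((2 * Real.pi * ‖ξ‖) ^ τ : ℝ) : ℂ) * (𝓕⁻ F : L2 E) ξ * η ξ =
      ∫ x, F x * (𝓕⁻ (hm.toLp _) : L2 E) x := by
    intro F
    rw [integral_mul_fourierInv]
    apply integral_congr_ae
    filter_upwards [hm.coeFn_toLp] with ξ hξ
    rw [hξ]
    ring
  have h2 := tendsto_integral_mul_schwartz hG (𝓕⁻ η)
  refine tendsto_nhds_unique ?_ h2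
  have h3 := tendsto_integral_mul hF (𝓕⁻ (hm.toLp _) : L2 E)
  rw [← e] at h3
  refine h3.congr fun i ↦ ?_
  rw [← e, h i η]

lemma IsFracPow.add {τ : ℝ} {F F' G G' : L2 E} (h : IsFracPow τ F G) (h' : IsFracPow τ F' G') :
    IsFracPow τ (F + F') (G + G') := by
  have e : ∀ a b : L2 E, (𝓕⁻ (a + b) : L2 E) = 𝓕⁻ a + 𝓕⁻ b :=
    fun a b ↦ map_add (Lp.fourierTransformₗᵢ E ℂ).symm a b
  unfold IsFracPow
  rw [e, e]
  filter_upwards [h, h', Lp.coeFn_add (𝓕⁻ F : L2 E) (𝓕⁻ F'), Lp.coeFn_add (𝓕⁻ G : L2 E) (𝓕⁻ G')]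
    with ξ h1 h2 h3 h4
  rw [h3, h4, Pi.add_apply, Pi.add_apply, h1, h2, mul_add]

lemma IsFracPow.smul {τ : ℝ} {F G : L2 E} (c : ℂ) (h : IsFracPow τ F G) :
    IsFracPow τ (c • F) (c • G) := by
  have e : ∀ a : L2 E, (𝓕⁻ (c • a) : L2 E) = c • 𝓕⁻ a :=
    fun a ↦ map_smul (Lp.fourierTransformₗᵢ E ℂ).symm c a
  unfold IsFracPow
  rw [e, e]
  filter_upwards [h, Lp.coeFn_smul c (𝓕⁻ F : L2 E), Lp.coeFn_smul c (𝓕⁻ G : L2 E)]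
    with ξ h1 h3 h4
  rw [h3, h4, Pi.smul_apply, Pi.smul_apply, h1, smul_eq_mul, smul_eq_mul, mul_left_comm]

lemma isFracPow_zero (τ : ℝ) : IsFracPow τ (0 : L2 E) 0 := by
  simpa using (IsFracPow.smul (E := E) (τ := τ) 0 (F := 0) (G := 0) (by
    unfold IsFracPow
    have e : (𝓕⁻ (0 : L2 E) : L2 E) = 0 := map_zero (Lp.fourierTransformₗᵢ E ℂ).symm
    rw [e]
    filter_upwards [Lp.coeFn_zero ℂ 2 (volume : Measure E)] with ξ h
    rw [h]
    simp))

lemma HasFracPow.const_smul {τ : ℝ} {q : ℝ≥0∞} {F : L2 E} {G : Lp ℂ q (volume : Measure E)} (c : ℂ)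
    (h : HasFracPow τ F G) : HasFracPow τ (c • F) ((c • G : Lp ℂ q (volume : Measure E))) := by
  intro η
  have e : (𝓕⁻ (c • F) : L2 E) = c • 𝓕⁻ F := map_smul (Lp.fourierTransformₗᵢ E ℂ).symm c F
  rw [e]
  calc _ = ∫ ξ, c * ((((2 * Real.pi * ‖ξ‖) ^ τ : ℝ) : ℂ) * (𝓕⁻ F : L2 E) ξ * η ξ) := by
        apply integral_congr_ae
        filter_upwards [Lp.coeFn_smul c (𝓕⁻ F : L2 E)] with ξ hξ
        rw [hξ, Pi.smul_apply, smul_eq_mul]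
        ring
    _ = ∫ x, c * (G x * (𝓕⁻ η) x) := by
        rw [integral_const_mul, integral_const_mul, h η]
    _ = _ := by
        apply integral_congr_ae
        filter_upwards [Lp.coeFn_smul c G] with ξ hξ
        rw [hξ, Pi.smul_apply, smul_eq_mul, mul_assoc]

section Contraction

variable {S S' : L2 E →L[ℂ] L2 E}

lemma exists_eq_add_apply {X : Type*} [NormedAddCommGroup X] [NormedSpace ℂ X] [CompleteSpace X]
    {S : X →L[ℂ] X} (hS : ‖S‖ ≤ 1 / 2) (F : X) : ∃ w, w = F + S w := by
  obtain ⟨u, hu⟩ := isUnit_one_sub_of_norm_lt_one (x := S) (by linarith)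
  refine ⟨(↑u⁻¹ : X →L[ℂ] X) F, ?_⟩
  have h : ((u : X →L[ℂ] X) * (↑u⁻¹ : X →L[ℂ] X)) F = F := by rw [Units.mul_inv]; rfl
  rw [← sub_eq_iff_eq_add]
  rwa [hu] at h

lemma norm_le_of_eq_add_apply {X : Type*} [NormedAddCommGroup X] [NormedSpace ℂ X]
    {S : X →L[ℂ] X} (hS : ‖S‖ ≤ 1 / 2) {F w : X} (h : w = F + S w) : ‖w‖ ≤ 2 * ‖F‖ := by
  have h1 : ‖w‖ ≤ ‖F‖ + ‖S w‖ := (congrArg norm h).trans_le (norm_add_le F (S w))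
  have h2 := S.le_of_opNorm_le hS w
  linarith

lemma eq_add_apply_of_smul_sub_eq {X : Type*} [NormedAddCommGroup X] [NormedSpace ℂ X]
    {T : X →L[ℂ] X} {γ ε Λ : ℝ} (hγ : γ ≠ 0) {w f : X}
    (h : (γ : ℂ) • w - (ε : ℂ) • T w = (Λ : ℂ)⁻¹ • f) :
    w = ((γ * Λ : ℝ) : ℂ)⁻¹ • f + (((ε / γ : ℝ) : ℂ) • T) w := by
  have hγ' : (γ : ℂ) ≠ 0 := Complex.ofReal_ne_zero.2 hγ
  have e : w = (γ : ℂ)⁻¹ • ((γ : ℂ) • w) := by rw [smul_smul, inv_mul_cancel₀ hγ', one_smul]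
  calc w = (γ : ℂ)⁻¹ • ((Λ : ℂ)⁻¹ • f + (ε : ℂ) • T w) := by
        rw [← sub_eq_iff_eq_add.1 h]
        exact e
    _ = _ := by
        rw [smul_add, smul_smul, smul_smul, ← mul_inv, ← Complex.ofReal_mul, ← div_eq_inv_mul,
          ← Complex.ofReal_div]
        rfl

/-- The approximations of the solution of `w = F + S w` by fixed point iteration. -/
def neumannIter (S : L2 E →L[ℂ] L2 E) (F : L2 E) : ℕ → L2 E
  | 0 => 0
  | n + 1 => F + S (neumannIter S F n)

lemma tendsto_neumannIter (hS : ‖S‖ ≤ 1 / 2) {F w : L2 E} (h : w = F + S w) :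
    Tendsto (neumannIter S F) atTop (𝓝 w) := by
  have hb : ∀ n, ‖neumannIter S F n - w‖ ≤ (1 / 2 : ℝ) ^ n * ‖w‖ := by
    intro n
    induction n with
    | zero => simp [neumannIter]
    | succ n ih =>
      have e : neumannIter S F (n + 1) - w = S (neumannIter S F n - w) := by
        rw [neumannIter, map_sub]
        conv_lhs => rw [h]
        abel
      rw [e]
      calc _ ≤ 1 / 2 * ‖neumannIter S F n - w‖ := S.le_of_opNorm_le hS _
        _ ≤ 1 / 2 * ((1 / 2 : ℝ) ^ n * ‖w‖) := by gcongr
        _ = _ := by ring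
  rw [tendsto_iff_norm_sub_tendsto_zero]
  refine squeeze_zero (fun _ ↦ norm_nonneg _) hb ?_
  simpa using (tendsto_pow_atTop_nhds_zero_of_lt_one (by norm_num : (0 : ℝ) ≤ 1 / 2)
    (by norm_num)).mul_const ‖w‖

/-- The intertwining of `S` and `S'` by `(-Δ)^{τ/2}` passes to their resolvents, along the fixed
point iteration. -/
lemma isFracPow_of_eq_add_apply {τ : ℝ} (h0 : 0 ≤ τ) (h1 : τ ≤ 1) (hS : ‖S‖ ≤ 1 / 2)
    (hS' : ‖S'‖ ≤ 1 / 2) (hSS : ∀ F G, IsFracPow τ F G → IsFracPow τ (S F) (S' G))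
    {F G w h : L2 E} (hFG : IsFracPow τ F G) (hw : w = F + S w) (hh : h = G + S' h) :
    IsFracPow τ w h := by
  have hn : ∀ n, IsFracPow τ (neumannIter S F n) (neumannIter S' G n) := by
    intro n
    induction n with
    | zero => exact isFracPow_zero τ
    | succ n ih => exact hFG.add (hSS _ _ ih)
  exact (hasFracPow_of_tendsto h0 h1 (tendsto_neumannIter hS hw) (tendsto_neumannIter hS' hh)
    fun n ↦ (hn n).hasFracPow).isFracPow h0

/-- A bound of a contraction of `L²` in a further norm `L^q` passes to the resolvent, by Fatou's
lemma. -/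
lemma eLpNorm_le_of_eq_add_apply {q : ℝ≥0∞} (hq : 1 ≤ q) (hS : ‖S‖ ≤ 1 / 2)
    (hSq : ∀ f : L2 E, eLpNorm (S f) q volume ≤ 2⁻¹ * eLpNorm f q volume) {G h : L2 E}
    (hh : h = G + S h) : eLpNorm h q volume ≤ 2 * eLpNorm G q volume := by
  have hn : ∀ n, eLpNorm (neumannIter S G n) q volume ≤ 2 * eLpNorm G q volume := by
    intro n
    induction n with
    | zero =>
      rw [neumannIter, eLpNorm_congr_ae (Lp.coeFn_zero ℂ 2 volume), eLpNorm_zero]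
      exact zero_le
    | succ n ih =>
      calc eLpNorm (neumannIter S G (n + 1)) q volume
          = eLpNorm (⇑G + ⇑(S (neumannIter S G n))) q volume :=
            eLpNorm_congr_ae (Lp.coeFn_add G (S (neumannIter S G n)))
        _ ≤ eLpNorm G q volume + eLpNorm (S (neumannIter S G n)) q volume :=
            eLpNorm_add_le (Lp.aestronglyMeasurable _) (Lp.aestronglyMeasurable _) hq
        _ ≤ eLpNorm G q volume + 2⁻¹ * (2 * eLpNorm G q volume) := by
            gcongr
            exact (hSq _).trans (by gcongr)
        _ = 2 * eLpNorm G q volume := by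
            rw [← mul_assoc, ENNReal.inv_mul_cancel two_ne_zero ENNReal.ofNat_ne_top, one_mul,
              two_mul]
  obtain ⟨ns, -, hns⟩ :=
    (tendstoInMeasure_of_tendsto_Lp (tendsto_neumannIter hS hh)).exists_seq_tendsto_ae
  exact Lp.eLpNorm_le_of_ae_tendsto (u := atTop) (Eventually.of_forall fun k ↦ hn (ns k))
    (fun k ↦ Lp.aestronglyMeasurable _) hns

lemma tendsto_L2_of_lintegral_le {F : ℕ → L2 E} {F' : L2 E}
    (h : ∀ n : ℕ, ∫⁻ x, ‖F n x - F' x‖ₑ ^ 2 ≤ ENNReal.ofReal (1 / ((n : ℝ) + 1))) :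
    Tendsto F atTop (𝓝 F') := by
  rw [tendsto_iff_norm_sub_tendsto_zero]
  have hb : ∀ n, ‖F n - F'‖ ^ 2 ≤ 1 / ((n : ℝ) + 1) := by
    intro n
    rw [← ENNReal.ofReal_le_ofReal_iff (by positivity), ENNReal.ofReal_pow (by positivity),
      ofReal_norm, enorm_sq_Lp]
    refine le_trans (le_of_eq ?_) (h n)
    apply lintegral_congr_ae
    filter_upwards [Lp.coeFn_sub (F n) F'] with x hx
    rw [hx, Pi.sub_apply]
  have h2 : Tendsto (fun n ↦ ‖F n - F'‖ ^ 2) atTop (𝓝 0) :=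
    squeeze_zero (fun _ ↦ by positivity) hb tendsto_one_div_add_atTop_nhds_zero_nat
  simpa [Real.sqrt_sq (norm_nonneg _)] using h2.sqrt

lemma tendsto_eLpNorm_of_lintegral_le {p : ℝ} (hp : 1 ≤ p) {G : ℕ → E → ℂ} {G' : E → ℂ}
    (h : ∀ n : ℕ, ∫⁻ x, ‖G n x - G' x‖ₑ ^ p ≤ ENNReal.ofReal (1 / ((n : ℝ) + 1))) :
    Tendsto (fun n ↦ eLpNorm (G n - G') (ENNReal.ofReal p) volume) atTop (𝓝 0) := by
  have hp0 : 0 < p := by linarith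
  have h1 : Tendsto (fun n : ℕ ↦ ENNReal.ofReal (1 / ((n : ℝ) + 1)) ^ (1 / p)) atTop (𝓝 0) := by
    have := (ENNReal.tendsto_ofReal tendsto_one_div_add_atTop_nhds_zero_nat).ennrpow_const (1 / p)
    simpa [ENNReal.zero_rpow_of_pos (inv_pos.2 hp0)] using this
  refine tendsto_of_tendsto_of_tendsto_of_le_of_le tendsto_const_nhds h1 (fun _ ↦ zero_le)
    fun n ↦ ?_
  change eLpNorm (G n - G') (ENNReal.ofReal p) volume ≤ _
  rw [eLpNorm_eq_lintegral_rpow_enorm_toReal (by simpa using hp0) ENNReal.ofReal_ne_top,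
    ENNReal.toReal_ofReal hp0.le]
  exact ENNReal.rpow_le_rpow (h n) (by positivity)

/-- Regularity for the resolvent of a contraction which commutes with `(-Δ)^{τ/2}` up to
exchanging `S` by `S'`. -/
theorem exists_hasFracPow_of_eq_add_apply {τ : ℝ} (h0 : 0 ≤ τ) (h1 : τ ≤ 1) {p : ℝ} (hp : 1 < p)
    [Fact (1 ≤ ENNReal.ofReal p)] (hS : ‖S‖ ≤ 1 / 2) (hS' : ‖S'‖ ≤ 1 / 2)
    (hSS : ∀ F G, IsFracPow τ F G → IsFracPow τ (S F) (S' G))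
    (hSq : ∀ f : L2 E,
      eLpNorm (S' f) (ENNReal.ofReal p) volume ≤ 2⁻¹ * eLpNorm f (ENNReal.ofReal p) volume)
    {F w : L2 E} {G : Lp ℂ (ENNReal.ofReal p) (volume : Measure E)} (hFG : HasFracPow τ F G)
    (hw : w = F + S w) :
    ∃ h : Lp ℂ (ENNReal.ofReal p) (volume : Measure E), HasFracPow τ w h ∧ ‖h‖ ≤ 2 * ‖G‖ := by
  have hq : 1 ≤ ENNReal.ofReal p := Fact.out
  -- For the regularized data the solutions of both equations exist in `L²` and are related by
  -- `(-Δ)^{τ/2}`; in the limit only the derivative in `L^p` survives.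
  choose F' G' hFG' hF' hG' using fun n : ℕ ↦
    exists_isFracPow_near h0 h1 hp hFG (δ := 1 / ((n : ℝ) + 1)) (by positivity)
  have tF : Tendsto F' atTop (𝓝 F) := tendsto_L2_of_lintegral_le hF'
  have tG := tendsto_eLpNorm_of_lintegral_le hp.le hG'
  choose w' hw' using fun n ↦ exists_eq_add_apply hS (F' n)
  choose h' hh' using fun n ↦ exists_eq_add_apply hS' (G' n)
  have hfp : ∀ n, IsFracPow τ (w' n) (h' n) := fun n ↦
    isFracPow_of_eq_add_apply h0 h1 hS hS' hSS (hFG' n) (hw' n) (hh' n)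
  have tw : Tendsto w' atTop (𝓝 w) := by
    rw [tendsto_iff_norm_sub_tendsto_zero] at tF ⊢
    refine squeeze_zero (fun _ ↦ norm_nonneg _) (fun n ↦ ?_) (by simpa using tF.const_mul 2)
    refine norm_le_of_eq_add_apply hS ?_
    rw [map_sub]
    nth_rw 1 [hw' n]
    nth_rw 1 [hw]
    abel
  have mGG : ∀ n, MemLp (⇑(G' n) - ⇑G) (ENNReal.ofReal p) volume := by
    intro n
    refine ⟨(Lp.aestronglyMeasurable _).sub (Lp.aestronglyMeasurable _), ?_⟩
    rw [eLpNorm_lt_top_iff_lintegral_rpow_enorm_lt_top (by positivity) ENNReal.ofReal_ne_top,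
      ENNReal.toReal_ofReal (by linarith)]
    exact (hG' n).trans_lt ENNReal.ofReal_lt_top
  have mG : ∀ n, MemLp (G' n) (ENNReal.ofReal p) volume := fun n ↦ by
    simpa using (mGG n).add (Lp.memLp G)
  have mh : ∀ n, MemLp (h' n) (ENNReal.ofReal p) volume := fun n ↦
    ⟨Lp.aestronglyMeasurable _, (eLpNorm_le_of_eq_add_apply hq hS' hSq (hh' n)).trans_lt
      (ENNReal.mul_lt_top (by simp) (mG n).2)⟩
  have tG' : Tendsto (fun n ↦ (mG n).toLp _) atTop (𝓝 G) := by
    have := (Lp.tendsto_Lp_iff_tendsto_eLpNorm'' (fun n ↦ ⇑(G' n)) mG G (Lp.memLp G)).2 tG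
    rwa [Lp.toLp_coeFn] at this
  -- The derivatives `h' n` need not converge in `L²`, but the `L^p` bound of the resolvent makes
  -- them Cauchy in `L^p`.
  have hdist : ∀ m n, dist ((mh m).toLp _) ((mh n).toLp _) ≤
      2 * dist ((mG m).toLp _) ((mG n).toLp _) := by
    intro m n
    rw [dist_eq_norm, dist_eq_norm, ← MemLp.toLp_sub, ← MemLp.toLp_sub, Lp.norm_toLp,
      Lp.norm_toLp]
    have e : h' m - h' n = (G' m - G' n) + S' (h' m - h' n) := by
      rw [map_sub]
      nth_rw 1 [hh' m, hh' n]
      abel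
    have hle := eLpNorm_le_of_eq_add_apply hq hS' hSq e
    rw [eLpNorm_congr_ae (Lp.coeFn_sub _ _), eLpNorm_congr_ae (Lp.coeFn_sub _ _)] at hle
    have := ENNReal.toReal_mono
      (ENNReal.mul_ne_top ENNReal.ofNat_ne_top ((mG m).sub (mG n)).2.ne) hle
    simpa using this
  have hcau : CauchySeq (fun n ↦ (mh n).toLp _) := by
    have hcG := tG'.cauchySeq
    rw [Metric.cauchySeq_iff] at hcG ⊢
    intro ε hε
    obtain ⟨N, hN⟩ := hcG (ε / 2) (by positivity)
    exact ⟨N, fun m hm n hn ↦ (hdist m n).trans_lt (by linarith [hN m hm n hn])⟩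
  obtain ⟨h, hh⟩ := cauchySeq_tendsto_of_complete hcau
  refine ⟨h, hasFracPow_of_tendsto h0 h1 tw hh fun n η ↦ ?_, ?_⟩
  · rw [(hfp n).hasFracPow η]
    apply integral_congr_ae
    filter_upwards [(mh n).coeFn_toLp] with x hx
    rw [hx]
  · refine le_of_tendsto_of_tendsto' hh.norm (tG'.norm.const_mul 2) fun n ↦ ?_
    rw [Lp.norm_toLp, Lp.norm_toLp]
    have := ENNReal.toReal_mono (ENNReal.mul_ne_top ENNReal.ofNat_ne_top (mG n).2.ne)
      (eLpNorm_le_of_eq_add_apply hq hS' hSq (hh' n))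
    simpa using this

end Contraction

/-! ### Totality of fractional derivatives of test functions -/

/-- Plancherel for the pairing of a square-integrable function with `(-Δ)^{t/2} φ`, `η` being the
Fourier transform of `φ`. -/
lemma integral_mul_fourierInv_rpow {t : ℝ} (h0 : 0 ≤ t) (h1 : t ≤ 1) (w : L2 E) (η : 𝓢(E, ℂ)) :
    ∫ x, w x * 𝓕⁻ (fun ξ ↦ (((2 * Real.pi * ‖ξ‖) ^ t : ℝ) : ℂ) * η ξ) x =
      ∫ ξ, (((2 * Real.pi * ‖ξ‖) ^ t : ℝ) : ℂ) * (𝓕⁻ w : L2 E) ξ * η ξ := by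
  have hm := memLp_rpow_mul_schwartz h0 h1 η 2
  have hi := memLp_one_iff_integrable.1 (memLp_rpow_mul_schwartz h0 h1 η 1)
  calc _ = ∫ x, w x * (𝓕⁻ (hm.toLp _) : L2 E) x := by
        apply integral_congr_ae
        filter_upwards [fourierInv_toLp_ae hi hm] with x hx
        rw [hx]
    _ = _ := by
        rw [integral_mul_fourierInv]
        apply integral_congr_ae
        filter_upwards [hm.coeFn_toLp] with ξ hξ
        rw [hξ]
        ring

lemma fourier_comp_sub (φ : E → ℂ) (a ξ : E) :
    𝓕 (fun x ↦ φ (x - a)) ξ = ((Real.fourierChar (-inner ℝ a ξ) : Circle) : ℂ) * 𝓕 φ ξ := by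
  have h := congrFun (VectorFourier.fourierIntegral_comp_add_right Real.fourierChar
    (volume : Measure E) (innerₗ E) φ (-a)) ξ
  simp only [map_neg, LinearMap.neg_apply, innerₗ_apply_apply, Circle.smul_def, smul_eq_mul] at h
  have e : (fun x ↦ φ (x - a)) = φ ∘ fun v ↦ v + -a := by
    funext x
    rw [Function.comp_apply, sub_eq_add_neg]
  rw [e]
  exact h

/-- An integrable function whose Fourier transform vanishes is zero. -/
lemma ae_eq_zero_of_fourier_eq_zero {g : E → ℂ} (hg : Integrable g) (h : ∀ a, 𝓕 g a = 0) :
    g =ᵐ[volume] 0 := by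
  refine ae_eq_of_integral_mul_schwartz hg.locallyIntegrable
    (integrable_zero _ _ _).locallyIntegrable fun φ _ ↦ ?_
  have h1 : 𝓕 (𝓕⁻ φ) = φ := FourierInvPair.fourier_fourierInv_eq φ
  have h2 : ∫ x, (𝓕 g x) • (𝓕⁻ φ) x = ∫ x, g x • 𝓕 ((𝓕⁻ φ : 𝓢(E, ℂ)) : E → ℂ) x := by
    simpa using! (VectorFourier.integral_fourierIntegral_smul_eq_flip (L := innerₗ E)
      Real.continuous_fourierChar continuous_inner hg (𝓕⁻ φ).integrable)
  rw [← SchwartzMap.fourier_coe, h1] at h2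
  simpa [h] using h2.symm

/-- The Fourier transform of a mollifier of radius `r` is close to `1` at frequencies small compared
with `1 / r`. -/
lemma norm_fourier_sub_one_le {k : 𝓢(E, ℂ)} {r : ℝ} (hk : ∫⁻ x, ‖k x‖ₑ = 1)
    (hk1 : ∫ x, k x = 1) (hr : ∀ x, r < ‖x‖ → k x = 0) (ξ : E) :
    ‖(𝓕 k) ξ - 1‖ ≤ 2 * Real.pi * (r * ‖ξ‖) := by
  have hi : Integrable (fun x ↦ ((Real.fourierChar (-inner ℝ x ξ) : Circle) : ℂ) * k x) :=
    k.integrable.bdd_mul (c := 1) (Continuous.aestronglyMeasurable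
      (continuous_induced_dom.comp (by fun_prop : Continuous fun x : E ↦
        (Real.fourierChar (-inner ℝ x ξ) : Circle))))
      (Eventually.of_forall fun ξ ↦ (Circle.norm_coe _).le)
  have e : (𝓕 k) ξ - 1 = ∫ x, diffSymbol x ξ * k x := by
    rw [SchwartzMap.fourier_coe, Real.fourier_eq, ← hk1]
    simp only [Circle.smul_def, smul_eq_mul, diffSymbol, sub_mul, one_mul]
    rw [integral_sub hi k.integrable]
  have hn : ∫ x, ‖k x‖ = 1 := by
    rw [integral_norm_eq_lintegral_enorm k.continuous.aestronglyMeasurable, hk, ENNReal.toReal_one]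
  rw [e]
  calc _ ≤ ∫ x, 2 * Real.pi * (r * ‖ξ‖) * ‖k x‖ := by
        refine norm_integral_le_of_norm_le (k.integrable.norm.const_mul _)
          (Eventually.of_forall fun x ↦ ?_)
        rw [norm_mul]
        by_cases hx : r < ‖x‖
        · simp [hr x hx]
        · have := norm_diffSymbol_le x ξ
          have hp := Real.pi_pos
          gcongr
          refine this.trans ?_
          gcongr
          exact not_lt.1 hx
    _ = _ := by rw [integral_const_mul, hn, mul_one]

/-- The functions `(-Δ)^{s/2} φ` with `φ ∈ C_c^∞` are total in `L²`: a function orthogonal to all of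
them is also orthogonal to their translates, so its Fourier transform vanishes wherever the
transform of some `φ` does not, and mollifiers `φ` have transforms close to `1`. -/
lemma eq_zero_of_integral_rpow_mul_fourier [Nontrivial E] {s : ℝ} (h0 : 0 ≤ s) (h1 : s ≤ 1)
    {X : L2 E} (h : ∀ φ : 𝓢(E, ℂ), HasCompactSupport φ →
      ∫ ξ, (((2 * Real.pi * ‖ξ‖) ^ s : ℝ) : ℂ) * (𝓕⁻ X : L2 E) ξ * (𝓕 φ) ξ = 0) : X = 0 := by
  have key : ∀ φ : 𝓢(E, ℂ), HasCompactSupport φ → ∀ᵐ ξ,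
      (((2 * Real.pi * ‖ξ‖) ^ s : ℝ) : ℂ) * (𝓕⁻ X : L2 E) ξ * (𝓕 φ) ξ = 0 := by
    intro φ hφ
    refine ae_eq_zero_of_fourier_eq_zero ?_ fun a ↦ ?_
    · refine ((memLp_rpow_mul_schwartz h0 h1 (𝓕 φ) 2).integrable_mul
        (Lp.memLp (𝓕⁻ X : L2 E))).congr (Eventually.of_forall fun ξ ↦ ?_)
      simp only [Pi.mul_apply]
      ring
    · have hc : HasCompactSupport (φ.compSubConstCLM ℂ a) := by
        have := hφ.comp_homeomorph (Homeomorph.subRight a)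
        exact this
      rw [← h _ hc, Real.fourier_eq]
      congr 1 with ξ
      have e : (φ.compSubConstCLM ℂ a : E → ℂ) = fun x ↦ φ (x - a) := rfl
      rw [SchwartzMap.fourier_coe (φ.compSubConstCLM ℂ a), e, fourier_comp_sub,
        ← SchwartzMap.fourier_coe, Circle.smul_def, smul_eq_mul, real_inner_comm]
      ring
  choose k hk hk1 hkr using fun n : ℕ ↦
    exists_mollifier (E := E) (r := 1 / ((n : ℝ) + 1)) (by positivity)
  have hkc : ∀ n, HasCompactSupport (k n) := fun n ↦
    HasCompactSupport.intro (isCompact_closedBall 0 (1 / ((n : ℝ) + 1))) fun x hx ↦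
      hkr n x (by simpa using hx)
  have hX : (𝓕⁻ X : L2 E) =ᵐ[volume] 0 := by
    filter_upwards [ae_all_iff.2 fun n ↦ key (k n) (hkc n), Measure.ae_ne volume 0] with ξ hξ h0
    have ht : Tendsto (fun n : ℕ ↦ 2 * Real.pi * (1 / ((n : ℝ) + 1) * ‖ξ‖)) atTop (𝓝 0) := by
      simpa using ((tendsto_one_div_add_atTop_nhds_zero_nat (𝕜 := ℝ)).mul_const ‖ξ‖).const_mul
        (2 * Real.pi)
    obtain ⟨n, hn⟩ := (ht.eventually_lt_const one_pos).exists
    have hne : (𝓕 (k n)) ξ ≠ 0 := by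
      intro h
      have := norm_fourier_sub_one_le (hk n) (hk1 n) (hkr n) ξ
      rw [h, zero_sub, norm_neg, norm_one] at this
      linarith
    have hp : (((2 * Real.pi * ‖ξ‖) ^ s : ℝ) : ℂ) ≠ 0 := by
      rw [Complex.ofReal_ne_zero]
      positivity
    simpa [hne, hp] using hξ n
  have e : (𝓕⁻ X : L2 E) = 0 := (Lp.eq_zero_iff_ae_eq_zero).2 hX
  exact (map_eq_zero_iff (Lp.fourierTransformₗᵢ E ℂ).symm
    (Lp.fourierTransformₗᵢ E ℂ).symm.injective).1 e

/-- An `H^s` function has a square-integrable fractional derivative of order `s`. -/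
lemma exists_isFracPow_of_memSobolev {s : ℝ} (hs : 0 ≤ s) {u : L2 E}
    (hu : TemperedDistribution.MemSobolev s 2 (u : 𝓢'(E, ℂ))) : ∃ w : L2 E, IsFracPow s u w := by
  obtain ⟨v, hv⟩ := TemperedDistribution.memSobolev_iff_exists_smulLeftCLM_fourier.1 hu
  rw [Lp.fourier_toTemperedDistribution_eq] at hv
  have hg : (fun x : E ↦ (((1 + ‖x‖ ^ 2) ^ (s / 2) : ℝ) : ℂ)).HasTemperateGrowth := by fun_prop
  have hgc : Continuous (fun x : E ↦ (((1 + ‖x‖ ^ 2) ^ (s / 2) : ℝ) : ℂ)) := hg.1.continuous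
  have hvu : (v : E → ℂ) =ᵐ[volume] fun ξ ↦
      (((1 + ‖ξ‖ ^ 2) ^ (s / 2) : ℝ) : ℂ) * (𝓕 u : L2 E) ξ := by
    refine ae_eq_of_integral_mul_schwartz (locallyIntegrable_Lp _) ?_ fun φ _ ↦ ?_
    · rw [locallyIntegrable_iff]
      intro K hK
      exact ((locallyIntegrable_iff.1 (locallyIntegrable_Lp (𝓕 u : L2 E))) K hK).continuousOn_mul
        hgc.continuousOn hK
    · have := DFunLike.congr_fun hv φ
      rw [TemperedDistribution.smulLeftCLM_apply_apply, Lp.toTemperedDistribution_apply,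
        Lp.toTemperedDistribution_apply] at this
      simp only [smul_eq_mul] at this
      rw [← integral_congr_ae (Eventually.of_forall fun x ↦ mul_comm (φ x) (v x)), ← this]
      apply integral_congr_ae
      filter_upwards with ξ
      rw [SchwartzMap.smulLeftCLM_apply_apply hg, smul_eq_mul]
      ring
  have hm : Measurable (fun ξ : E ↦ (((2 * Real.pi * ‖ξ‖) ^ s : ℝ) : ℂ)) :=
    Complex.measurable_ofReal.comp (by fun_prop)
  have hL : MemLp (fun ξ ↦ (((2 * Real.pi * ‖ξ‖) ^ s : ℝ) : ℂ) * (𝓕⁻ u : L2 E) ξ) 2 := by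
    have hneg := Measure.measurePreserving_neg (volume : Measure E)
    refine MemLp.of_le_mul (c := (2 * Real.pi) ^ s)
      ((Lp.memLp v).comp_measurePreserving hneg)
      (hm.aestronglyMeasurable.mul (Lp.aestronglyMeasurable _)) ?_
    have hf := fourierInv_fourierInv_ae (𝓕 u : L2 E)
    have e : (𝓕⁻ (𝓕 u : L2 E) : L2 E) = u := (Lp.fourierTransformₗᵢ E ℂ).symm_apply_apply u
    rw [e] at hf
    filter_upwards [hf, hneg.quasiMeasurePreserving.ae hvu] with ξ h1 h2
    have hp := Real.pi_pos
    rw [Function.comp_apply, h2, h1, norm_mul, norm_mul, Complex.norm_real, Complex.norm_real,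
      Real.norm_of_nonneg (by positivity), Real.norm_of_nonneg (by positivity),
      Real.mul_rpow (by positivity) (by positivity), norm_neg, ← mul_assoc]
    gcongr
    calc ‖ξ‖ ^ s = (‖ξ‖ ^ 2) ^ (s / 2) := by
          rw [← Real.rpow_natCast, ← Real.rpow_mul (norm_nonneg _)]
          congr 1
          push_cast
          ring
      _ ≤ _ := by
          gcongr
          linarith
  refine ⟨𝓕 (hL.toLp _), ?_⟩
  have e : (𝓕⁻ (𝓕 (hL.toLp _) : L2 E) : L2 E) = hL.toLp _ :=
    (Lp.fourierTransformₗᵢ E ℂ).symm_apply_apply _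
  unfold IsFracPow
  rw [e]
  exact hL.coeFn_toLp

/-! ### Weak solutions as a perturbed identity -/

/-- The quadratic form of the coefficient `Λ (1 - ε κ)` in terms of the operator `incrOp κ`. -/
lemma integral_one_sub_mul_liftFun [Nontrivial E] {κ : E × E → ℝ} (hκ : Measurable κ)
    (hb : ∀ z, |κ z| ≤ 1) {s : ℝ} (hs : s ∈ Set.Ioo (0 : ℝ) 1) {γ : ℝ}
    (hγ : ∀ v w : L2 E, ∫ z, lift s hs v z * lift s hs w z = (γ : ℂ) * ∫ x, v x * w x)
    (Λ ε : ℝ) (w ψ : L2 E) :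
    ∫ z : E × E, ((Λ * (1 - ε * κ z) : ℝ) : ℂ) * liftFun s w z * liftFun s ψ z =
      Λ * (γ * (∫ x, w x * ψ x) - ε * ∫ x, incrOp κ hκ hb hs hs w x * ψ x) := by
  have hi : Integrable (fun z : E × E ↦ liftFun s w z * liftFun s ψ z) :=
    (memLp_liftFun hs w).integrable_mul (memLp_liftFun hs ψ)
  have hiκ : Integrable (fun z : E × E ↦ (κ z : ℂ) * liftFun s w z * liftFun s ψ z) := by
    simp_rw [mul_assoc]
    refine hi.bdd_mul (c := 1) (Complex.measurable_ofReal.comp hκ).aestronglyMeasurable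
      (Eventually.of_forall fun z ↦ ?_)
    rw [Complex.norm_real]
    exact hb z
  have e : ∫ z : E × E, liftFun s w z * liftFun s ψ z = γ * ∫ x, w x * ψ x := by
    rw [← hγ]
    apply integral_congr_ae
    filter_upwards [lift_ae_eq hs w, lift_ae_eq hs ψ] with z h1 h2
    rw [h1, h2]
  rw [integral_incrOp_mul hκ hb hs hs, incrForm, ← e, ← integral_const_mul (ε : ℂ),
    ← integral_sub hi (hiκ.const_mul _), ← integral_const_mul]
  congr 1 with z
  push_cast
  ring

/-- Regularity for the equation `γ w - ε T w = f / Λ`, when `ε / γ` times the norm of `T` on `L²`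
and on `L^p` is at most one half. -/
lemma exists_hasFracPow_of_smul_sub_incrOp [Nontrivial E] {κ : E × E → ℝ} (hκ : Measurable κ)
    (hb : ∀ z, |κ z| ≤ 1) {s s₁ s₂ τ p : ℝ} (hs : s ∈ Set.Ioo (0 : ℝ) 1)
    (h₁ : s₁ ∈ Set.Ioo (0 : ℝ) 1) (h₂ : s₂ ∈ Set.Ioo (0 : ℝ) 1) (hτ : 0 ≤ τ) (e₁ : s₁ = s + τ)
    (e₂ : s = s₂ + τ) (hp : 1 < p) [Fact (1 ≤ ENNReal.ofReal p)] {γ ε A B Λ : ℝ} (hγ : 0 < γ)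
    (hε : 0 ≤ ε) (hΛ : 0 < Λ) (hA : ‖incrOp κ hκ hb hs hs‖ ≤ A)
    (hA' : ‖incrOp κ hκ hb h₁ h₂‖ ≤ A)
    (hB : ∀ v : L2 E, eLpNorm (incrOp κ hκ hb h₁ h₂ v) (ENNReal.ofReal p) volume ≤
      ENNReal.ofReal B * eLpNorm v (ENNReal.ofReal p) volume)
    (hεA : ε * A ≤ γ / 2) (hεB : ε * B ≤ γ / 2) {w f : L2 E}
    {g : Lp ℂ (ENNReal.ofReal p) (volume : Measure E)}
    (heq : (γ : ℂ) • w - (ε : ℂ) • incrOp κ hκ hb hs hs w = (Λ : ℂ)⁻¹ • f)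
    (hfg : HasFracPow τ f g) :
    ∃ h : Lp ℂ (ENNReal.ofReal p) (volume : Measure E), HasFracPow τ w h ∧
      ‖h‖ ≤ 2 / (γ * Λ) * ‖g‖ := by
  have hγε : ∀ a : ℝ, ε * a ≤ γ / 2 → ε / γ * a ≤ 1 / 2 := by
    intro a h
    rw [div_mul_eq_mul_div, div_le_iff₀ hγ]
    linarith
  have hnorm : ‖((ε / γ : ℝ) : ℂ)‖ = ε / γ := by
    rw [Complex.norm_real, Real.norm_of_nonneg (by positivity)]
  have hcontr : ∀ T : L2 E →L[ℂ] L2 E, ‖T‖ ≤ A → ‖((ε / γ : ℝ) : ℂ) • T‖ ≤ 1 / 2 := by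
    intro T hT
    rw [norm_smul, hnorm]
    exact (mul_le_mul_of_nonneg_left hT (by positivity)).trans (hγε A hεA)
  have hSq : ∀ v : L2 E, eLpNorm ((((ε / γ : ℝ) : ℂ) • incrOp κ hκ hb h₁ h₂) v)
      (ENNReal.ofReal p) volume ≤ 2⁻¹ * eLpNorm v (ENNReal.ofReal p) volume := by
    intro v
    rw [smul_apply, eLpNorm_congr_ae (Lp.coeFn_smul _ _), eLpNorm_const_smul]
    calc _ ≤ ENNReal.ofReal (ε / γ) *
          (ENNReal.ofReal B * eLpNorm v (ENNReal.ofReal p) volume) := by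
          rw [← ofReal_norm, hnorm]
          exact mul_le_mul' le_rfl (hB v)
      _ ≤ _ := by
          rw [← mul_assoc, ← ENNReal.ofReal_mul (by positivity)]
          refine mul_le_mul' ?_ le_rfl
          refine (ENNReal.ofReal_le_ofReal (hγε _ hεB)).trans (le_of_eq ?_)
          rw [one_div, ENNReal.ofReal_inv_of_pos two_pos, ENNReal.ofReal_ofNat]
  have hint : ∀ F G : L2 E, IsFracPow τ F G →
      IsFracPow τ ((((ε / γ : ℝ) : ℂ) • incrOp κ hκ hb hs hs) F)
        ((((ε / γ : ℝ) : ℂ) • incrOp κ hκ hb h₁ h₂) G) := by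
    intro F G h
    rw [smul_apply, smul_apply]
    exact (h.incrOp hκ hb hs h₁ h₂ hτ e₁ e₂).smul _
  obtain ⟨h, hh, hle⟩ := exists_hasFracPow_of_eq_add_apply hτ (by linarith [hs.1, h₁.2]) hp
    (hcontr _ hA) (hcontr _ hA') hint hSq (hfg.const_smul ((γ * Λ : ℝ) : ℂ)⁻¹)
    (eq_add_apply_of_smul_sub_eq hγ.ne' heq)
  refine ⟨h, hh, hle.trans (le_of_eq ?_)⟩
  rw [norm_smul, norm_inv, Complex.norm_real, Real.norm_of_nonneg (by positivity), ← mul_assoc,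
    div_eq_mul_inv]

section Euclidean

variable {n : ℕ}

/-- The distributional fractional Laplacian with Schwartz test functions `φ` in space, and with
test functions `η = 𝓕 φ` in frequency. -/
lemma hasFracLaplacian_iff {q : ℝ≥0∞} {t : ℝ} (h0 : 0 ≤ t) (h1 : t ≤ 1)
    {w : L2 (EuclideanSpace ℝ (Fin n))}
    {g : Lp ℂ q (volume : Measure (EuclideanSpace ℝ (Fin n)))} :
    HasFracLaplacian t w g ↔ HasFracPow t w g := by
  have e : ∀ φ : 𝓢(EuclideanSpace ℝ (Fin n), ℂ), ∫ x, w x * fracLaplacian t φ x =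
      ∫ ξ, (((2 * Real.pi * ‖ξ‖) ^ t : ℝ) : ℂ) * (𝓕⁻ w : L2 _) ξ * (𝓕 φ) ξ := by
    intro φ
    rw [← integral_mul_fourierInv_rpow h0 h1, SchwartzMap.fourier_coe]
    rfl
  constructor
  · intro h η
    have h2 := h (𝓕⁻ η)
    rwa [e, show 𝓕 (𝓕⁻ η) = η from FourierInvPair.fourier_fourierInv_eq η] at h2
  · intro h φ
    rw [e, h (𝓕 φ), show 𝓕⁻ (𝓕 φ) = φ from FourierPair.fourierInv_fourier_eq φ]

/-- In the coordinates `(h, x) = (x' - x, x)`, the nonlocal form is an integral of lifts. -/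
lemma nonlocalForm_eq [Nontrivial (EuclideanSpace ℝ (Fin n))] {s : ℝ}
    (hs : s ∈ Set.Ioo (0 : ℝ) 1)
    {K : EuclideanSpace ℝ (Fin n) × EuclideanSpace ℝ (Fin n) → ℝ} (hK : Measurable K)
    {u w ψ : L2 (EuclideanSpace ℝ (Fin n))} {φ : 𝓢(EuclideanSpace ℝ (Fin n), ℂ)}
    (hu : IsFracPow s u w) (hφ : IsFracPow s (φ.toLp 2) ψ) :
    nonlocalForm s K u φ = ∫ z : EuclideanSpace ℝ (Fin n) × EuclideanSpace ℝ (Fin n),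
      (K (z.1 + z.2, z.2) : ℂ) * liftFun s w z * liftFun s ψ z := by
  set I : EuclideanSpace ℝ (Fin n) × EuclideanSpace ℝ (Fin n) → ℂ := fun z ↦
    (K z : ℂ) * (u z.1 - u z.2) * (φ z.1 - φ z.2) / ((‖z.1 - z.2‖ ^ ((n : ℝ) + 2 * s) : ℝ) : ℂ)
  have hum := measurable_coeFn_Lp u
  have hφm := φ.continuous.measurable
  have hI : Measurable I := by
    refine Measurable.div ?_ (Complex.measurable_ofReal.comp (by fun_prop))
    exact (((Complex.measurable_ofReal.comp hK).mul ((hum.comp measurable_fst).sub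
      (hum.comp measurable_snd))).mul ((hφm.comp measurable_fst).sub (hφm.comp measurable_snd)))
  have mp := measurePreserving_add_prod (volume : Measure (EuclideanSpace ℝ (Fin n)))
    (volume : Measure (EuclideanSpace ℝ (Fin n)))
  have hmap := integral_map (μ := (volume : Measure (EuclideanSpace ℝ (Fin n))).prod volume) mp.measurable.aemeasurable
    (f := I) hI.aestronglyMeasurable
  rw [mp.map_eq] at hmap
  have hadd : Measurable (fun z : EuclideanSpace ℝ (Fin n) × EuclideanSpace ℝ (Fin n) ↦
      (z.1 + z.2, z.2)) := by fun_prop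
  have hm := fun (w : L2 (EuclideanSpace ℝ (Fin n))) ↦ measurable_liftFun s (measurable_coeFn_Lp w)
  have hae : ∀ᵐ z : EuclideanSpace ℝ (Fin n) × EuclideanSpace ℝ (Fin n),
      I (z.1 + z.2, z.2) = (K (z.1 + z.2, z.2) : ℂ) * liftFun s w z * liftFun s ψ z := by
    rw [Measure.volume_eq_prod]
    refine (Measure.ae_prod_iff_ae_ae (measurableSet_eq_fun (hI.comp hadd)
      (((Complex.measurable_ofReal.comp (hK.comp hadd)).mul (hm _)).mul (hm _)))).2 ?_
    filter_upwards [Measure.ae_ne volume 0] with h hh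
    have hφ2 := φ.coeFn_toLp 2 (volume : Measure (EuclideanSpace ℝ (Fin n)))
    filter_upwards [potIncr_ae_eq_sub hs.1 hs.2 hu h, potIncr_ae_eq_sub hs.1 hs.2 hφ h, hφ2,
      (measurePreserving_add_right volume h).quasiMeasurePreserving.ae hφ2] with x h1 h2 h3 h4
    change I (h + x, x) = (K (h + x, x) : ℂ) * liftFun s w (h, x) * liftFun s ψ (h, x)
    simp only [I, liftFun]
    rw [h1, h2, h3, h4, add_sub_cancel_right, add_comm h x, div_eq_mul_inv, ← Complex.ofReal_inv,
      ← Real.rpow_neg (norm_nonneg _), finrank_euclideanSpace_fin]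
    have e : ‖h‖ ^ (-((n : ℝ) + 2 * s)) =
        ‖h‖ ^ (-((n : ℝ) / 2 + s)) * ‖h‖ ^ (-((n : ℝ) / 2 + s)) := by
      rw [← Real.rpow_add (by positivity)]
      congr 1
      ring
    rw [e]
    push_cast
    ring
  exact hmap.trans (integral_congr_ae hae)

/-- A weak solution satisfies the equation `γ w - ε T w = f / Λ` for its fractional derivative
`w`, where `T` is the operator of the normalized oscillation `κ` of the coefficient. -/
lemma smul_sub_incrOp_eq [Nontrivial (EuclideanSpace ℝ (Fin n))] {s : ℝ}
    (hs : s ∈ Set.Ioo (0 : ℝ) 1)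
    {K κ : EuclideanSpace ℝ (Fin n) × EuclideanSpace ℝ (Fin n) → ℝ} (hK : Measurable K)
    (hκ : Measurable κ) (hb : ∀ z, |κ z| ≤ 1) {Λ ε : ℝ} (hΛ : Λ ≠ 0)
    (hKκ : ∀ z, K (z.1 + z.2, z.2) = Λ * (1 - ε * κ z)) {γ : ℝ}
    (hγ : ∀ v w : L2 (EuclideanSpace ℝ (Fin n)),
      ∫ z, lift s hs v z * lift s hs w z = (γ : ℂ) * ∫ x, v x * w x)
    {u f w : L2 (EuclideanSpace ℝ (Fin n))} (hw : IsFracPow s u w) (hsol : IsWeakSolution s K u f) :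
    (γ : ℂ) • w - (ε : ℂ) • incrOp κ hκ hb hs hs w = (Λ : ℂ)⁻¹ • f := by
  rw [← sub_eq_zero]
  -- It suffices to test with `ψ = (-Δ)^{s/2} φ`, for which the form is that of the weak equation.
  refine eq_zero_of_integral_rpow_mul_fourier hs.1.le hs.2.le fun φ hφ ↦ ?_
  have hm := memLp_rpow_mul_schwartz hs.1.le hs.2.le (𝓕 φ) 2
  set ψ : L2 (EuclideanSpace ℝ (Fin n)) := 𝓕⁻ (hm.toLp _) with hψ
  have e : ∀ X : L2 (EuclideanSpace ℝ (Fin n)), ∫ x, X x * ψ x =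
      ∫ ξ, (((2 * Real.pi * ‖ξ‖) ^ s : ℝ) : ℂ) * (𝓕⁻ X : L2 _) ξ * (𝓕 φ) ξ := by
    intro X
    rw [hψ, integral_mul_fourierInv]
    apply integral_congr_ae
    filter_upwards [hm.coeFn_toLp] with ξ hξ
    rw [hξ]
    ring
  have hφψ : IsFracPow s (φ.toLp 2) ψ := by
    have := isFracPow_schwartz hm.coeFn_toLp
    rwa [show 𝓕⁻ (𝓕 φ) = φ from FourierPair.fourierInv_fourier_eq φ] at this
  have h := hsol φ hφ
  have hf : ∫ x, f x * fracLaplacian s φ x = ∫ x, f x * ψ x := by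
    rw [e, ← integral_mul_fourierInv_rpow hs.1.le hs.2.le, SchwartzMap.fourier_coe]
    rfl
  rw [nonlocalForm_eq hs hK hw hφψ, hf] at h
  simp_rw [hKκ] at h
  rw [integral_one_sub_mul_liftFun hκ hb hs hγ] at h
  rw [← e]
  simp only [← inner_star_Lp] at h ⊢
  rw [inner_sub_right, inner_sub_right, inner_smul_right, inner_smul_right, inner_smul_right, ← h,
    inv_mul_cancel_left₀ (Complex.ofReal_ne_zero.2 hΛ), sub_self]

end Euclidean

end NonlocalCZ

end

theorem theorem1p4 (n : ℕ) (hn : 0 < n) (θ : ℝ) (hθ : 0 < θ) :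
    ∃ ε : ℝ, 0 < ε ∧
      ∀ s s₁ s₂ p : ℝ, s ∈ Set.Ioo θ (1 - θ) → s₁ ∈ Set.Ioo θ (1 - θ) →
        s₂ ∈ Set.Ioo θ (1 - θ) → s₁ + s₂ = 2 * s → s ≤ s₁ → p ∈ Set.Ico 2 (1 / θ) →
        ∃ C : ℝ, 0 < C ∧
          ∀ K : EuclideanSpace ℝ (Fin n) × EuclideanSpace ℝ (Fin n) → ℝ,
            Measurable K → (∀ z, 0 ≤ K z) → BddAbove (Set.range K) → 0 < (⨆ z, K z) →
            1 - (⨅ z, K z) / (⨆ z, K z) < ε →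
            ∀ u f : Lp ℂ 2 (volume : Measure (EuclideanSpace ℝ (Fin n))),
              TemperedDistribution.MemSobolev s 2 (u : 𝓢'(EuclideanSpace ℝ (Fin n), ℂ)) →
              IsWeakSolution s K u f →
              ∀ g : Lp ℂ (ENNReal.ofReal p) (volume : Measure (EuclideanSpace ℝ (Fin n))),
                HasFracLaplacian (s - s₂) f g →
                ∃ h : Lp ℂ (ENNReal.ofReal p) (volume : Measure (EuclideanSpace ℝ (Fin n))),
                  HasFracLaplacian s₁ u h ∧ ‖h‖ ≤ C / (⨆ z, K z) * ‖g‖ := by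
  have : Nonempty (Fin n) := ⟨⟨0, hn⟩⟩
  have : Nontrivial (EuclideanSpace ℝ (Fin n)) := inferInstance
  obtain ⟨c, c', hc, -, hlift⟩ :=
    NonlocalCZ.exists_integral_lift_mul (E := EuclideanSpace ℝ (Fin n)) hθ
  obtain ⟨A, hA, hbA⟩ := NonlocalCZ.exists_norm_incrOp_le (E := EuclideanSpace ℝ (Fin n)) hθ
  obtain ⟨B, hB, hbB⟩ := NonlocalCZ.exists_eLpNorm'_incrOp_le (E := EuclideanSpace ℝ (Fin n)) hθ
  have hB0 : 0 ≤ B.toReal := ENNReal.toReal_nonneg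
  -- With this choice `ε / γ` times the operator of a coefficient bounded by one is a contraction
  -- by one half, both in `L²` and in `L^p`.
  set ε : ℝ := c / (2 * (A + B.toReal)) with hε
  have hε0 : 0 < ε := by positivity
  have hεA : ε * A ≤ c / 2 := by
    rw [hε, div_mul_eq_mul_div, div_le_iff₀ (by positivity)]
    nlinarith
  have hεB : ε * B.toReal ≤ c / 2 := by
    rw [hε, div_mul_eq_mul_div, div_le_iff₀ (by positivity)]
    nlinarith
  refine ⟨ε, hε0, fun s s₁ s₂ p hs h₁ h₂ hsum hss hp ↦ ⟨2 / c, by positivity, ?_⟩⟩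
  intro K hK hK0 hbdd hΛ hosc u f hu hsol g hg
  have hIoo : ∀ σ ∈ Set.Ioo θ (1 - θ), σ ∈ Set.Ioo (0 : ℝ) 1 := fun σ hσ ↦
    ⟨hθ.trans hσ.1, by linarith [hσ.2]⟩
  have hs' := hIoo s hs
  have h₁' := hIoo s₁ h₁
  have h₂' := hIoo s₂ h₂
  have hp2 : 2 ≤ p := hp.1
  have : Fact (1 ≤ ENNReal.ofReal p) := ⟨by rw [ENNReal.one_le_ofReal]; linarith⟩
  set Λ : ℝ := ⨆ z, K z with hΛ_def
  obtain ⟨γ, hcγ, -, hγ⟩ := hlift s hs' hs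
  have hγ0 : 0 < γ := hc.trans_le hcγ
  -- The normalized oscillation of the coefficient, in the coordinates `(x' - x, x)`.
  obtain ⟨κ, hκ_def⟩ : ∃ κ : EuclideanSpace ℝ (Fin n) × EuclideanSpace ℝ (Fin n) → ℝ,
      κ = fun z ↦ (1 - K (z.1 + z.2, z.2) / Λ) / ε := ⟨_, rfl⟩
  have hκ : Measurable κ := by
    rw [hκ_def]
    exact (measurable_const.sub ((hK.comp (by fun_prop)).div_const Λ)).div_const ε
  have hb : ∀ z, |κ z| ≤ 1 := by
    intro z
    have hle : K (z.1 + z.2, z.2) / Λ ≤ 1 := (div_le_one hΛ).2 (le_ciSup hbdd _)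
    have hge : (⨅ z, K z) / Λ ≤ K (z.1 + z.2, z.2) / Λ := by
      gcongr
      exact ciInf_le ⟨0, by rintro _ ⟨z, rfl⟩; exact hK0 z⟩ _
    rw [hκ_def, abs_of_nonneg (div_nonneg (by linarith) hε0.le), div_le_one hε0]
    linarith
  have hKκ : ∀ z : EuclideanSpace ℝ (Fin n) × EuclideanSpace ℝ (Fin n),
      K (z.1 + z.2, z.2) = Λ * (1 - ε * κ z) := by
    intro z
    simp only [hκ_def]
    field_simp
    ring
  obtain ⟨w, hw⟩ := NonlocalCZ.exists_isFracPow_of_memSobolev hs'.1.le hu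
  have heq := NonlocalCZ.smul_sub_incrOp_eq hs' hK hκ hb hΛ.ne' hKκ hγ hw hsol
  set τ : ℝ := s₁ - s with hτ
  have hτ0 : 0 ≤ τ := by linarith
  have hτ1 : τ ≤ 1 := by linarith [h₁'.2, hs'.1]
  have hgf : NonlocalCZ.HasFracPow τ f g := by
    have e : s - s₂ = τ := by linarith
    rw [e] at hg
    exact (NonlocalCZ.hasFracLaplacian_iff hτ0 hτ1).1 hg
  have hp0 : ENNReal.ofReal p ≠ 0 := by
    rw [ne_eq, ENNReal.ofReal_eq_zero, not_le]
    linarith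
  obtain ⟨h, hh, hle⟩ := NonlocalCZ.exists_hasFracPow_of_smul_sub_incrOp hκ hb hs' h₁' h₂' hτ0
    (by linarith) (by linarith) (by linarith) hγ0 hε0.le hΛ
    (hbA κ hκ hb s s _ _ hs hs) (hbA κ hκ hb s₁ s₂ _ _ h₁ h₂) (B := B.toReal) (fun v ↦ by
      rw [eLpNorm_eq_eLpNorm' hp0 ENNReal.ofReal_ne_top,
        eLpNorm_eq_eLpNorm' hp0 ENNReal.ofReal_ne_top, ENNReal.toReal_ofReal (by linarith),
        ENNReal.ofReal_toReal hB]
      exact hbB κ hκ hb s₁ s₂ _ _ h₁ h₂ p hp v)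
    (by linarith) (by linarith) heq hgf
  refine ⟨h, (NonlocalCZ.hasFracLaplacian_iff h₁'.1.le h₁'.2.le).2 fun η ↦ ?_, hle.trans ?_⟩
  · rw [← hh η]
    apply integral_congr_ae
    filter_upwards [hw, Measure.ae_ne volume 0] with ξ hξ h0
    rw [hξ, ← mul_assoc, ← Complex.ofReal_mul, ← Real.rpow_add (by positivity), hτ,
      sub_add_cancel]
  · rw [div_div]
    gcongr
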